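/- **Setting.** A *graph* (with legs) is a finite set $X(\Gamma)$ with an idempotent root map $r$ and an involution $\iota$ fixing the image of $r$; the vertices are the image of $r$, the other elements are half-edges, and the $\iota$-orbits of half-edges of size 2 and 1 are the edges and the legs. Graphs may be disconnected. A *weighted metric graph* has vertex genera $g(v)\in\mathbb Z_{\ge0}$ and edge lengths $\ell(e)>0$. Its realization $|\Gamma|$ is obtained by gluing intervals $[0,\ell(e)]$ for the edges and $[0,\infty)$ for the legs, with the path metric (infinite between different components). A *tropical curve* $X$ is a metric space with a function $g:X\to\mathbb Z_{\ge 0}$ that is isometric to some $|\Gamma|$ (a *model* of $X$), with $g$ equal to the genus at the vertices and $0$ elsewhere. A *finite harmonic morphism* of weighted metric graphs is a map $\varphi:X(\Gamma')\to X(\Gamma)$ commuting with $r$ and $\iota$, sending edges to edges and legs to legs, with degrees $d(x')\in\mathbb Z_{>0}$, equal on the two halves of an edge, such that $\ell(\varphi(e'))=d(e')\ell(e')$ and $d(v')=\sum_{r(h')=v',\,\varphi(h')=h}d(h')$ for every vertex $v'$ and every half-edge $h$ rooted at $\varphi(v')$. It is *unramified* if $d(v')\chi(\varphi(v'))=\chi(v')$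 for all vertices $v'$, where $\chi(v)=2-2g(v)-\mathrm{val}(v)$. A map of tropical curves with a local degree function is finite harmonic (unramified) if it is induced, on suitable models, by such a morphism. Let $G$ be a finite abelian group. A *$G$-cover* of $X$ is a finite harmonic morphism $\tau:X'\to X$ with an action of $G$ on $X'$ by automorphisms that preserve $\tau$ and its local degrees, transitive on each fiber, such that the local degrees over each point of $X$ sum to $\#G$. $G$-covers are considered up to $G$-equivariant isomorphism of tropical curves over $X$. A *$G$-stratification* of $X$ is a family of subcurves $\mathcal S=\{X_H\}$ (realizations of possibly empty subgraphs of models) indexed by the subgroups $H\subseteq G$, with $X_0=X$, $X_K\subseteq X_H$ if $H\subseteq K$, and $X_H\cap X_K=X_{H+K}$. Let $D(x)$ be the largest $H$ with $x\in X_H$, and let $a_{\mathcal S}(x;K)$ be the number of connected components of $\{y: D(y)=K\}\cap U$ for a sufficiently small punctured neighborhood $U$ of $x$. $\mathcal S$ is *admissible* if for every $x\in X$ the number $$g'_{\mathcal S}(x)=\#D(x)\,[g(x)-1]+1+\tfrac12\sum_{K\subseteq D(x)}a_{\mathcal S}(x;K)\big(\#D(x)-[D(x):K]\big)$$ is a non-negative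 integer. For an oriented model $\Gamma$ of $X$ in which every $X_H$ is a subgraph, put $C(e)=D(s(e))+D(t(e))$ for every edge $e$ with source $s(e)$ and target $t(e)$. The *dilated cohomology group* $H^1(X,\mathcal S)$ is the cokernel of $$\prod_v G/D(v)\to\prod_e G/C(e),\qquad \xi\mapsto\big(\xi(t(e))-\xi(s(e))\big)_e .$$ To a $G$-cover $\tau$ one attaches: its stratification $\mathcal S_\tau$, where $X_H$ is the set of points over which the stabilizers contain $H$; the function $g'_\tau$ on $X$ sending $x$ to the common genus of the points of $\tau^{-1}(x)$; and a class $\eta_\tau\in H^1(X,\mathcal S_\tau)$: choose a point $y_v\in\tau^{-1}(v)$ for each vertex $v$ and a lift to $X'$ of each closed edge $e$, with initial point $a_e\cdot y_{s(e)}$ and final point $b_e\cdot y_{t(e)}$ ($a_e,b_e\in G$), and let $\eta_\tau$ be the class of $(a_e-b_e)_e$. **Theorem.** Let $X$ be a tropical curve and $G$ a finite abelian group. 1. The assignment $\tau\mapsto(\mathcal S_\tau,\eta_\tau,g'_\tau)$ is well defined and is a bijection from the set of isomorphism classes of $G$-covers of $X$ to the set of triples $(\mathcal S,\eta,g')$,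 where $\mathcal S$ is a $G$-stratification of $X$, $\eta\in H^1(X,\mathcal S)$, and $g':X\to\mathbb Z_{\ge0}$ is a function vanishing outside a finite set. 2. A $G$-cover $\tau$ is unramified if and only if $\mathcal S_\tau$ is admissible and $g'_\tau=g'_{\mathcal S_\tau}$. 3. For every admissible $G$-stratification $\mathcal S$ of $X$, the map $\tau\mapsto\eta_\tau$ is a bijection from the set of isomorphism classes of unramified $G$-covers of $X$ with $\mathcal S_\tau=\mathcal S$ to $H^1(X,\mathcal S)$. Here $H^1(X,\mathcal S)$ does not depend on the oriented model: for any other such model there is a group isomorphism between the two groups carrying the classes $\eta_\tau$ computed in one model to those computed in the other, for all $G$-covers $\tau$ with $\mathcal S_\tau=\mathcal S$. -/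

import Mathlib

open Filter Topology
open scoped ENNReal

universe u v

/-! ### Graphs with legs -/

/-- A (finite) graph with legs: a finite set with an idempotent root map `r` and an involution `ι`
fixing the image of `r`. -/
structure LegGraph where
  X : Type
  [finite : Finite X]
  r : X → X
  ι : X → X
  r_r : ∀ x, r (r x) = r x
  ι_ι : ∀ x, ι (ι x) = x
  ι_r : ∀ x, ι (r x) = r x

namespace LegGraph

variable (Γ : LegGraph)

/-- Vertices are the elements of the image of `r`, that is, the fixed points of the idempotent
map `r`. -/
def IsVertex (x : Γ.X) : Prop := Γ.r x = x

/-- Half-edges are the elements that are not vertices. -/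
def IsHalfEdge (h : Γ.X) : Prop := Γ.r h ≠ h

/-- `h` is one of the two half-edges of an edge `{h, ι h}`. -/
def IsEdge (h : Γ.X) : Prop := Γ.IsHalfEdge h ∧ Γ.ι h ≠ h

/-- `h` is a leg. -/
def IsLeg (h : Γ.X) : Prop := Γ.IsHalfEdge h ∧ Γ.ι h = h

/-- The set of vertices. -/
abbrev V : Type := {x : Γ.X // Γ.IsVertex x}

/-- The set of half-edges. -/
abbrev H : Type := {h : Γ.X // Γ.IsHalfEdge h}

/-- The root vertex of an element. -/
def root (x : Γ.X) : Γ.V := ⟨Γ.r x, Γ.r_r x⟩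

theorem isHalfEdge_ι {h : Γ.X} (hh : Γ.IsHalfEdge h) : Γ.IsHalfEdge (Γ.ι h) := by
  intro h0
  apply hh
  have h1 : Γ.ι (Γ.ι h) = Γ.ι h := by
    conv_lhs => rw [← h0]
    rw [Γ.ι_r, h0]
  rw [Γ.ι_ι] at h1
  rw [← h1] at h0
  exact h0

theorem isEdge_ι {h : Γ.X} (hh : Γ.IsEdge h) : Γ.IsEdge (Γ.ι h) :=
  ⟨Γ.isHalfEdge_ι hh.1, by rw [Γ.ι_ι]; exact fun h0 => hh.2 h0.symm⟩

/-- The involution on half-edges. -/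
def flip (h : Γ.H) : Γ.H := ⟨Γ.ι h.1, Γ.isHalfEdge_ι h.2⟩

/-- The tangent space at a vertex: the half-edges rooted at it. -/
def tangent (v : Γ.V) : Set Γ.X := {h | Γ.IsHalfEdge h ∧ Γ.r h = v.1}

/-- The valency of a vertex. -/
noncomputable def valency (v : Γ.V) : ℕ := (Γ.tangent v).ncard

/-- A subgraph: a subset closed under the root map and the involution. -/
structure Subgraph where
  carrier : Set Γ.X
  r_mem : ∀ x ∈ carrier, Γ.r x ∈ carrier
  ι_mem : ∀ x ∈ carrier, Γ.ι x ∈ carrier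

/-- An orientation: exactly one half-edge `h` is selected from each edge `{h, ι h}`. The edge is
then ordered as `(h, ι h)`, its source is the root of `h`, its target the root of `ι h`. -/
structure Orientation where
  edges : Set Γ.X
  isEdge : ∀ h ∈ edges, Γ.IsEdge h
  mem_iff : ∀ h, Γ.IsEdge h → (h ∈ edges ↔ Γ.ι h ∉ edges)

theorem nonempty_orientation : Nonempty Γ.Orientation := by
  classical
  let ord : Γ.X → Γ.X → Prop := WellOrderingRel
  refine ⟨⟨{h | Γ.IsEdge h ∧ ord h (Γ.ι h)}, fun h hh => hh.1, fun h hh => ?_⟩⟩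
  simp only [Set.mem_ofPred_eq, Γ.ι_ι, hh, Γ.isEdge_ι hh, true_and]
  constructor
  · exact fun h1 h2 => asymm_of (α := Γ.X) WellOrderingRel h1 h2
  · intro h1
    rcases trichotomous_of (α := Γ.X) WellOrderingRel h (Γ.ι h) with h2 | h2 | h2
    · exact h2
    · exact absurd h2.symm hh.2
    · exact absurd h2 h1

namespace Orientation

variable {Γ}

/-- Source vertex of an oriented edge. -/
def source (o : Γ.Orientation) (e : o.edges) : Γ.V := Γ.root e.1

/-- Target vertex of an oriented edge. -/
def target (o : Γ.Orientation) (e : o.edges) : Γ.V := Γ.root (Γ.ι e.1)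

/-- An oriented edge, given by its selected half-edge. -/
def half (o : Γ.Orientation) (e : o.edges) : Γ.H := ⟨e.1, (o.isEdge e.1 e.2).1⟩

end Orientation

end LegGraph

/-! ### Dilation data and dilated cohomology of a graph -/

/-- A `G`-dilation datum on a graph. -/
structure DilationDatum (G : Type v) [AddCommGroup G] (Γ : LegGraph) where
  D : Γ.X → AddSubgroup G
  le_root : ∀ h, Γ.IsHalfEdge h → D h ≤ D (Γ.r h)
  flip_eq : ∀ h, Γ.IsEdge h → D (Γ.ι h) = D h

namespace DilationDatum

variable {G : Type v} [AddCommGroup G] {Γ : LegGraph} (D : DilationDatum G Γ)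
  (o : Γ.Orientation)

/-- The vertex dilation group `C(e) = D(s(e)) + D(t(e))` of an edge. -/
def C (e : o.edges) : AddSubgroup G := D.D (o.source e).1 ⊔ D.D (o.target e).1

/-- `C⁰(Γ, D) = ∏_v G / D(v)`. -/
abbrev C0 : Type v := ∀ w : Γ.V, G ⧸ D.D w.1

/-- `C¹(Γ, D) = ∏_e G / C(e)`. -/
abbrev C1 : Type v := ∀ e : o.edges, G ⧸ D.C o e

/-- The natural projection `G / D(s(e)) → G / C(e)`. -/
def sourceMap (e : o.edges) : (G ⧸ D.D (o.source e).1) →+ G ⧸ D.C o e :=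
  QuotientAddGroup.map _ _ (AddMonoidHom.id G) (fun _ hx => (le_sup_left : _ ≤ D.C o e) hx)

/-- The natural projection `G / D(t(e)) → G / C(e)`. -/
def targetMap (e : o.edges) : (G ⧸ D.D (o.target e).1) →+ G ⧸ D.C o e :=
  QuotientAddGroup.map _ _ (AddMonoidHom.id G) (fun _ hx => (le_sup_right : _ ≤ D.C o e) hx)

/-- The coboundary map `δ(ξ)(e) = ξ(t(e)) - ξ(s(e))`. -/
def coboundary : D.C0 →+ D.C1 o where
  toFun ξ e := D.targetMap o e (ξ (o.target e)) - D.sourceMap o e (ξ (o.source e))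
  map_zero' := by
    funext e
    simp
  map_add' ξ ζ := by
    funext e
    simp only [Pi.add_apply, map_add]
    abel

/-- The dilated cohomology group `H¹(Γ, D) = Coker δ`. -/
abbrev H1 : Type v := D.C1 o ⧸ (D.coboundary o).range

end DilationDatum

/-! ### Weighted metric graphs and their metric realizations -/

/-- A weighted metric graph. The length of the edge `{h, ι h}` is `length h = length (ι h)`; the
values of `length` at other elements are never used. -/
structure WeightedMetricGraph extends LegGraph where
  genus : toLegGraph.V → ℕ
  length : X → ℝ
  length_pos : ∀ h, toLegGraph.IsEdge h → 0 < length h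
  length_ι : ∀ h, toLegGraph.IsEdge h → length (ι h) = length h

namespace WeightedMetricGraph

variable (Γ : WeightedMetricGraph)

/-- The Euler characteristic `2 - 2 g(v) - val(v)` of a vertex. -/
noncomputable def euler (w : Γ.V) : ℤ := 2 - 2 * (Γ.genus w : ℤ) - (Γ.valency w : ℤ)

/-- The interval of a half-edge `h`, with `0` at the root of `h`: it is `[0, ℓ(e)]` if `h` belongs
to an edge `e`, and `[0, ∞)` if `h` is a leg. -/
def Param (h : Γ.H) : Set ℝ := {t | 0 ≤ t ∧ (Γ.IsEdge h.1 → t ≤ Γ.length h.1)}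

theorem zero_mem_param (h : Γ.H) : (0 : ℝ) ∈ Γ.Param h :=
  ⟨le_rfl, fun he => (Γ.length_pos _ he).le⟩

theorem length_mem_param {h : Γ.H} (he : Γ.IsEdge h.1) : Γ.length h.1 ∈ Γ.Param h :=
  ⟨(Γ.length_pos _ he).le, fun _ => le_rfl⟩

theorem flip_mem_param {h : Γ.H} (he : Γ.IsEdge h.1) {t : ℝ} (ht : t ∈ Γ.Param h) :
    Γ.length h.1 - t ∈ Γ.Param (Γ.flip h) := by
  refine ⟨sub_nonneg.2 (ht.2 he), fun _ => ?_⟩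
  have h1 : Γ.length (Γ.flip h).1 = Γ.length h.1 := Γ.length_ι _ he
  rw [h1]
  linarith [ht.1]

/-- The disjoint union of the vertices and of one interval for every half-edge. -/
abbrev PrePoint : Type := Γ.V ⊕ (Σ h : Γ.H, Γ.Param h)

/-- Gluing: the point `0` of the interval of `h` is the root vertex of `h`, and the intervals of
the two half-edges of an edge are identified by reversing the parameter. -/
inductive Glue : Γ.PrePoint → Γ.PrePoint → Prop
  | root (h : Γ.H) : Glue (Sum.inr ⟨h, ⟨0, Γ.zero_mem_param h⟩⟩) (Sum.inl (Γ.root h.1))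
  | flip (h : Γ.H) (he : Γ.IsEdge h.1) (t : ℝ) (ht : t ∈ Γ.Param h) :
      Glue (Sum.inr ⟨h, ⟨t, ht⟩⟩)
        (Sum.inr ⟨Γ.flip h, ⟨Γ.length h.1 - t, Γ.flip_mem_param he ht⟩⟩)

/-- The set underlying the metric realization `|Γ|`. -/
def Realization : Type := Quot Γ.Glue

/-- A vertex as a point of the realization. -/
def vert (w : Γ.V) : Γ.Realization := Quot.mk _ (Sum.inl w)

/-- The point with parameter `t` on the half-edge `h`. -/
def pt (h : Γ.H) (t : Γ.Param h) : Γ.Realization := Quot.mk _ (Sum.inr ⟨h, t⟩)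

/-- `p` and `q` are joined by a path consisting of finitely many segments, each of them inside the
interval of one half-edge, of total length `L`. -/
inductive PathLength : Γ.Realization → Γ.Realization → ℝ → Prop
  | nil (p : Γ.Realization) : PathLength p p 0
  | snoc (p : Γ.Realization) (h : Γ.H) (s t : Γ.Param h) (L : ℝ) :
      PathLength p (Γ.pt h s) L → PathLength p (Γ.pt h t) (L + |(s : ℝ) - (t : ℝ)|)

/-- The path metric on `|Γ|`: the infimum of the lengths of the paths joining two points (infinite
for points in different connected components). -/
noncomputable def pathEDist (p q : Γ.Realization) : ℝ≥0∞ :=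
  ⨅ (L : ℝ) (_ : Γ.PathLength p q L), ENNReal.ofReal L

/-- The closed cell of an element of the graph: a point for a vertex, the image of the whole
interval for a half-edge. -/
def cell (x : Γ.X) : Set Γ.Realization :=
  {p | (∃ hx : Γ.IsVertex x, p = Γ.vert ⟨x, hx⟩) ∨
    ∃ (hx : Γ.IsHalfEdge x) (t : Γ.Param ⟨x, hx⟩), p = Γ.pt ⟨x, hx⟩ t}

/-- The realization `|Δ| ⊆ |Γ|` of a subgraph. -/
def subRealization (Δ : Γ.Subgraph) : Set Γ.Realization := ⋃ x ∈ Δ.carrier, Γ.cell x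

theorem vert_root_mem_cell {h : Γ.X} (hh : Γ.IsHalfEdge h) : Γ.cell (Γ.r h) ⊆ Γ.cell h := by
  rintro p (⟨hx, rfl⟩ | ⟨hx, -⟩)
  · refine Or.inr ⟨hh, ⟨0, Γ.zero_mem_param _⟩, ?_⟩
    exact (Quot.sound (Glue.root (Γ := Γ) ⟨h, hh⟩)).symm
  · exact absurd (Γ.r_r h) hx

theorem cell_subset_cell_ι {h : Γ.X} (he : Γ.IsEdge h) : Γ.cell h ⊆ Γ.cell (Γ.ι h) := by
  rintro p (⟨hx, -⟩ | ⟨hx, t, rfl⟩)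
  · exact absurd hx he.1
  · exact Or.inr ⟨Γ.isHalfEdge_ι hx, _, Quot.sound (Glue.flip (Γ := Γ) ⟨h, hx⟩ he t.1 t.2)⟩

theorem cell_ι {h : Γ.X} (he : Γ.IsEdge h) : Γ.cell (Γ.ι h) = Γ.cell h := by
  apply Set.Subset.antisymm
  · have h1 := Γ.cell_subset_cell_ι (Γ.isEdge_ι he)
    rwa [Γ.ι_ι] at h1
  · exact Γ.cell_subset_cell_ι he

end WeightedMetricGraph

/-- A finite harmonic morphism of weighted metric graphs, with its degree function. -/
structure HarmonicMorphism (Γ' Γ : WeightedMetricGraph) where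
  toFun : Γ'.X → Γ.X
  map_r : ∀ x, toFun (Γ'.r x) = Γ.r (toFun x)
  map_ι : ∀ x, toFun (Γ'.ι x) = Γ.ι (toFun x)
  map_edge : ∀ h, Γ'.IsEdge h → Γ.IsEdge (toFun h)
  map_leg : ∀ h, Γ'.IsLeg h → Γ.IsLeg (toFun h)
  deg : Γ'.X → ℕ
  deg_pos : ∀ x, 0 < deg x
  deg_ι : ∀ h, Γ'.IsEdge h → deg (Γ'.ι h) = deg h
  harmonic : ∀ (w : Γ'.V) (h : Γ.X), Γ.IsHalfEdge h → Γ.r h = toFun w.1 →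
    deg w.1 = ∑ᶠ h' ∈ {h' | h' ∈ Γ'.tangent w ∧ toFun h' = h}, deg h'
  length_eq : ∀ h, Γ'.IsEdge h → Γ.length (toFun h) = deg h * Γ'.length h

namespace HarmonicMorphism

variable {Γ' Γ : WeightedMetricGraph} (φ : HarmonicMorphism Γ' Γ)

/-- The map on vertices. -/
def mapV (w : Γ'.V) : Γ.V :=
  ⟨φ.toFun w.1, by
    have h1 : Γ'.r w.1 = w.1 := w.2
    have h2 := φ.map_r w.1
    rw [h1] at h2
    exact h2.symm⟩

theorem map_halfEdge {h : Γ'.X} (hh : Γ'.IsHalfEdge h) : Γ.IsHalfEdge (φ.toFun h) := by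
  by_cases h1 : Γ'.ι h = h
  · exact (φ.map_leg h ⟨hh, h1⟩).1
  · exact (φ.map_edge h ⟨hh, h1⟩).1

/-- The map on half-edges. -/
def mapH (h : Γ'.H) : Γ.H := ⟨φ.toFun h.1, φ.map_halfEdge h.2⟩

theorem map_param {h : Γ'.H} {t : ℝ} (ht : t ∈ Γ'.Param h) :
    (φ.deg h.1 : ℝ) * t ∈ Γ.Param (φ.mapH h) := by
  refine ⟨mul_nonneg (Nat.cast_nonneg _) ht.1, fun he => ?_⟩
  have h1 : Γ'.IsEdge h.1 := by
    refine ⟨h.2, fun h2 => ?_⟩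
    exact he.2 (φ.map_leg h.1 ⟨h.2, h2⟩).2
  have h2 : Γ.length (φ.mapH h).1 = φ.deg h.1 * Γ'.length h.1 := φ.length_eq _ h1
  rw [h2]
  exact mul_le_mul_of_nonneg_left (ht.2 h1) (Nat.cast_nonneg _)

/-- The induced map `|φ| : |Γ'| → |Γ|`, which stretches every half-edge by its degree. -/
def realize : Γ'.Realization → Γ.Realization :=
  Quot.lift
    (fun p => match p with
      | Sum.inl w => Γ.vert (φ.mapV w)
      | Sum.inr ⟨h, t⟩ => Γ.pt (φ.mapH h) ⟨φ.deg h.1 * t.1, φ.map_param t.2⟩)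
    (by
      rintro _ _ (⟨h⟩ | ⟨h, he, t, ht⟩)
      · have h1 := Quot.sound (WeightedMetricGraph.Glue.root (Γ := Γ) (φ.mapH h))
        have h2 : Γ.root (φ.mapH h).1 = φ.mapV (Γ'.root h.1) :=
          Subtype.ext (φ.map_r h.1).symm
        rw [h2] at h1
        refine Eq.trans ?_ h1
        simp only [WeightedMetricGraph.pt]
        congr 4
        exact mul_zero _
      · have h1 := Quot.sound (WeightedMetricGraph.Glue.flip (Γ := Γ) (φ.mapH h)
          (φ.map_edge _ he) _ (φ.map_param ht))
        refine Eq.trans h1 ?_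
        have h2 : Γ.flip (φ.mapH h) = φ.mapH (Γ'.flip h) := Subtype.ext (φ.map_ι h.1).symm
        have key : ∀ (k k' : Γ.H) (_ : k = k') (a b : ℝ) (ha : a ∈ Γ.Param k)
            (hb : b ∈ Γ.Param k'), a = b → Γ.pt k ⟨a, ha⟩ = Γ.pt k' ⟨b, hb⟩ := by
          rintro k _ rfl a _ ha hb rfl
          rfl
        refine key _ _ h2 _ _ _ _ ?_
        have h3 : Γ.length (φ.mapH h).1 = φ.deg h.1 * Γ'.length h.1 := φ.length_eq _ he
        have h4 : φ.deg (Γ'.flip h).1 = φ.deg h.1 := φ.deg_ι _ he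
        rw [h3, h4]
        ring)

/-- The ramification degree at a vertex. -/
noncomputable def ram (w : Γ'.V) : ℤ := φ.deg w.1 * Γ.euler (φ.mapV w) - Γ'.euler w

/-- The local Riemann-Hurwitz condition holds at every vertex. -/
def Unramified : Prop := ∀ w, φ.ram w = 0

end HarmonicMorphism

/-! ### Tropical curves -/

/-- A model of a metric space `X` with weight function `g`. Distances may be infinite, because
tropical curves may be disconnected. -/
structure MetricModel (X : Type u) [EMetricSpace X] (g : X → ℕ) where
  graph : WeightedMetricGraph
  toFun : graph.Realization → X
  bijective : Function.Bijective toFun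
  isometry : ∀ p q, edist (toFun p) (toFun q) = graph.pathEDist p q
  genus_vert : ∀ w, g (toFun (graph.vert w)) = graph.genus w
  genus_zero : ∀ x, (∀ w, x ≠ toFun (graph.vert w)) → g x = 0

/-- A tropical curve: a metric space with a weight function that admits a model. -/
structure TropicalCurve where
  carrier : Type u
  [emetric : EMetricSpace carrier]
  genus : carrier → ℕ
  exists_model : Nonempty (MetricModel carrier genus)

namespace TropicalCurve

instance : CoeSort TropicalCurve.{u} (Type u) := ⟨carrier⟩

instance (X : TropicalCurve.{u}) : EMetricSpace X := X.emetric

/-- Models of a tropical curve. -/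
abbrev Model (X : TropicalCurve.{u}) := MetricModel X X.genus

end TropicalCurve

/-- The harmonic morphism of weighted metric graphs `φ` is a model for the map `τ` of tropical
curves with local degree function `d`. -/
structure IsModelOf {Y X : TropicalCurve.{u}} (τ : Y → X) (d : Y → ℕ) (M' : Y.Model) (M : X.Model)
    (φ : HarmonicMorphism M'.graph M.graph) : Prop where
  comm : ∀ p, τ (M'.toFun p) = M.toFun (φ.realize p)
  deg_vert : ∀ w, d (M'.toFun (M'.graph.vert w)) = φ.deg w.1
  deg_interior : ∀ (h : M'.graph.H) (t : M'.graph.Param h), 0 < t.1 →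
    (M'.graph.IsEdge h.1 → t.1 < M'.graph.length h.1) →
    d (M'.toFun (M'.graph.pt h t)) = φ.deg h.1

/-- `τ`, with local degree function `d`, is a finite harmonic morphism of tropical curves. -/
def IsHarmonic {Y X : TropicalCurve.{u}} (τ : Y → X) (d : Y → ℕ) : Prop :=
  ∃ (M' : Y.Model) (M : X.Model) (φ : HarmonicMorphism M'.graph M.graph), IsModelOf τ d M' M φ

/-- `τ`, with local degree function `d`, is an unramified finite harmonic morphism. -/
def IsUnramified {Y X : TropicalCurve.{u}} (τ : Y → X) (d : Y → ℕ) : Prop :=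
  ∃ (M' : Y.Model) (M : X.Model) (φ : HarmonicMorphism M'.graph M.graph),
    IsModelOf τ d M' M φ ∧ φ.Unramified

/-! ### Stratifications and dilated cohomology of a tropical curve -/

/-- A `G`-stratification of a tropical curve: a family of subcurves indexed by the subgroups of
`G`. Subcurves are the realizations of subgraphs of models; since there are finitely many of them,
they may be taken with respect to one and the same model. -/
structure GStratification (G : Type v) [AddCommGroup G] (X : TropicalCurve.{u}) where
  sub : AddSubgroup G → Set X
  exists_model : ∃ M : X.Model, ∀ H, ∃ Δ : M.graph.Subgraph,
    sub H = M.toFun '' M.graph.subRealization Δ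
  sub_bot : sub ⊥ = Set.univ
  anti : ∀ H K, H ≤ K → sub K ⊆ sub H
  inter : ∀ H K, sub H ∩ sub K = sub (H ⊔ K)

namespace GStratification

variable {G : Type v} [AddCommGroup G] {X : TropicalCurve.{u}} (S : GStratification G X)

/-- The stratum `X_H \ ⋃_{K ⊋ H} X_K`. -/
def stratum (H : AddSubgroup G) : Set X := {x | x ∈ S.sub H ∧ ∀ K, H < K → x ∉ S.sub K}

/-- The dilation subgroup `D(x)`: the largest `H` with `x ∈ X_H`. -/
def dilation (x : X) : AddSubgroup G := sSup {H | x ∈ S.sub H}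

theorem mem_sub_iff [Finite G] (x : X) (H : AddSubgroup G) :
    x ∈ S.sub H ↔ H ≤ S.dilation x := by
  constructor
  · exact fun h => le_sSup h
  · intro h
    refine S.anti _ _ h ?_
    have hf : {H | x ∈ S.sub H}.Finite := Set.toFinite _
    have key : ∀ T : Set (AddSubgroup G), T.Finite → T ⊆ {H | x ∈ S.sub H} →
        x ∈ S.sub (sSup T) := by
      intro T hT
      induction T, hT using Set.Finite.induction_on with
      | empty =>
        intro _
        rw [sSup_empty, S.sub_bot]
        trivial
      | @insert a s _ _ ih =>
        intro hs
        rw [sSup_insert, ← S.inter]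
        exact ⟨hs (Set.mem_insert _ _), ih ((Set.subset_insert _ _).trans hs)⟩
    exact key _ hf subset_rfl

/-- `D(x)` is the unique subgroup whose stratum contains `x`. -/
theorem mem_stratum_iff [Finite G] (x : X) (H : AddSubgroup G) :
    x ∈ S.stratum H ↔ S.dilation x = H := by
  simp only [stratum, Set.mem_ofPred_eq, S.mem_sub_iff]
  constructor
  · rintro ⟨h1, h2⟩
    by_contra h3
    exact h2 _ (lt_of_le_of_ne h1 (Ne.symm h3)) le_rfl
  · rintro rfl
    exact ⟨le_rfl, fun K hK hK' => absurd hK' (not_le_of_gt hK)⟩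

/-- The index function: the number of connected components of the intersection of the stratum of
`K` with a sufficiently small punctured neighborhood of `x`, that is, the eventually constant value
of this number for punctured balls of radius `ε → 0`. -/
noncomputable def index (x : X) (K : AddSubgroup G) : ℕ :=
  limUnder (𝓝[>] (0 : ℝ≥0∞)) fun ε =>
    Nat.card (ConnectedComponents ↥({y : X | edist y x < ε ∧ y ≠ x} ∩ S.stratum K))

/-- The number `g'(x) = #D(x)(g(x) - 1) + 1 + ½ ∑_{K ≤ D(x)} a(x; K)(#D(x) - [D(x) : K])`. -/
noncomputable def coverGenus (x : X) : ℚ :=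
  (Nat.card (S.dilation x) : ℚ) * ((X.genus x : ℚ) - 1) + 1 +
    1 / 2 * ∑ᶠ K ∈ {K : AddSubgroup G | K ≤ S.dilation x},
      (S.index x K : ℚ) * ((Nat.card (S.dilation x) : ℚ) - (K.relIndex (S.dilation x) : ℚ))

/-- A stratification is admissible if all numbers `g'(x)` are non-negative integers. -/
def Admissible : Prop := ∀ x, ∃ n : ℕ, S.coverGenus x = n

/-- An oriented model in which each `X_H` is (the realization of) a subgraph. -/
structure FramedModel where
  model : X.Model
  compatible : ∀ H, ∃ Δ : model.graph.Subgraph,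
    S.sub H = model.toFun '' model.graph.subRealization Δ
  orientation : model.graph.Orientation

theorem nonempty_framedModel : Nonempty S.FramedModel := by
  obtain ⟨M, hM⟩ := S.exists_model
  obtain ⟨o⟩ := M.graph.nonempty_orientation
  exact ⟨⟨M, hM, o⟩⟩

namespace FramedModel

variable {S} (F : S.FramedModel)

/-- The dilation datum induced by the stratification: `D(x)` is the largest `H` such that `x`
belongs to the subgraph corresponding to `X_H`. -/
def datum : DilationDatum G F.model.graph.toLegGraph where
  D x := sSup {H | F.model.toFun '' F.model.graph.cell x ⊆ S.sub H}
  le_root h hh := sSup_le_sSup fun _ hH =>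
    (Set.image_mono (F.model.graph.vert_root_mem_cell hh)).trans hH
  flip_eq h he := by
    have h1 := F.model.graph.cell_ι he
    rw [h1]

/-- The dilated cohomology group computed in the given oriented model. -/
abbrev H1 : Type v := F.datum.H1 F.orientation

end FramedModel

/-- A choice of an oriented model compatible with the stratification. -/
noncomputable def frame : S.FramedModel := Classical.choice S.nonempty_framedModel

/-- The dilated cohomology group `H¹(X, S)`: the dilated cohomology group of the dilation datum
induced on a model compatible with `S`. -/
abbrev H1 : Type v := S.frame.H1

end GStratification

/-! ### `G`-covers of a tropical curve -/

/-- A `G`-cover of a tropical curve. -/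
structure GCover (G : Type v) [AddCommGroup G] (X : TropicalCurve.{u}) where
  total : TropicalCurve.{u}
  [act : AddAction G total]
  map : total → X
  /-- the local degree -/
  degree : total → ℕ
  harmonic : IsHarmonic map degree
  /-- the group acts by automorphisms of the tropical curve `total` -/
  edist_vadd : ∀ (g : G) (y z : total), edist (g +ᵥ y) (g +ᵥ z) = edist y z
  genus_vadd : ∀ (g : G) (y : total), total.genus (g +ᵥ y) = total.genus y
  /-- the action is invariant with respect to the harmonic morphism -/
  map_vadd : ∀ (g : G) (y : total), map (g +ᵥ y) = map y
  degree_vadd : ∀ (g : G) (y : total), degree (g +ᵥ y) = degree y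
  transitive : ∀ y z : total, map y = map z → ∃ g : G, g +ᵥ y = z
  /-- the degree of the harmonic morphism (the sum of the local degrees over any fiber) is the
  order of the group -/
  degree_eq : ∀ x, ∑ᶠ y ∈ {y | map y = x}, degree y = Nat.card G

namespace GCover

variable {G : Type v} [AddCommGroup G] {X : TropicalCurve.{u}}

instance (τ : GCover G X) : AddAction G τ.total := τ.act

/-- Isomorphism of `G`-covers: an equivariant isomorphism of tropical curves over `X`. -/
def Iso (τ₁ τ₂ : GCover G X) : Prop :=
  ∃ ψ : τ₁.total ≃ τ₂.total,
    (∀ y z, edist (ψ y) (ψ z) = edist y z) ∧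
    (∀ y, τ₂.total.genus (ψ y) = τ₁.total.genus y) ∧
    (∀ y, τ₂.map (ψ y) = τ₁.map y) ∧
    (∀ y, τ₂.degree (ψ y) = τ₁.degree y) ∧
    (∀ (g : G) y, ψ (g +ᵥ y) = g +ᵥ ψ y)

/-- Isomorphism of `G`-covers as an equivalence relation. -/
instance setoid (G : Type v) [AddCommGroup G] (X : TropicalCurve.{u}) : Setoid (GCover G X) where
  r := Iso
  iseqv :=
    { refl := fun _ => ⟨Equiv.refl _, fun _ _ => rfl, fun _ => rfl, fun _ => rfl, fun _ => rfl,
        fun _ _ => rfl⟩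
      symm := by
        rintro τ₁ τ₂ ⟨ψ, h1, h2, h3, h4, h5⟩
        refine ⟨ψ.symm, fun y z => ?_, fun y => ?_, fun y => ?_, fun y => ?_, fun g y => ?_⟩
        · rw [← h1, ψ.apply_symm_apply, ψ.apply_symm_apply]
        · rw [← h2, ψ.apply_symm_apply]
        · rw [← h3, ψ.apply_symm_apply]
        · rw [← h4, ψ.apply_symm_apply]
        · apply ψ.injective
          rw [h5, ψ.apply_symm_apply, ψ.apply_symm_apply]
      trans := by
        rintro τ₁ τ₂ τ₃ ⟨ψ, h1, h2, h3, h4, h5⟩ ⟨χ, k1, k2, k3, k4, k5⟩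
        refine ⟨ψ.trans χ, fun y z => ?_, fun y => ?_, fun y => ?_, fun y => ?_, fun g y => ?_⟩
        · simp only [Equiv.trans_apply, k1, h1]
        · simp only [Equiv.trans_apply, k2, h2]
        · simp only [Equiv.trans_apply, k3, h3]
        · simp only [Equiv.trans_apply, k4, h4]
        · simp only [Equiv.trans_apply, h5, k5] }

/-- The cover is unramified. -/
def Unramified (τ : GCover G X) : Prop := IsUnramified τ.map τ.degree

/-- `S` is the dilation stratification of the cover: `X_H` is the set of points over which the
stabilizers contain `H`. -/
def HasStratification (τ : GCover G X) (S : GStratification G X) : Prop :=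
  ∀ H, S.sub H = {x | ∃ y, τ.map y = x ∧ H ≤ AddAction.stabilizer G y}

/-- `η` is a cochain attached to the cover in the oriented model `F`. Choose a point `y v` in the
fiber over each vertex `v` (that is, the trivialization of this fiber sending `y v` to `0`), and a
continuous lift `σ e` of each closed edge `e` (that is, an edge over `e`); if the lift of `e` starts
at `a + y (s(e))` and ends at `b + y (t(e))`, then `η(e)` is the class of `a - b`. -/
def HasCochain (τ : GCover G X) {S : GStratification G X} (F : S.FramedModel)
    (η : F.datum.C1 F.orientation) : Prop :=
  ∃ (y : F.model.graph.V → τ.total)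
    (σ : ∀ e : F.orientation.edges, F.model.graph.Param (F.orientation.half e) → τ.total)
    (a b : F.orientation.edges → G),
    (∀ w, τ.map (y w) = F.model.toFun (F.model.graph.vert w)) ∧
    ∀ e, Continuous (σ e) ∧
      (∀ t, τ.map (σ e t) = F.model.toFun (F.model.graph.pt (F.orientation.half e) t)) ∧
      σ e ⟨0, F.model.graph.zero_mem_param _⟩ = a e +ᵥ y (F.orientation.source e) ∧
      σ e ⟨F.model.graph.length e.1,
          F.model.graph.length_mem_param (h := F.orientation.half e)
            (F.orientation.isEdge e.1 e.2)⟩ = b e +ᵥ y (F.orientation.target e) ∧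
      η e = QuotientAddGroup.mk (a e - b e)

/-- `c` is the class attached to the cover in the dilated cohomology group computed in the
oriented model `F`. -/
def HasClass (τ : GCover G X) {S : GStratification G X} (F : S.FramedModel) (c : F.H1) : Prop :=
  ∃ η : F.datum.C1 F.orientation, τ.HasCochain F η ∧ QuotientAddGroup.mk η = c

end GCover

/-- Isomorphism classes of `G`-covers. -/
abbrev GCoverClass (G : Type v) [AddCommGroup G] (X : TropicalCurve.{u}) :=
  Quotient (GCover.setoid G X)

/-- Triples `(S, η, g')` of a `G`-stratification, a dilated cohomology class and a genus function,
that is, a function to the non-negative integers that vanishes outside a finite set. -/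
structure CoverData (G : Type v) [AddCommGroup G] (X : TropicalCurve.{u}) where
  strat : GStratification G X
  cls : strat.H1
  genus : X → ℕ
  finite_support : (Function.support genus).Finite

/-- The triple `t` consists of the dilation stratification of the cover, its cohomology class, and
the genera of the points in its fibers. -/
structure GCover.HasData {G : Type v} [AddCommGroup G] {X : TropicalCurve.{u}} (τ : GCover G X)
    (t : CoverData G X) : Prop where
  strat : τ.HasStratification t.strat
  cls : τ.HasClass t.strat.frame t.cls
  genus : ∀ y, τ.total.genus y = t.genus (τ.map y)

/-! Away from gluing, a `G`-cover is determined by its stabilizers. A fibre is one orbit on which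
the local degree is constant, and the degrees add up to `#G`, so the local degree is the order of
the stabilizer (`GCover.degree_eq_card`). The condition `H ≤ Stab y` is closed, and the degree is
constant on the interior of an edge or leg of a model. Hence stabilizers are constant there
(`GCover.stabilizer_const`) and can only grow at the ends, so the loci of large stabilizers are
subcurves and the cover has a stratification.

A harmonic morphism is onto on tangent directions, so edges and legs lift, and two lifts over the
same edge or leg differ by one group element. A cover thus has framings (`IsFraming`): points over
the vertices and lifts whose ends differ from these points by elements `A` and `B` of `G`.
Translating a lift does not change `A - B`; the choices of `A` and `B` at the ends matter only
modulo `D(s(e)) + D(t(e))`; moving the points over the vertices adds a coboundary. So exactly a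
class in the dilated cohomology survives (`hasClass_unique`). Conversely, covers with the same
stratification and class have framings with equal `A` and `B`. Matching framings give an equivariant
homeomorphism over `X` (`IsFraming.exists_map`), and it is an isometry because both covers stretch
local distances by the same degrees (`edist_map_le`).

For existence one builds a covering graph: its elements over `x` are the cosets of `D(x)`, and the
root map is twisted by representatives of a cocycle (`FramedModel.exists_cover`). The genus function
is free once its finite support consists of vertices, which is achieved by subdivision
(`exists_cover_of_finite`).

Above a vertex `v`, a direction `h` has `[D(v) : D(h)]` preimages at each point of the fibre. The
local Riemann-Hurwitz condition therefore says that the genus upstairs equals `coverGenus`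
(`ram_eq`), once `index` is identified with a count of directions (`StarNhd.index_eq`). At inner
points both numbers vanish.

Classes do not depend on the model because an equivariant homeomorphism over `X` carries framings in
every model at once (`HasClass.transfer`). Addition does not depend on it either: covers of classes
`c₁`, `c₂`, `c₁ + c₂` are linked by a map from the fibre product of the first two to the third,
equivariant along the addition of `G` (`HasClass.add_transfer`). -/

/-! ### Rays in the realization of a weighted metric graph -/

namespace WeightedMetricGraph

variable (Γ : WeightedMetricGraph)

open Classical in
/-- The parameter of the interval of `h` nearest to `t`. -/
noncomputable def clamp (h : Γ.H) (t : ℝ) : ℝ :=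
  if Γ.IsEdge h.1 then max 0 (min t (Γ.length h.1)) else max 0 t

theorem clamp_mem (h : Γ.H) (t : ℝ) : Γ.clamp h t ∈ Γ.Param h := by
  unfold clamp
  split_ifs with he
  · exact ⟨le_max_left _ _, fun _ => max_le (Γ.length_pos _ he).le (min_le_right _ _)⟩
  · exact ⟨le_max_left _ _, fun h1 => absurd h1 he⟩

theorem clamp_of_mem {h : Γ.H} {t : ℝ} (ht : t ∈ Γ.Param h) : Γ.clamp h t = t := by
  unfold clamp
  split_ifs with he
  · rw [min_eq_left (ht.2 he), max_eq_right ht.1]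
  · exact max_eq_right ht.1

theorem abs_clamp_sub_le (h : Γ.H) (s t : ℝ) : |Γ.clamp h s - Γ.clamp h t| ≤ |s - t| := by
  unfold clamp
  split_ifs with he
  · refine (abs_max_sub_max_le_max _ _ _ _).trans ?_
    simp only [sub_self, abs_zero]
    refine max_le (abs_nonneg _) ((abs_min_sub_min_le_max _ _ _ _).trans ?_)
    simp
  · refine (abs_max_sub_max_le_max _ _ _ _).trans ?_
    simp

theorem mem_param_iff_of_edge {h : Γ.H} (he : Γ.IsEdge h.1) {t : ℝ} :
    t ∈ Γ.Param h ↔ 0 ≤ t ∧ t ≤ Γ.length h.1 := by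
  simp [Param, he]

theorem mem_param_iff_of_not_edge {h : Γ.H} (he : ¬ Γ.IsEdge h.1) {t : ℝ} :
    t ∈ Γ.Param h ↔ 0 ≤ t := by
  simp [Param, he]

theorem isClosed_param (h : Γ.H) : IsClosed (Γ.Param h) := by
  by_cases he : Γ.IsEdge h.1
  · have : Γ.Param h = Set.Icc 0 (Γ.length h.1) := by
      ext t; exact Γ.mem_param_iff_of_edge he
    rw [this]; exact isClosed_Icc
  · have : Γ.Param h = Set.Ici 0 := by
      ext t; exact Γ.mem_param_iff_of_not_edge he
    rw [this]; exact isClosed_Ici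

/-- The point of `|Γ|` with parameter `t` on `h`; parameters out of range are clamped. -/
noncomputable def ray (h : Γ.H) (t : ℝ) : Γ.Realization := Γ.pt h ⟨Γ.clamp h t, Γ.clamp_mem h t⟩

variable {Γ}

theorem ray_of_mem {h : Γ.H} {t : ℝ} (ht : t ∈ Γ.Param h) : Γ.ray h t = Γ.pt h ⟨t, ht⟩ := by
  unfold ray
  congr
  exact Γ.clamp_of_mem ht

theorem pt_eq_ray (h : Γ.H) (t : Γ.Param h) : Γ.pt h t = Γ.ray h t :=
  (ray_of_mem t.2).symm

theorem ray_zero (h : Γ.H) : Γ.ray h 0 = Γ.vert (Γ.root h.1) := by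
  rw [ray_of_mem (Γ.zero_mem_param h)]
  exact Quot.sound (Glue.root h)

theorem ray_congr {h : Γ.H} {s t : ℝ} (hst : Γ.clamp h s = Γ.clamp h t) :
    Γ.ray h s = Γ.ray h t := by
  unfold ray
  congr

theorem isEdge_flip {h : Γ.H} (he : Γ.IsEdge h.1) : Γ.IsEdge (Γ.flip h).1 := Γ.isEdge_ι he

theorem flip_flip (h : Γ.H) : Γ.flip (Γ.flip h) = h := Subtype.ext (Γ.ι_ι _)

theorem flip_ne {h : Γ.H} (he : Γ.IsEdge h.1) : Γ.flip h ≠ h := fun h1 =>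
  he.2 (congrArg Subtype.val h1)

theorem length_flip {h : Γ.H} (he : Γ.IsEdge h.1) : Γ.length (Γ.flip h).1 = Γ.length h.1 :=
  Γ.length_ι _ he

theorem clamp_flip {h : Γ.H} (he : Γ.IsEdge h.1) (t : ℝ) :
    Γ.clamp (Γ.flip h) (Γ.length h.1 - t) = Γ.length h.1 - Γ.clamp h t := by
  have hl := Γ.length_pos _ he
  unfold clamp
  rw [if_pos he, if_pos (isEdge_flip he), length_flip he]
  rcases le_total t 0 with h0 | h0
  · rw [min_eq_right (by linarith), min_eq_left (by linarith), max_eq_left h0,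
      max_eq_right hl.le, sub_zero]
  · rcases le_total t (Γ.length h.1) with h1 | h1
    · rw [min_eq_left (by linarith), min_eq_left (by linarith), max_eq_right h0,
        max_eq_right (by linarith)]
    · rw [min_eq_left (by linarith), min_eq_right (by linarith), max_eq_left (by linarith),
        max_eq_right hl.le, sub_self]

theorem ray_flip {h : Γ.H} (he : Γ.IsEdge h.1) (t : ℝ) :
    Γ.ray (Γ.flip h) (Γ.length h.1 - t) = Γ.ray h t := by
  have h1 := Quot.sound (Glue.flip (Γ := Γ) h he _ (Γ.clamp_mem h t))
  refine Eq.trans ?_ h1.symm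
  have h2 : Γ.length h.1 - Γ.clamp h t ∈ Γ.Param (Γ.flip h) :=
    Γ.flip_mem_param he (Γ.clamp_mem h t)
  exact congrArg (Γ.pt (Γ.flip h)) (Subtype.ext (clamp_flip he t))

theorem ray_flip' {h : Γ.H} (he : Γ.IsEdge h.1) (t : ℝ) :
    Γ.ray (Γ.flip h) t = Γ.ray h (Γ.length h.1 - t) := by
  rw [← ray_flip he, sub_sub_cancel]

theorem ray_length {h : Γ.H} (he : Γ.IsEdge h.1) :
    Γ.ray h (Γ.length h.1) = Γ.vert (Γ.root (Γ.ι h.1)) := by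
  rw [← ray_flip he, sub_self, ray_zero]
  rfl

variable (Γ) in
/-- `t` is an inner parameter of the interval of `h`. -/
def IsInner (h : Γ.H) (t : ℝ) : Prop := 0 < t ∧ (Γ.IsEdge h.1 → t < Γ.length h.1)

theorem IsInner.mem {h : Γ.H} {t : ℝ} (ht : Γ.IsInner h t) : t ∈ Γ.Param h :=
  ⟨ht.1.le, fun he => (ht.2 he).le⟩

theorem IsInner.flip {h : Γ.H} {t : ℝ} (ht : Γ.IsInner h t) (he : Γ.IsEdge h.1) :
    Γ.IsInner (Γ.flip h) (Γ.length h.1 - t) :=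
  ⟨by linarith [ht.2 he], fun _ => by rw [length_flip he]; linarith [ht.1]⟩

theorem isInner_or {h : Γ.H} {t : ℝ} (ht : t ∈ Γ.Param h) :
    t = 0 ∨ (Γ.IsEdge h.1 ∧ t = Γ.length h.1) ∨ Γ.IsInner h t := by
  rcases ht.1.eq_or_lt with h0 | h0
  · exact Or.inl h0.symm
  · by_cases he : Γ.IsEdge h.1
    · rcases (ht.2 he).eq_or_lt with h1 | h1
      · exact Or.inr (Or.inl ⟨he, h1⟩)
      · exact Or.inr (Or.inr ⟨h0, fun _ => h1⟩)
    · exact Or.inr (Or.inr ⟨h0, fun h1 => absurd h1 he⟩)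

theorem exists_rep (p : Γ.Realization) :
    (∃ w, p = Γ.vert w) ∨ ∃ h t, Γ.IsInner h t ∧ p = Γ.ray h t := by
  induction p using Quot.ind with
  | mk p =>
    rcases p with w | ⟨h, t⟩
    · exact Or.inl ⟨w, rfl⟩
    · have h1 : (Quot.mk _ (Sum.inr ⟨h, t⟩) : Γ.Realization) = Γ.ray h t := pt_eq_ray h t
      rw [h1]
      rcases isInner_or t.2 with h0 | ⟨he, h0⟩ | h0
      · exact Or.inl ⟨_, by rw [h0, ray_zero]⟩
      · exact Or.inl ⟨_, by rw [h0, ray_length he]⟩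
      · exact Or.inr ⟨h, t, h0, rfl⟩

variable (Γ) in
open Classical in
/-- The representatives of a point which are vertices or have an inner parameter. -/
def precode : Γ.PrePoint → Set (Γ.V ⊕ (Γ.H × ℝ))
  | Sum.inl w => {Sum.inl w}
  | Sum.inr ⟨h, t⟩ =>
      if t.1 = 0 then {Sum.inl (Γ.root h.1)}
      else if Γ.IsEdge h.1 then
        (if t.1 = Γ.length h.1 then {Sum.inl (Γ.root (Γ.ι h.1))}
          else {Sum.inr (h, t.1), Sum.inr (Γ.flip h, Γ.length h.1 - t.1)})
      else {Sum.inr (h, t.1)}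

/-- Being constant on glued points, these normal forms separate the points of the quotient without
any description of the equivalence relation generated by the gluing. -/
theorem precode_glue (p q : Γ.PrePoint) (hpq : Γ.Glue p q) : Γ.precode p = Γ.precode q := by
  rcases hpq with ⟨h⟩ | ⟨h, he, t, ht⟩
  · simp [precode]
  · have hl := Γ.length_pos _ he
    have he' := Γ.isEdge_ι he
    have h1 : Γ.ι (Γ.flip h).1 = h.1 := Γ.ι_ι _
    have he2 : Γ.IsEdge (Γ.flip h).1 := he'
    simp only [precode, he, if_true, he2]
    rw [length_flip he]
    by_cases h0 : t = 0
    · subst h0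
      simp [hl.ne', h1]
    · by_cases h2 : t = Γ.length h.1
      · subst h2
        simp [hl.ne', LegGraph.flip]
      · rw [if_neg h0, if_neg h2, if_neg (by intro h3; apply h2; linarith),
          if_neg (by intro h3; apply h0; linarith), flip_flip, sub_sub_cancel, Set.pair_comm]

/-- The representatives of a point which are vertices or have an inner parameter. -/
def code : Γ.Realization → Set (Γ.V ⊕ (Γ.H × ℝ)) := Quot.lift Γ.precode precode_glue

theorem code_vert (w : Γ.V) : code (Γ.vert w) = {Sum.inl w} := rfl

open Classical in
theorem code_ray {h : Γ.H} {t : ℝ} (ht : Γ.IsInner h t) : code (Γ.ray h t) =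
    if Γ.IsEdge h.1 then {Sum.inr (h, t), Sum.inr (Γ.flip h, Γ.length h.1 - t)}
      else {Sum.inr (h, t)} := by
  rw [ray_of_mem ht.mem]
  change Γ.precode (Sum.inr ⟨h, ⟨t, ht.mem⟩⟩) = _
  simp only [precode]
  rw [if_neg ht.1.ne']
  split_ifs with he h2
  · exact absurd h2 (ht.2 he).ne
  · rfl
  · rfl

theorem vert_injective : Function.Injective Γ.vert := fun v w hvw => by
  have h1 := congrArg code hvw
  rw [code_vert, code_vert] at h1
  simpa using h1

theorem ray_ne_vert {h : Γ.H} {t : ℝ} (ht : Γ.IsInner h t) (w : Γ.V) :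
    Γ.ray h t ≠ Γ.vert w := fun h0 => by
  have h1 := congrArg code h0
  rw [code_vert, code_ray ht] at h1
  have h2 : (Sum.inr (h, t) : Γ.V ⊕ (Γ.H × ℝ)) ∈ ({Sum.inl w} : Set _) := by
    rw [← h1]; split_ifs <;> simp
  simp at h2

open Classical in
theorem ray_eq_ray {h k : Γ.H} {s t : ℝ} (hs : Γ.IsInner h s) (ht : Γ.IsInner k t)
    (h0 : Γ.ray h s = Γ.ray k t) :
    (k = h ∧ t = s) ∨ (Γ.IsEdge h.1 ∧ k = Γ.flip h ∧ t = Γ.length h.1 - s) := by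
  have h1 := congrArg code h0
  rw [code_ray hs, code_ray ht] at h1
  have h2 : (Sum.inr (k, t) : Γ.V ⊕ (Γ.H × ℝ)) ∈
      if Γ.IsEdge h.1 then {Sum.inr (h, s), Sum.inr (Γ.flip h, Γ.length h.1 - s)}
        else ({Sum.inr (h, s)} : Set (Γ.V ⊕ (Γ.H × ℝ))) := by
    rw [h1]; split_ifs <;> simp
  split_ifs at h2 with he
  · simp only [Set.mem_insert_iff, Set.mem_singleton_iff, Sum.inr.injEq, Prod.mk.injEq] at h2
    rcases h2 with h2 | h2
    · exact Or.inl h2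
    · exact Or.inr ⟨he, h2⟩
  · simp only [Set.mem_singleton_iff, Sum.inr.injEq, Prod.mk.injEq] at h2
    exact Or.inl h2

theorem ray_inj {h : Γ.H} {s t : ℝ} (hs : Γ.IsInner h s) (ht : Γ.IsInner h t)
    (h0 : Γ.ray h s = Γ.ray h t) : s = t := by
  rcases ray_eq_ray hs ht h0 with ⟨-, h1⟩ | ⟨he, h1, -⟩
  · exact h1.symm
  · exact absurd h1.symm (flip_ne he)

/-! ### The path metric -/

theorem pathLength_ray {p : Γ.Realization} {L : ℝ} (h : Γ.H) (s t : ℝ)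
    (hp : Γ.PathLength p (Γ.ray h s) L) :
    Γ.PathLength p (Γ.ray h t) (L + |Γ.clamp h s - Γ.clamp h t|) :=
  PathLength.snoc p h _ _ L hp

theorem PathLength.trans {p q r : Γ.Realization} {L L' : ℝ} (h1 : Γ.PathLength p q L)
    (h2 : Γ.PathLength q r L') : Γ.PathLength p r (L + L') := by
  induction h2 with
  | nil => rwa [add_zero]
  | snoc h s t L' _ ih =>
    rw [← add_assoc]
    exact PathLength.snoc p h s t _ ih

theorem PathLength.symm {p q : Γ.Realization} {L : ℝ} (h1 : Γ.PathLength p q L) :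
    Γ.PathLength q p L := by
  induction h1 with
  | nil => exact PathLength.nil _
  | snoc h s t L' _ ih =>
    have h2 := PathLength.snoc _ h t s 0 (PathLength.nil (Γ.pt h t))
    have h3 := h2.trans ih
    rwa [abs_sub_comm, zero_add, add_comm] at h3

theorem PathLength.nonneg {p q : Γ.Realization} {L : ℝ} (h1 : Γ.PathLength p q L) : 0 ≤ L := by
  induction h1 with
  | nil => exact le_rfl
  | snoc h s t L' _ ih => positivity

theorem pathEDist_le {p q : Γ.Realization} {L : ℝ} (h1 : Γ.PathLength p q L) :
    Γ.pathEDist p q ≤ ENNReal.ofReal L := iInf₂_le L h1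

theorem pathEDist_self (p : Γ.Realization) : Γ.pathEDist p p = 0 := by
  have h1 := pathEDist_le (PathLength.nil p)
  rw [ENNReal.ofReal_zero] at h1
  exact le_antisymm h1 bot_le

theorem pathEDist_comm (p q : Γ.Realization) : Γ.pathEDist p q = Γ.pathEDist q p :=
  le_antisymm (le_iInf₂ fun _ h => pathEDist_le h.symm) (le_iInf₂ fun _ h => pathEDist_le h.symm)

theorem pathEDist_triangle (p q r : Γ.Realization) :
    Γ.pathEDist p r ≤ Γ.pathEDist p q + Γ.pathEDist q r := by
  unfold pathEDist
  simp only [ENNReal.iInf_add, ENNReal.add_iInf]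
  refine le_iInf₂ fun L hL => le_iInf₂ fun L' hL' => ?_
  rw [← ENNReal.ofReal_add hL'.nonneg hL.nonneg]
  exact pathEDist_le (hL'.trans hL)

theorem pathEDist_ray_le (h : Γ.H) (s t : ℝ) :
    Γ.pathEDist (Γ.ray h s) (Γ.ray h t) ≤ ENNReal.ofReal |s - t| := by
  refine (pathEDist_le (pathLength_ray h s t (PathLength.nil _))).trans ?_
  rw [zero_add]
  exact ENNReal.ofReal_le_ofReal (Γ.abs_clamp_sub_le h s t)

/-- A bound along all segments is a bound for the path metric. -/
theorem le_pathEDist {Y : Type*} [PseudoEMetricSpace Y] (f : Γ.Realization → Y)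
    (hf : ∀ h s t, edist (f (Γ.pt h s)) (f (Γ.pt h t)) ≤ ENNReal.ofReal |(s : ℝ) - t|)
    (p q : Γ.Realization) : edist (f p) (f q) ≤ Γ.pathEDist p q := by
  refine le_iInf₂ fun L hL => ?_
  induction hL with
  | nil => simp
  | snoc h s t L hL ih =>
    rw [ENNReal.ofReal_add hL.nonneg (abs_nonneg _)]
    exact (edist_triangle _ _ _).trans (add_le_add ih (hf _ _ _))

/-! ### Functions separating points -/

section Separate

variable (F : Γ.V → ℝ) (b : Γ.H → ℝ → ℝ) (ε : ℝ)

open Classical in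
/-- The minimum of `ε` and of the functions `b` on the two half-edges of an edge. -/
noncomputable def minVal (h : Γ.H) (t : ℝ) : ℝ :=
  min ε (min (b h t) (if Γ.IsEdge h.1 then b (Γ.flip h) (Γ.length h.1 - t) else ε))

theorem minVal_flip {h : Γ.H} (he : Γ.IsEdge h.1) (t : ℝ) :
    minVal b ε (Γ.flip h) (Γ.length h.1 - t) = minVal b ε h t := by
  unfold minVal
  rw [if_pos he, if_pos (isEdge_flip he), length_flip he, flip_flip, sub_sub_cancel, min_comm (b h t)]

theorem abs_minVal_sub_le (hb : ∀ h s t, |b h s - b h t| ≤ |s - t|) (h : Γ.H) (s t : ℝ) :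
    |minVal b ε h s - minVal b ε h t| ≤ |s - t| := by
  refine (abs_min_sub_min_le_max _ _ _ _).trans ?_
  rw [sub_self, abs_zero]
  refine max_le (abs_nonneg _) ((abs_min_sub_min_le_max _ _ _ _).trans (max_le (hb _ _ _) ?_))
  split_ifs
  · refine (hb _ _ _).trans (le_of_eq ?_)
    rw [abs_sub_comm]
    congr 1
    ring
  · simp

variable (hF : ∀ h, minVal b ε h 0 = F (Γ.root h.1))

-- Lower bounds for an infimum over all paths come from test functions: a function that is
-- `1`-Lipschitz on every segment varies by at most the path distance. The minimum over the two
-- half-edges makes the values compatible with flips, and `hF` makes them compatible with roots.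
include hF in
theorem exists_separate (hb : ∀ h s t, |b h s - b h t| ≤ |s - t|) :
    ∃ f : Γ.Realization → ℝ, (∀ w, f (Γ.vert w) = F w) ∧
      (∀ h, ∀ t ∈ Γ.Param h, f (Γ.ray h t) = minVal b ε h t) ∧
      ∀ p q, ENNReal.ofReal |f p - f q| ≤ Γ.pathEDist p q := by
  let f : Γ.Realization → ℝ := Quot.lift
    (fun p : Γ.PrePoint => match p with
      | Sum.inl w => F w
      | Sum.inr ⟨h, t⟩ => minVal b ε h t.1)
    (by
      rintro _ _ (⟨h⟩ | ⟨h, he, t, ht⟩)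
      · exact hF h
      · exact (minVal_flip b ε he t).symm)
  refine ⟨f, fun w => rfl, fun h t ht => ?_, fun p q => ?_⟩
  · rw [ray_of_mem ht]
    rfl
  · have h1 := le_pathEDist f (fun h s t => ?_) p q
    · rwa [edist_dist, Real.dist_eq] at h1
    · rw [edist_dist, Real.dist_eq]
      exact ENNReal.ofReal_le_ofReal (abs_minVal_sub_le b ε hb h s t)

end Separate

/-- The factor `2` keeps the intervals `[0, ε)` at the two ends of an edge disjoint, which matters
for loops. -/
theorem exists_length_bound (Γ : WeightedMetricGraph) :
    ∃ ε : ℝ, 0 < ε ∧ ∀ h, Γ.IsEdge h → 2 * ε ≤ Γ.length h := by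
  have := Γ.finite
  obtain ⟨ε, h0, h1⟩ : ∃ ε : ℝ, 0 < ε ∧ ∀ h ∈ {h | Γ.IsEdge h}, ε ≤ Γ.length h := by
    have hf : {h | Γ.IsEdge h}.Finite := Set.toFinite _
    have h2 : ∀ T : Set Γ.X, T.Finite → T ⊆ {h | Γ.IsEdge h} →
        ∃ ε : ℝ, 0 < ε ∧ ∀ h ∈ T, ε ≤ Γ.length h := by
      intro T hT
      induction T, hT using Set.Finite.induction_on with
      | empty => exact fun _ => ⟨1, one_pos, by simp⟩
      | @insert a s _ _ ih =>
        intro hs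
        obtain ⟨ε, h0, h1⟩ := ih ((Set.subset_insert _ _).trans hs)
        refine ⟨min ε (Γ.length a), lt_min h0 (Γ.length_pos _ (hs (Set.mem_insert _ _))), ?_⟩
        rintro h (rfl | h2)
        · exact min_le_right _ _
        · exact (min_le_left _ _).trans (h1 h h2)
    exact h2 _ hf subset_rfl
  exact ⟨ε / 2, by positivity, fun h hh => by linarith [h1 h hh]⟩

open Classical in
/-- The path metric near a vertex. -/
theorem pathEDist_near_vert {ε : ℝ} (h0 : 0 < ε) (hε : ∀ h, Γ.IsEdge h → 2 * ε ≤ Γ.length h)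
    (w : Γ.V) :
    (∀ h : Γ.H, Γ.root h.1 = w → ∀ t, 0 ≤ t → t < ε →
      Γ.pathEDist (Γ.vert w) (Γ.ray h t) = ENNReal.ofReal t) ∧
    ∀ q, Γ.pathEDist (Γ.vert w) q < ENNReal.ofReal ε → q = Γ.vert w ∨
      ∃ h : Γ.H, Γ.root h.1 = w ∧ ∃ t, 0 < t ∧ t < ε ∧ q = Γ.ray h t := by
  have hinner : ∀ (h : Γ.H) t, 0 ≤ t → t < ε → t ∈ Γ.Param h := fun h t h1 h2 =>
    ⟨h1, fun he => by linarith [hε _ he]⟩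
  -- The test function is the distance to `w`, capped at `ε`. On a loop at `w` both half-edges start
  -- at `w`, and the minimum picks the nearer end.
  obtain ⟨f, f1, f2, f3⟩ := exists_separate (Γ := Γ) (fun w' => if w' = w then 0 else ε)
    (fun h t => if Γ.root h.1 = w then t else ε) ε
    (fun h => by
      unfold minVal
      by_cases h1 : Γ.root h.1 = w
      · simp only [h1, if_true]
        by_cases he : Γ.IsEdge h.1
        · have := hε _ he
          simp only [he, if_true, sub_zero]
          split_ifs
          · rw [min_eq_left (a := 0) (by linarith), min_eq_right h0.le]
          · rw [min_eq_left (a := 0) h0.le, min_eq_right h0.le]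
        · simp [he, h0.le]
      · simp only [h1, if_false]
        by_cases he : Γ.IsEdge h.1
        · have := hε _ he
          simp only [he, if_true, sub_zero]
          split_ifs
          · rw [min_eq_left (a := ε) (b := Γ.length _) (by linarith), min_self]
          · simp
        · simp [he])
    (fun h s t => by
      split_ifs
      · exact le_rfl
      · simp)
  constructor
  · intro h hh t t0 t1
    apply le_antisymm
    · have h1 := pathEDist_ray_le h 0 t
      rw [ray_zero, hh, zero_sub, abs_neg, abs_of_nonneg t0] at h1
      exact h1
    · have h1 := f3 (Γ.vert w) (Γ.ray h t)
      rw [f1, if_pos rfl, f2 h t (hinner h t t0 t1), zero_sub, abs_neg] at h1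
      refine le_trans (ENNReal.ofReal_le_ofReal (le_trans ?_ (le_abs_self _))) h1
      unfold minVal
      simp only [hh, if_true]
      refine le_min t1.le (le_min le_rfl ?_)
      split_ifs with he h3
      · linarith [hε _ he]
      · exact t1.le
      · exact t1.le
  · intro q hq
    have h1 := (f3 (Γ.vert w) q).trans_lt hq
    rw [ENNReal.ofReal_lt_ofReal_iff h0, f1, if_pos rfl, zero_sub, abs_neg] at h1
    have h2 := lt_of_le_of_lt (le_abs_self _) h1
    rcases exists_rep q with ⟨w', rfl⟩ | ⟨h, t, ht, rfl⟩
    · rw [f1] at h2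
      split_ifs at h2 with h3
      · exact Or.inl (h3 ▸ rfl)
      · exact absurd h2 (lt_irrefl _)
    · right
      rw [f2 h t ht.mem] at h2
      simp only [minVal] at h2
      rcases min_lt_iff.1 h2 with h3 | h3
      · exact absurd h3 (lt_irrefl _)
      · rcases min_lt_iff.1 h3 with h4 | h4
        · split_ifs at h4 with h5
          · exact ⟨h, h5, t, ht.1, h4, rfl⟩
          · exact absurd h4 (lt_irrefl _)
        · split_ifs at h4 with he h5
          · exact ⟨Γ.flip h, h5, Γ.length h.1 - t, (ht.flip he).1, h4, (ray_flip he t).symm⟩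
          · exact absurd h4 (lt_irrefl _)
          · exact absurd h4 (lt_irrefl _)

open Classical in
/-- The path metric near an inner point of an edge or leg. -/
theorem pathEDist_near_inner {ε : ℝ} (h0 : 0 < ε) (k : Γ.H) (a : ℝ) (ha : ε ≤ a)
    (ha' : Γ.IsEdge k.1 → ε ≤ Γ.length k.1 - a) :
    (∀ t, |t| < ε → Γ.pathEDist (Γ.ray k a) (Γ.ray k (a + t)) = ENNReal.ofReal |t|) ∧
    ∀ q, Γ.pathEDist (Γ.ray k a) q < ENNReal.ofReal ε → ∃ t, |t| < ε ∧ q = Γ.ray k (a + t) := by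
  have hinner : ∀ t, |t| < ε → Γ.IsInner k (a + t) := fun t h1 =>
    ⟨by linarith [(abs_lt.1 h1).1], fun he => by linarith [(abs_lt.1 h1).2, ha' he]⟩
  have hai : Γ.IsInner k a := by simpa using hinner 0 (by simpa using h0)
  -- Now the test function is the distance to the chosen inner point, capped at `ε`; the bounds on
  -- `a` force the value `ε` at all vertices.
  obtain ⟨f, f1, f2, f3⟩ := exists_separate (Γ := Γ) (fun w' => ε)
    (fun h t => if h = k then |t - a| else ε) ε
    (fun h => by
      simp only [minVal]
      refine le_antisymm (min_le_left _ _) (le_min le_rfl (le_min ?_ ?_))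
      · split_ifs
        · rw [zero_sub, abs_neg]; exact ha.trans (le_abs_self _)
        · exact le_rfl
      · split_ifs with he h1
        · subst h1
          have h2 := ha' (isEdge_flip he)
          rw [length_flip he] at h2
          rw [sub_zero]
          exact h2.trans (le_abs_self _)
        · exact le_rfl
        · exact le_rfl)
    (fun h s t => by
      split_ifs
      · refine (abs_abs_sub_abs_le _ _).trans (le_of_eq ?_)
        congr 1; ring
      · simp)
  have fk : ∀ t, |t| < ε → f (Γ.ray k (a + t)) = |t| := by
    intro t ht
    rw [f2 _ _ (hinner t ht).mem]
    unfold minVal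
    simp only [if_true, add_sub_cancel_left]
    rw [min_eq_left (a := |t|), min_eq_right ht.le]
    split_ifs with he h1
    · exact absurd h1 (flip_ne he)
    · exact ht.le
    · exact ht.le
  constructor
  · intro t ht
    apply le_antisymm
    · have h1 := pathEDist_ray_le k a (a + t)
      rwa [sub_add_cancel_left, abs_neg] at h1
    · have h1 := f3 (Γ.ray k a) (Γ.ray k (a + t))
      have h2 := fk 0 (by simpa using h0)
      rw [add_zero, abs_zero] at h2
      rw [h2, fk t ht, zero_sub, abs_neg, abs_abs] at h1
      exact h1
  · intro q hq
    have h1 := (f3 (Γ.ray k a) q).trans_lt hq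
    have h2 := fk 0 (by simpa using h0)
    rw [add_zero, abs_zero] at h2
    rw [ENNReal.ofReal_lt_ofReal_iff h0, h2, zero_sub, abs_neg] at h1
    have h2 := lt_of_le_of_lt (le_abs_self _) h1
    rcases exists_rep q with ⟨w', rfl⟩ | ⟨h, t, ht, rfl⟩
    · rw [f1] at h2
      exact absurd h2 (lt_irrefl _)
    · rw [f2 h t ht.mem] at h2
      simp only [minVal] at h2
      rcases min_lt_iff.1 h2 with h3 | h3
      · exact absurd h3 (lt_irrefl _)
      · rcases min_lt_iff.1 h3 with h4 | h4
        · split_ifs at h4 with h5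
          · subst h5
            exact ⟨t - a, h4, by rw [add_sub_cancel]⟩
          · exact absurd h4 (lt_irrefl _)
        · split_ifs at h4 with he h5
          · subst h5
            exact ⟨_, h4, by rw [add_sub_cancel, ray_flip he]⟩
          · exact absurd h4 (lt_irrefl _)
          · exact absurd h4 (lt_irrefl _)

theorem exists_inner_bound {h : Γ.H} {t : ℝ} (ht : Γ.IsInner h t) :
    ∃ ε : ℝ, 0 < ε ∧ ε ≤ t ∧ (Γ.IsEdge h.1 → ε ≤ Γ.length h.1 - t) := by
  by_cases he : Γ.IsEdge h.1
  · exact ⟨min t (Γ.length h.1 - t), lt_min ht.1 (by linarith [ht.2 he]), min_le_left _ _,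
      fun _ => min_le_right _ _⟩
  · exact ⟨t, ht.1, le_rfl, fun h1 => absurd h1 he⟩

/-- The exact distances in a small ball around a vertex or an inner point leave only the centre at
distance zero. -/
theorem eq_of_pathEDist_eq_zero {p q : Γ.Realization} (h0 : Γ.pathEDist p q = 0) : p = q := by
  have key : ∀ w : Γ.V, ∀ q, Γ.pathEDist (Γ.vert w) q = 0 → Γ.vert w = q := by
    intro w q hq
    obtain ⟨ε, e0, e1⟩ := Γ.exists_length_bound
    obtain ⟨h1, h2⟩ := pathEDist_near_vert e0 e1 w
    rcases h2 q (by rw [hq]; simpa using e0) with h3 | ⟨h, hh, t, t0, t1, rfl⟩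
    · exact h3.symm
    · rw [h1 h hh t t0.le t1, ENNReal.ofReal_eq_zero] at hq
      linarith
  rcases exists_rep p with ⟨w, rfl⟩ | ⟨h, t, ht, rfl⟩
  · exact key w q h0
  · obtain ⟨ε, e0, e1, e2⟩ := exists_inner_bound ht
    obtain ⟨h1, h2⟩ := pathEDist_near_inner e0 h t e1 e2
    obtain ⟨s, hs, rfl⟩ := h2 q (by rw [h0]; simpa using e0)
    rw [h1 s hs, ENNReal.ofReal_eq_zero] at h0
    have : s = 0 := abs_eq_zero.1 (le_antisymm h0 (abs_nonneg _))
    rw [this, add_zero]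

end WeightedMetricGraph

/-! ### Rays in a metric space with a model -/

namespace MetricModel

variable {X : Type u} [EMetricSpace X] {g : X → ℕ} (M : MetricModel X g)

/-- A vertex of the model as a point of the space. -/
def vert (w : M.graph.V) : X := M.toFun (M.graph.vert w)

/-- The point with parameter `t` on `h`; parameters out of range are clamped. -/
noncomputable def ray (h : M.graph.H) (t : ℝ) : X := M.toFun (M.graph.ray h t)

variable {M}

theorem exists_rep (x : X) :
    (∃ w, x = M.vert w) ∨ ∃ h t, M.graph.IsInner h t ∧ x = M.ray h t := by
  obtain ⟨p, rfl⟩ := M.bijective.2 x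
  rcases WeightedMetricGraph.exists_rep p with ⟨w, rfl⟩ | ⟨h, t, ht, rfl⟩
  · exact Or.inl ⟨w, rfl⟩
  · exact Or.inr ⟨h, t, ht, rfl⟩

theorem vert_injective : Function.Injective M.vert :=
  M.bijective.1.comp WeightedMetricGraph.vert_injective

theorem toFun_pt {h : M.graph.H} {t : ℝ} (ht : t ∈ M.graph.Param h) :
    M.toFun (M.graph.pt h ⟨t, ht⟩) = M.ray h t := by
  rw [ray, WeightedMetricGraph.ray_of_mem ht]

theorem ray_zero (h : M.graph.H) : M.ray h 0 = M.vert (M.graph.root h.1) := by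
  rw [ray, WeightedMetricGraph.ray_zero]; rfl

theorem ray_length {h : M.graph.H} (he : M.graph.IsEdge h.1) :
    M.ray h (M.graph.length h.1) = M.vert (M.graph.root (M.graph.ι h.1)) := by
  rw [ray, WeightedMetricGraph.ray_length he]; rfl

theorem ray_flip {h : M.graph.H} (he : M.graph.IsEdge h.1) (t : ℝ) :
    M.ray (M.graph.flip h) (M.graph.length h.1 - t) = M.ray h t := by
  rw [ray, WeightedMetricGraph.ray_flip he]; rfl

theorem ray_flip' {h : M.graph.H} (he : M.graph.IsEdge h.1) (t : ℝ) :
    M.ray (M.graph.flip h) t = M.ray h (M.graph.length h.1 - t) := by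
  rw [ray, WeightedMetricGraph.ray_flip' he]; rfl

theorem ray_ne_vert {h : M.graph.H} {t : ℝ} (ht : M.graph.IsInner h t) (w : M.graph.V) :
    M.ray h t ≠ M.vert w :=
  fun h0 => WeightedMetricGraph.ray_ne_vert ht w (M.bijective.1 h0)

theorem ray_eq_ray {h k : M.graph.H} {s t : ℝ} (hs : M.graph.IsInner h s)
    (ht : M.graph.IsInner k t) (h0 : M.ray h s = M.ray k t) :
    (k = h ∧ t = s) ∨ (M.graph.IsEdge h.1 ∧ k = M.graph.flip h ∧ t = M.graph.length h.1 - s) :=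
  WeightedMetricGraph.ray_eq_ray hs ht (M.bijective.1 h0)

theorem ray_inj {h : M.graph.H} {s t : ℝ} (hs : M.graph.IsInner h s) (ht : M.graph.IsInner h t)
    (h0 : M.ray h s = M.ray h t) : s = t :=
  WeightedMetricGraph.ray_inj hs ht (M.bijective.1 h0)

theorem ray_clamp (h : M.graph.H) (t : ℝ) : M.ray h (M.graph.clamp h t) = M.ray h t :=
  congrArg M.toFun (WeightedMetricGraph.ray_congr
    (M.graph.clamp_of_mem (M.graph.clamp_mem h t)))

theorem edist_ray_le (h : M.graph.H) (s t : ℝ) :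
    edist (M.ray h s) (M.ray h t) ≤ ENNReal.ofReal |s - t| := by
  rw [ray, ray, M.isometry]
  exact WeightedMetricGraph.pathEDist_ray_le h s t

theorem continuous_ray (h : M.graph.H) : Continuous (M.ray h) := by
  have : LipschitzWith 1 (M.ray h) := fun s t => by
    rw [ENNReal.coe_one, one_mul, edist_dist, Real.dist_eq]
    exact edist_ray_le h s t
  exact this.continuous

theorem genus_ray {h : M.graph.H} {t : ℝ} (ht : M.graph.IsInner h t) : g (M.ray h t) = 0 :=
  M.genus_zero _ fun w => ray_ne_vert ht w

theorem near_vert {ε : ℝ} (h0 : 0 < ε) (hε : ∀ h, M.graph.IsEdge h → 2 * ε ≤ M.graph.length h)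
    (w : M.graph.V) :
    (∀ h : M.graph.H, M.graph.root h.1 = w → ∀ t, 0 ≤ t → t < ε →
      edist (M.vert w) (M.ray h t) = ENNReal.ofReal t) ∧
    ∀ q, edist (M.vert w) q < ENNReal.ofReal ε → q = M.vert w ∨
      ∃ h : M.graph.H, M.graph.root h.1 = w ∧ ∃ t, 0 < t ∧ t < ε ∧ q = M.ray h t := by
  obtain ⟨h1, h2⟩ := WeightedMetricGraph.pathEDist_near_vert h0 hε w
  refine ⟨fun h hh t t0 t1 => ?_, fun q hq => ?_⟩
  · rw [vert, ray, M.isometry]; exact h1 h hh t t0 t1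
  · obtain ⟨q, rfl⟩ := M.bijective.2 q
    rw [vert, M.isometry] at hq
    rcases h2 q hq with rfl | ⟨h, hh, t, t0, t1, rfl⟩
    · exact Or.inl rfl
    · exact Or.inr ⟨h, hh, t, t0, t1, rfl⟩

theorem near_inner {ε : ℝ} (h0 : 0 < ε) (k : M.graph.H) (a : ℝ) (ha : ε ≤ a)
    (ha' : M.graph.IsEdge k.1 → ε ≤ M.graph.length k.1 - a) :
    (∀ t, |t| < ε → edist (M.ray k a) (M.ray k (a + t)) = ENNReal.ofReal |t|) ∧
    ∀ q, edist (M.ray k a) q < ENNReal.ofReal ε → ∃ t, |t| < ε ∧ q = M.ray k (a + t) := by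
  obtain ⟨h1, h2⟩ := WeightedMetricGraph.pathEDist_near_inner h0 k a ha ha'
  refine ⟨fun t ht => ?_, fun q hq => ?_⟩
  · rw [ray, ray, M.isometry]; exact h1 t ht
  · obtain ⟨q, rfl⟩ := M.bijective.2 q
    rw [ray, M.isometry] at hq
    obtain ⟨t, ht, rfl⟩ := h2 q hq
    exact ⟨t, ht, rfl⟩

/-- A small ball around an inner point stays inside the same edge or leg and is described there by
the parameter, so openness comes from the real line. -/
theorem isOpen_ray_image {h : M.graph.H} {U : Set ℝ} (hU : IsOpen U)
    (hU' : ∀ t ∈ U, M.graph.IsInner h t) : IsOpen (M.ray h '' U) := by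
  rw [EMetric.isOpen_iff]
  rintro _ ⟨t, ht, rfl⟩
  obtain ⟨ε, e0, e1, e2⟩ := WeightedMetricGraph.exists_inner_bound (hU' t ht)
  obtain ⟨δ, d0, d1⟩ := Metric.isOpen_iff.1 hU t ht
  have h1 := near_inner (M := M) (lt_min e0 d0) h t ((min_le_left _ _).trans e1)
    (fun he => (min_le_left _ _).trans (e2 he))
  refine ⟨ENNReal.ofReal (min ε δ), by simpa using ⟨e0, d0⟩, fun q hq => ?_⟩
  obtain ⟨s, hs, rfl⟩ := h1.2 q (by rw [edist_comm]; exact hq)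
  refine ⟨t + s, d1 ?_, rfl⟩
  rw [Metric.mem_ball, Real.dist_eq, add_sub_cancel_left]
  exact hs.trans_le (min_le_right _ _)

/-- Rays are locally isometric. -/
theorem exists_edist_ray_eq {h : M.graph.H} {t : ℝ} (ht : t ∈ M.graph.Param h) :
    ∃ δ > 0, ∀ s ∈ M.graph.Param h, |s - t| < δ →
      edist (M.ray h t) (M.ray h s) = ENNReal.ofReal |s - t| := by
  obtain ⟨ε, e0, e1⟩ := M.graph.exists_length_bound
  rcases WeightedMetricGraph.isInner_or ht with rfl | ⟨he, rfl⟩ | h1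
  · refine ⟨ε, e0, fun s hs h1 => ?_⟩
    rw [sub_zero, abs_of_nonneg hs.1] at h1 ⊢
    rw [ray_zero]
    exact (near_vert e0 e1 _).1 h rfl s hs.1 h1
  · refine ⟨ε, e0, fun s hs h1 => ?_⟩
    rw [abs_sub_comm, abs_of_nonneg (sub_nonneg.2 (hs.2 he))] at h1 ⊢
    rw [ray_length he, ← ray_flip he s]
    exact (near_vert e0 e1 _).1 (M.graph.flip h) rfl _ (sub_nonneg.2 (hs.2 he)) h1
  · obtain ⟨ε, e0, e1, e2⟩ := WeightedMetricGraph.exists_inner_bound h1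
    refine ⟨ε, e0, fun s _ hs => ?_⟩
    have h2 := (near_inner (M := M) e0 h t e1 e2).1 _ hs
    rwa [add_sub_cancel] at h2

end MetricModel

/-! ### Stars -/

/-- The point `x` has a neighbourhood which is a star with the rays `c r`. -/
structure StarNhd {X : Type u} [EMetricSpace X] (x : X) {R : Type} (c : R → ℝ → X) (ε : ℝ) :
    Prop where
  pos : 0 < ε
  continuous : ∀ r, Continuous (c r)
  zero : ∀ r, c r 0 = x
  edist_eq : ∀ r t, 0 ≤ t → t < ε → edist x (c r t) = ENNReal.ofReal t
  cover : ∀ q, edist x q < ENNReal.ofReal ε → q = x ∨ ∃ r t, 0 < t ∧ t < ε ∧ q = c r t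
  inj : ∀ r s a b, 0 < a → a < ε → 0 < b → b < ε → c r a = c s b → r = s
  isOpen : ∀ r, IsOpen (c r '' Set.Ioo 0 ε)

namespace StarNhd

variable {X : Type u} [EMetricSpace X] {x : X} {R : Type} {c : R → ℝ → X} {ε : ℝ}

theorem ne (S : StarNhd x c ε) (r : R) {t : ℝ} (t0 : 0 < t) (t1 : t < ε) : c r t ≠ x := fun h => by
  have h1 := S.edist_eq r t t0.le t1
  rw [h, edist_self, eq_comm, ENNReal.ofReal_eq_zero] at h1
  linarith

/-- Since the parameter is the distance to the centre, shortening a ray means intersecting it with a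
ball; this keeps it open when the star shrinks. -/
theorem image_eq (S : StarNhd x c ε) {δ : ℝ} (hδ : δ ≤ ε) (r : R) :
    c r '' Set.Ioo 0 δ = c r '' Set.Ioo 0 ε ∩ Metric.eball x (ENNReal.ofReal δ) := by
  ext q
  constructor
  · rintro ⟨t, ⟨t0, t1⟩, rfl⟩
    refine ⟨⟨t, ⟨t0, t1.trans_le hδ⟩, rfl⟩, ?_⟩
    rw [Metric.mem_eball, edist_comm, S.edist_eq r t t0.le (t1.trans_le hδ)]
    exact (ENNReal.ofReal_lt_ofReal_iff (t0.trans t1)).2 t1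
  · rintro ⟨⟨t, ⟨t0, t1⟩, rfl⟩, h1⟩
    rw [Metric.mem_eball, edist_comm, S.edist_eq r t t0.le t1, ENNReal.ofReal_lt_ofReal_iff'] at h1
    exact ⟨t, ⟨t0, h1.1⟩, rfl⟩

theorem mono (S : StarNhd x c ε) {δ : ℝ} (d0 : 0 < δ) (hδ : δ ≤ ε) : StarNhd x c δ where
  pos := d0
  continuous := S.continuous
  zero := S.zero
  edist_eq r t t0 t1 := S.edist_eq r t t0 (t1.trans_le hδ)
  cover q hq := by
    rcases S.cover q (hq.trans_le (ENNReal.ofReal_le_ofReal hδ)) with h1 | ⟨r, t, t0, t1, rfl⟩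
    · exact Or.inl h1
    · rw [S.edist_eq r t t0.le t1, ENNReal.ofReal_lt_ofReal_iff'] at hq
      exact Or.inr ⟨r, t, t0, hq.1, rfl⟩
  inj r s a b a0 a1 b0 b1 := S.inj r s a b a0 (a1.trans_le hδ) b0 (b1.trans_le hδ)
  isOpen r := by
    rw [S.image_eq hδ]
    exact (S.isOpen r).inter Metric.isOpen_eball

end StarNhd

/-- No topology on the target is involved, so `f` may come from arbitrary choices as long as its
fibres are relatively open. -/
theorem IsPreconnected.eq_of_isOpen_fibers {α β : Type*} [TopologicalSpace α] {I : Set α}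
    (hI : IsPreconnected I) (f : α → β) (hf : ∀ b, ∃ U, IsOpen U ∧ I ∩ U = I ∩ f ⁻¹' {b})
    {s t : α} (hs : s ∈ I) (ht : t ∈ I) : f s = f t := by
  have : PreconnectedSpace I := Subtype.preconnectedSpace hI
  have h1 : IsLocallyConstant (fun z : I => f z) := by
    rw [IsLocallyConstant.iff_isOpen_fiber]
    intro b
    obtain ⟨U, hU, h2⟩ := hf b
    rw [isOpen_induced_iff]
    refine ⟨U, hU, ?_⟩
    ext ⟨z, hz⟩
    have h3 := Set.ext_iff.1 h2 z
    simpa [hz] using h3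
  exact h1.apply_eq_of_preconnectedSpace ⟨s, hs⟩ ⟨t, ht⟩

/-- With finitely many values, the complement of a fibre is a finite union of closed fibres, so
closed fibres are open. The values will be stabilizers and cosets, whose fibres are cut out by
equalities of continuous maps. -/
theorem IsPreconnected.eq_of_isClosed_fibers {α β : Type*} [TopologicalSpace α] [Finite β]
    {I : Set α} (hI : IsPreconnected I) (f : α → β)
    (hf : ∀ b, ∃ U, IsClosed U ∧ I ∩ U = I ∩ f ⁻¹' {b})
    {s t : α} (hs : s ∈ I) (ht : t ∈ I) : f s = f t := by
  refine hI.eq_of_isOpen_fibers f (fun b => ?_) hs ht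
  choose U hU hU' using hf
  refine ⟨(⋃ a ∈ {a | a ≠ b}, U a)ᶜ,
    (Set.Finite.isClosed_biUnion (Set.toFinite _) fun a _ => hU a).isOpen_compl, ?_⟩
  ext z
  simp only [Set.mem_inter_iff, Set.mem_compl_iff, Set.mem_iUnion, Set.mem_preimage,
    Set.mem_singleton_iff, not_exists]
  refine and_congr_right fun hz => ?_
  have h1 : ∀ a, z ∈ U a ↔ f z = a := fun a => by
    have h3 := Set.ext_iff.1 (hU' a) z
    simpa [hz] using h3
  constructor
  · intro h2
    by_contra h3
    exact h2 (f z) h3 ((h1 _).2 rfl)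
  · rintro rfl a ha h2
    exact ha ((h1 a).1 h2).symm

/-- A path leaving the centre of a star at unit speed runs along one of the rays. -/
theorem StarNhd.exists_eq_ray {X : Type u} [EMetricSpace X] {x : X} {R : Type} {c : R → ℝ → X}
    {ε : ℝ} (S : StarNhd x c ε) {γ : ℝ → X} {δ : ℝ} (hδ : 0 < δ) (hγ : ContinuousOn γ (Set.Ico 0 δ))
    (h : ∀ t, 0 ≤ t → t < δ → edist x (γ t) = ENNReal.ofReal t) :
    ∃ r, ∃ δ' > 0, δ' ≤ ε ∧ ∀ t, 0 ≤ t → t < δ' → γ t = c r t := by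
  let m := min δ ε
  have hm : 0 < m := lt_min hδ S.pos
  -- The distance to the centre determines the parameter on a ray, so only the index of the ray can
  -- still depend on `t`.
  have key : ∀ t ∈ Set.Ioo 0 m, ∃ r, γ t = c r t := by
    rintro t ⟨t0, t1⟩
    have h1 := h t t0.le (t1.trans_le (min_le_left _ _))
    rcases S.cover (γ t) (by
      rw [h1]
      exact (ENNReal.ofReal_lt_ofReal_iff S.pos).2 (t1.trans_le (min_le_right _ _))) with
      h2 | ⟨r, s, s0, s1, h2⟩
    · rw [h2, edist_self, eq_comm, ENNReal.ofReal_eq_zero] at h1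
      linarith
    · rw [h2, S.edist_eq r s s0.le s1, ENNReal.ofReal_eq_ofReal_iff s0.le t0.le] at h1
      exact ⟨r, by rw [h2, h1]⟩
  have hR : Nonempty R := ⟨(key (m / 2) ⟨by linarith, by linarith⟩).choose⟩
  choose! f hf using key
  -- The rays are open and pairwise disjoint, hence the index is constant on the connected interval.
  have hc : ∀ s ∈ Set.Ioo 0 m, ∀ t ∈ Set.Ioo 0 m, f s = f t := by
    intro s hs t ht
    refine (isPreconnected_Ioo (a := 0) (b := m)).eq_of_isOpen_fibers f (fun r => ?_) hs ht
    have h1 : ContinuousOn γ (Set.Ioo 0 m) :=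
      hγ.mono fun t ht => ⟨ht.1.le, ht.2.trans_le (min_le_left _ _)⟩
    obtain ⟨U, hU, h2⟩ := (continuousOn_iff'.1 h1) _ (S.isOpen r)
    refine ⟨U, hU, ?_⟩
    rw [Set.inter_comm, ← h2, Set.inter_comm]
    ext t
    refine and_congr_right fun ht => ?_
    simp only [Set.mem_preimage, Set.mem_singleton_iff]
    constructor
    · rintro ⟨a, ha, h3⟩
      rw [hf t ht] at h3
      exact (S.inj _ _ _ _ ha.1 ha.2 ht.1 (ht.2.trans_le (min_le_right _ _)) h3).symm
    · rintro rfl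
      exact ⟨t, ⟨ht.1, ht.2.trans_le (min_le_right _ _)⟩, (hf t ht).symm⟩
  refine ⟨f (m / 2), m, hm, min_le_right _ _, fun t t0 t1 => ?_⟩
  rcases t0.eq_or_lt with rfl | t0
  · rw [S.zero]
    have h1 := h 0 le_rfl hδ
    rw [ENNReal.ofReal_zero, edist_eq_zero] at h1
    exact h1.symm
  · rw [hf t ⟨t0, t1⟩, hc _ ⟨t0, t1⟩ (m / 2) ⟨by linarith, by linarith⟩]

namespace MetricModel

variable {X : Type u} [EMetricSpace X] {g : X → ℕ} {M : MetricModel X g}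

theorem star_vert {ε : ℝ} (h0 : 0 < ε)
    (hε : ∀ h, M.graph.IsEdge h → 2 * ε ≤ M.graph.length h) (w : M.graph.V) :
    StarNhd (M.vert w) (fun h : {h : M.graph.H // M.graph.root h.1 = w} => M.ray h.1) ε := by
  obtain ⟨h1, h2⟩ := near_vert h0 hε w
  have hi : ∀ (h : M.graph.H) t, 0 < t → t < ε → M.graph.IsInner h t := fun h t t0 t1 =>
    ⟨t0, fun he => by linarith [hε _ he]⟩
  refine ⟨h0, fun _ => continuous_ray _, fun ⟨h, hh⟩ => ?_, fun ⟨h, hh⟩ t t0 t1 => h1 h hh t t0 t1,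
    fun q hq => ?_, ?_, fun ⟨h, hh⟩ => ?_⟩
  · rw [ray_zero, hh]
  · rcases h2 q hq with h3 | ⟨h, hh, t, t0, t1, h3⟩
    · exact Or.inl h3
    · exact Or.inr ⟨⟨h, hh⟩, t, t0, t1, h3⟩
  · rintro ⟨h, hh⟩ ⟨k, hk⟩ a b a0 a1 b0 b1 h3
    rcases ray_eq_ray (hi h a a0 a1) (hi k b b0 b1) h3 with ⟨rfl, -⟩ | ⟨he, rfl, rfl⟩
    · rfl
    -- Two opposite ends of one edge would have both `a` and `length - a` below `ε`.
    · linarith [hε _ he]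
  · exact isOpen_ray_image isOpen_Ioo fun t ht => hi h t ht.1 ht.2

theorem star_inner {ε : ℝ} (h0 : 0 < ε) (k : M.graph.H) (a : ℝ) (ha : ε ≤ a)
    (ha' : M.graph.IsEdge k.1 → ε ≤ M.graph.length k.1 - a) :
    StarNhd (M.ray k a) (fun (b : Bool) t => M.ray k (a + if b then t else -t)) ε := by
  obtain ⟨h1, h2⟩ := near_inner h0 k a ha ha'
  have hi : ∀ t, |t| < ε → M.graph.IsInner k (a + t) := fun t h1 =>
    ⟨by linarith [(abs_lt.1 h1).1], fun he => by linarith [(abs_lt.1 h1).2, ha' he]⟩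
  have hs : ∀ (b : Bool) (t : ℝ), |if b then t else -t| = |t| := by rintro (_ | _) t <;> simp
  refine ⟨h0, fun b => ?_, fun b => by simp, fun b t t0 t1 => ?_, fun q hq => ?_, ?_, fun b => ?_⟩
  · cases b
    · exact (continuous_ray k).comp (by simp only [Bool.false_eq_true, if_false]; fun_prop)
    · exact (continuous_ray k).comp (by simp only [if_true]; fun_prop)
  · rw [h1 _ (by rw [hs, abs_of_nonneg t0]; exact t1), hs, abs_of_nonneg t0]
  · obtain ⟨t, ht, rfl⟩ := h2 q hq
    rcases lt_trichotomy t 0 with h3 | rfl | h3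
    · exact Or.inr ⟨false, -t, by linarith, by rwa [abs_of_neg h3] at ht, by simp⟩
    · exact Or.inl (by simp)
    · exact Or.inr ⟨true, t, h3, by rwa [abs_of_pos h3] at ht, by simp⟩
  · intro b d s t s0 s1 t0 t1 h3
    have h4 := ray_inj (hi _ (by rw [hs, abs_of_pos s0]; exact s1))
      (hi _ (by rw [hs, abs_of_pos t0]; exact t1)) h3
    cases b <;> cases d <;> simp at h4 ⊢ <;> linarith
  · have h3 : (fun t => M.ray k (a + if b = true then t else -t)) '' Set.Ioo 0 ε =
        M.ray k '' ((fun t => a + if b = true then t else -t) '' Set.Ioo 0 ε) := by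
      rw [Set.image_image]
    rw [h3]
    refine isOpen_ray_image ?_ ?_
    · cases b
      · have h4 : (fun t => a + if false = true then t else -t) '' Set.Ioo 0 ε
            = (fun t => a - t) '' Set.Ioo 0 ε := by simp [sub_eq_add_neg]
        rw [h4, Set.image_const_sub_Ioo]
        exact isOpen_Ioo
      · simp only [if_true, Set.image_const_add_Ioo]
        exact isOpen_Ioo
    · rintro _ ⟨t, ⟨t0, t1⟩, rfl⟩
      exact hi _ (by rw [hs, abs_of_pos t0]; exact t1)

end MetricModel

/-! ### The local form of a harmonic morphism -/

namespace HarmonicMorphism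

variable {Γ' Γ : WeightedMetricGraph} (φ : HarmonicMorphism Γ' Γ)

theorem isEdge_iff {h : Γ'.X} (hh : Γ'.IsHalfEdge h) : Γ.IsEdge (φ.toFun h) ↔ Γ'.IsEdge h := by
  refine ⟨fun h1 => ⟨hh, fun h2 => h1.2 (φ.map_leg h ⟨hh, h2⟩).2⟩, φ.map_edge h⟩

theorem deg_pos_real (x : Γ'.X) : (0 : ℝ) < φ.deg x := Nat.cast_pos.2 (φ.deg_pos x)

theorem clamp_map (h : Γ'.H) (t : ℝ) :
    Γ.clamp (φ.mapH h) (φ.deg h.1 * t) = φ.deg h.1 * Γ'.clamp h t := by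
  have hd := φ.deg_pos_real h.1
  have he := φ.isEdge_iff h.2
  unfold WeightedMetricGraph.clamp
  have he' : Γ.IsEdge (φ.mapH h).1 ↔ Γ'.IsEdge h.1 := he
  by_cases h1 : Γ'.IsEdge h.1
  · have hl : Γ.length (φ.mapH h).1 = φ.deg h.1 * Γ'.length h.1 := φ.length_eq _ h1
    rw [if_pos h1, if_pos (he'.2 h1), hl, mul_max_of_nonneg _ _ hd.le, mul_zero,
      mul_min_of_nonneg _ _ hd.le]
  · rw [if_neg h1, if_neg (he'.not.2 h1), mul_max_of_nonneg _ _ hd.le, mul_zero]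

theorem realize_ray (h : Γ'.H) (t : ℝ) :
    φ.realize (Γ'.ray h t) = Γ.ray (φ.mapH h) (φ.deg h.1 * t) := by
  unfold WeightedMetricGraph.ray
  refine congrArg (Γ.pt (φ.mapH h)) (Subtype.ext ?_)
  exact (φ.clamp_map h t).symm

theorem isInner_map_iff {h : Γ'.H} {t : ℝ} :
    Γ.IsInner (φ.mapH h) (φ.deg h.1 * t) ↔ Γ'.IsInner h t := by
  have hd := φ.deg_pos_real h.1
  have he : Γ.IsEdge (φ.mapH h).1 ↔ Γ'.IsEdge h.1 := φ.isEdge_iff h.2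
  unfold WeightedMetricGraph.IsInner
  rw [he, mul_pos_iff_of_pos_left hd]
  refine and_congr_right fun _ => forall_congr' fun h1 => ?_
  have hl : Γ.length (φ.mapH h).1 = φ.deg h.1 * Γ'.length h.1 := φ.length_eq _ h1
  rw [hl, mul_lt_mul_iff_right₀ hd]

/-- If no half-edge at `w` lay over `h`, the sum in the harmonicity condition would be empty,
although the degree of `w` is positive. -/
theorem exists_halfEdge_over (w : Γ'.V) (h : Γ.X) (hh : Γ.IsHalfEdge h)
    (hr : Γ.r h = φ.toFun w.1) : ∃ h' ∈ Γ'.tangent w, φ.toFun h' = h := by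
  by_contra h0
  push Not at h0
  have h1 := φ.harmonic w h hh hr
  have h2 : {h' | h' ∈ Γ'.tangent w ∧ φ.toFun h' = h} = ∅ := by
    ext h'
    simpa using h0 h'
  rw [h2, finsum_mem_empty] at h1
  exact (φ.deg_pos w.1).ne' h1

end HarmonicMorphism

/-- The form of a harmonic morphism near a point: a map of stars. -/
structure LocalForm {Y X : Type u} [EMetricSpace Y] [EMetricSpace X] (τ : Y → X) (d : Y → ℕ)
    (y : Y) where
  R' : Type
  R : Type
  [finite : Finite R']
  c' : R' → ℝ → Y
  c : R → ℝ → X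
  ε' : ℝ
  ε : ℝ
  star' : StarNhd y c' ε'
  star : StarNhd (τ y) c ε
  π : R' → R
  surj : Function.Surjective π
  deg : R' → ℕ
  deg_pos : ∀ r, 0 < deg r
  map_c' : ∀ r t, τ (c' r t) = c (π r) (deg r * t)
  degree : ∀ r t, 0 < t → t < ε' → d (c' r t) = deg r

instance (Γ : LegGraph) : Finite Γ.X := Γ.finite

namespace IsModelOf

variable {Y X : TropicalCurve.{u}} {τ : Y → X} {d : Y → ℕ} {M' : Y.Model} {M : X.Model}
  {φ : HarmonicMorphism M'.graph M.graph}

theorem map_vert (h : IsModelOf τ d M' M φ) (w : M'.graph.V) :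
    τ (M'.vert w) = M.vert (φ.mapV w) := h.comm _

theorem map_ray (h : IsModelOf τ d M' M φ) (k : M'.graph.H) (t : ℝ) :
    τ (M'.ray k t) = M.ray (φ.mapH k) (φ.deg k.1 * t) := by
  rw [MetricModel.ray, h.comm, φ.realize_ray]; rfl

theorem degree_ray (h : IsModelOf τ d M' M φ) {k : M'.graph.H} {t : ℝ}
    (ht : M'.graph.IsInner k t) : d (M'.ray k t) = φ.deg k.1 := by
  rw [← MetricModel.toFun_pt ht.mem]
  exact h.deg_interior k _ ht.1 ht.2

/-- At a vertex the rays are the half-edges rooted there; at an inner point they are the two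
directions along its edge or leg, both stretched by the same degree. -/
theorem nonempty_localForm (h : IsModelOf τ d M' M φ) (y : Y) : Nonempty (LocalForm τ d y) := by
  rcases MetricModel.exists_rep (M := M') y with ⟨w, rfl⟩ | ⟨k, a, ha, rfl⟩
  · obtain ⟨ε', e0', e1'⟩ := M'.graph.exists_length_bound
    obtain ⟨ε, e0, e1⟩ := M.graph.exists_length_bound
    refine ⟨{
      R' := {h : M'.graph.H // M'.graph.root h.1 = w}
      R := {h : M.graph.H // M.graph.root h.1 = φ.mapV w}
      c' := fun h => M'.ray h.1
      c := fun h => M.ray h.1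
      ε' := ε'
      ε := ε
      star' := MetricModel.star_vert e0' e1' w
      star := by
        rw [h.map_vert]
        exact MetricModel.star_vert e0 e1 _
      π := fun k => ⟨φ.mapH k.1, by
        obtain ⟨k, rfl⟩ := k
        exact Subtype.ext (φ.map_r k.1).symm⟩
      surj := ?_
      deg := fun k => φ.deg k.1.1
      deg_pos := fun _ => φ.deg_pos _
      map_c' := fun k t => h.map_ray _ _
      degree := fun k t t0 t1 => h.degree_ray ⟨t0, fun he => by linarith [e1' _ he]⟩ }⟩
    rintro ⟨k, hk⟩
    obtain ⟨k', hk', h1⟩ := φ.exists_halfEdge_over w k.1 k.2 (congrArg Subtype.val hk)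
    exact ⟨⟨⟨k', hk'.1⟩, Subtype.ext hk'.2⟩, Subtype.ext (Subtype.ext h1)⟩
  · obtain ⟨ε', e0', e1', e2'⟩ := WeightedMetricGraph.exists_inner_bound ha
    have ha2 : M.graph.IsInner (φ.mapH k) (φ.deg k.1 * a) := φ.isInner_map_iff.2 ha
    obtain ⟨ε, e0, e1, e2⟩ := WeightedMetricGraph.exists_inner_bound ha2
    exact ⟨{
      R' := Bool
      R := Bool
      c' := fun b t => M'.ray k (a + if b then t else -t)
      c := fun b t => M.ray (φ.mapH k) (φ.deg k.1 * a + if b then t else -t)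
      ε' := ε'
      ε := ε
      star' := MetricModel.star_inner e0' k a e1' e2'
      star := by
        rw [h.map_ray]
        exact MetricModel.star_inner e0 _ _ e1 e2
      π := id
      surj := Function.surjective_id
      deg := fun _ => φ.deg k.1
      deg_pos := fun _ => φ.deg_pos _
      map_c' := fun b t => by
        rw [h.map_ray, mul_add]
        cases b <;> simp
      degree := fun b t t0 t1 => h.degree_ray (by
        cases b
        · exact ⟨by simp; linarith, fun he => by simp; linarith [ha.2 he]⟩
        · exact ⟨by simp; linarith, fun he => by simp; linarith [e2' he]⟩) }⟩

end IsModelOf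

namespace LocalForm

variable {Y X : Type u} [EMetricSpace Y] [EMetricSpace X] {τ : Y → X} {d : Y → ℕ} {y : Y}

/-- Near `y`, the map `τ` multiplies distances to `y` by the local degrees. -/
theorem exists_edist_eq (L : LocalForm τ d y) : ∃ δ : ℝ, 0 < δ ∧
    ∀ z, edist y z < ENNReal.ofReal δ → edist (τ y) (τ z) = d z * edist y z := by
  have := L.finite
  have h0 : ∃ δ : ℝ, 0 < δ ∧ δ ≤ L.ε' ∧ ∀ r, L.deg r * δ ≤ L.ε := by
    cases nonempty_fintype L.R'
    -- The radius is so small that rays remain in the target star after stretching by any of the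
    -- degrees; the summand `1` keeps the denominator positive when there are no rays.
    refine ⟨min L.ε' (L.ε / (1 + ∑ r, (L.deg r : ℝ))), lt_min L.star'.pos
      (div_pos L.star.pos (by positivity)), min_le_left _ _, fun r => ?_⟩
    have h1 : (L.deg r : ℝ) ≤ 1 + ∑ r, (L.deg r : ℝ) := by
      have := Finset.single_le_sum (f := fun r => (L.deg r : ℝ)) (fun _ _ => by positivity)
        (Finset.mem_univ r)
      linarith
    have h2 : (0 : ℝ) < 1 + ∑ r, (L.deg r : ℝ) := by positivity
    calc (L.deg r : ℝ) * min L.ε' (L.ε / (1 + ∑ r, (L.deg r : ℝ)))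
        ≤ (1 + ∑ r, (L.deg r : ℝ)) * (L.ε / (1 + ∑ r, (L.deg r : ℝ))) :=
          mul_le_mul h1 (min_le_right _ _) (le_min L.star'.pos.le
            (div_nonneg L.star.pos.le h2.le)) h2.le
      _ = L.ε := mul_div_cancel₀ _ h2.ne'
  obtain ⟨δ, d0, d1, d2⟩ := h0
  refine ⟨δ, d0, fun z hz => ?_⟩
  rcases L.star'.cover z (hz.trans_le (ENNReal.ofReal_le_ofReal d1)) with
    rfl | ⟨r, t, t0, t1, rfl⟩
  · simp
  · rw [L.star'.edist_eq r t t0.le t1, ENNReal.ofReal_lt_ofReal_iff d0] at hz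
    have hd : (0 : ℝ) < L.deg r := Nat.cast_pos.2 (L.deg_pos r)
    rw [L.map_c', L.degree r t t0 t1, L.star'.edist_eq r t t0.le t1,
      L.star.edist_eq _ _ (by positivity)
        ((mul_lt_mul_of_pos_left hz hd).trans_le (d2 r)), ENNReal.ofReal_mul hd.le,
      ENNReal.ofReal_natCast]

/-- Distances to `y` are multiplied by one of finitely many degrees, so the sum of the degrees is a
Lipschitz constant at `y`. -/
theorem continuousAt (L : LocalForm τ d y) : ContinuousAt τ y := by
  have := L.finite
  cases nonempty_fintype L.R'
  obtain ⟨δ, d0, d1⟩ := L.exists_edist_eq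
  have h1 : ∀ᶠ z in 𝓝 y, edist (τ z) (τ y) ≤ (∑ r, L.deg r : ℕ) * edist z y := by
    have h2 : 0 < min (ENNReal.ofReal δ) (ENNReal.ofReal L.ε') := by
      simpa using ⟨d0, L.star'.pos⟩
    filter_upwards [Metric.eball_mem_nhds y h2] with z hz
    rw [Metric.mem_eball, edist_comm] at hz
    rw [edist_comm, d1 z (hz.trans_le (min_le_left _ _)), edist_comm]
    rcases L.star'.cover z (hz.trans_le (min_le_right _ _)) with rfl | ⟨r, t, t0, t1, rfl⟩
    · simp
    · rw [L.degree r t t0 t1]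
      gcongr
      exact Finset.single_le_sum (f := L.deg) (fun _ _ => by positivity) (Finset.mem_univ r)
  rw [ContinuousAt, tendsto_iff_edist_tendsto_0]
  refine tendsto_of_tendsto_of_tendsto_of_le_of_le' tendsto_const_nhds ?_
    (Eventually.of_forall fun _ => bot_le) h1
  have h3 : Tendsto (fun z => edist z y) (𝓝 y) (𝓝 0) := tendsto_iff_edist_tendsto_0.1 tendsto_id
  have h4 := ENNReal.Tendsto.const_mul (a := ((∑ r, L.deg r : ℕ) : ℝ≥0∞)) h3
    (Or.inr (ENNReal.natCast_ne_top _))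
  rwa [mul_zero] at h4

/-- Paths of unit speed lift locally. -/
theorem exists_lift (L : LocalForm τ d y) {γ : ℝ → X} {δ : ℝ} (hδ : 0 < δ)
    (hγ : ContinuousOn γ (Set.Ico 0 δ))
    (h : ∀ t, 0 ≤ t → t < δ → edist (τ y) (γ t) = ENNReal.ofReal t) :
    ∃ σ : ℝ → Y, Continuous σ ∧ ∃ δ' > 0, ∀ t, 0 ≤ t → t < δ' → τ (σ t) = γ t := by
  obtain ⟨r, δ', d0, -, d1⟩ := L.star.exists_eq_ray hδ hγ h
  obtain ⟨r', rfl⟩ := L.surj r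
  have hd : (L.deg r' : ℝ) ≠ 0 := Nat.cast_ne_zero.2 (L.deg_pos r').ne'
  refine ⟨fun t => L.c' r' (t / L.deg r'), (L.star'.continuous r').comp (by fun_prop), δ', d0,
    fun t t0 t1 => ?_⟩
  rw [L.map_c', d1 t t0 t1, mul_div_cancel₀ _ hd]

end LocalForm

/-! ### Subcurves and cells -/

namespace WeightedMetricGraph

variable {Γ : WeightedMetricGraph}

theorem isPreconnected_isInner (h : Γ.H) : IsPreconnected {t | Γ.IsInner h t} := by
  by_cases he : Γ.IsEdge h.1
  · have : {t | Γ.IsInner h t} = Set.Ioo 0 (Γ.length h.1) := by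
      ext t; simp [IsInner, he]
    rw [this]; exact isPreconnected_Ioo
  · have : {t | Γ.IsInner h t} = Set.Ioi 0 := by
      ext t; simp [IsInner, he]
    rw [this]; exact isPreconnected_Ioi

theorem param_subset_closure (h : Γ.H) : Γ.Param h ⊆ closure {t | Γ.IsInner h t} := by
  by_cases he : Γ.IsEdge h.1
  · have : {t | Γ.IsInner h t} = Set.Ioo 0 (Γ.length h.1) := by
      ext t; simp [IsInner, he]
    rw [this, closure_Ioo (Γ.length_pos _ he).ne]
    exact fun t ht => ⟨ht.1, ht.2 he⟩
  · have : {t | Γ.IsInner h t} = Set.Ioi 0 := by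
      ext t; simp [IsInner, he]
    rw [this, closure_Ioi]
    exact fun t ht => ht.1

theorem exists_isInner (h : Γ.H) : ∃ t, Γ.IsInner h t := by
  by_cases he : Γ.IsEdge h.1
  · exact ⟨Γ.length h.1 / 2, by linarith [Γ.length_pos _ he], fun _ => by
      linarith [Γ.length_pos _ he]⟩
  · exact ⟨1, one_pos, fun h1 => absurd h1 he⟩

theorem cell_eq_singleton (w : Γ.V) : Γ.cell w.1 = {Γ.vert w} := by
  ext p
  constructor
  · rintro (⟨hx, rfl⟩ | ⟨hx, -⟩)
    · rfl
    · exact absurd w.2 hx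
  · rintro rfl
    exact Or.inl ⟨w.2, rfl⟩

theorem cell_eq_range (h : Γ.H) : Γ.cell h.1 = Set.range (Γ.ray h) := by
  ext p
  constructor
  · rintro (⟨hx, -⟩ | ⟨hx, t, rfl⟩)
    · exact absurd hx h.2
    · exact ⟨t.1, (pt_eq_ray _ _).symm⟩
  · rintro ⟨t, rfl⟩
    exact Or.inr ⟨h.2, _, rfl⟩

theorem isVertex_or (x : Γ.X) : (∃ w : Γ.V, x = w.1) ∨ ∃ h : Γ.H, x = h.1 := by
  by_cases hx : Γ.IsVertex x
  · exact Or.inl ⟨⟨x, hx⟩, rfl⟩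
  · exact Or.inr ⟨⟨x, hx⟩, rfl⟩

theorem cell_r_subset (x : Γ.X) : Γ.cell (Γ.r x) ⊆ Γ.cell x := by
  by_cases hx : Γ.IsVertex x
  · have : Γ.r x = x := hx
    rw [this]
  · exact Γ.vert_root_mem_cell hx

theorem cell_ι_eq (x : Γ.X) : Γ.cell (Γ.ι x) = Γ.cell x := by
  by_cases h1 : Γ.ι x = x
  · rw [h1]
  · refine Γ.cell_ι ⟨fun hx => h1 ?_, h1⟩
    rw [← hx, Γ.ι_r]

end WeightedMetricGraph

namespace MetricModel

variable {X : Type u} [EMetricSpace X] {g : X → ℕ} (M : MetricModel X g)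

/-- A union of closed cells of the model. -/
def Cellular (A : Set X) : Prop :=
  ∀ h t, M.graph.IsInner h t → M.ray h t ∈ A → ∀ s, M.ray h s ∈ A

theorem image_cell_vert (w : M.graph.V) : M.toFun '' M.graph.cell w.1 = {M.vert w} := by
  rw [WeightedMetricGraph.cell_eq_singleton, Set.image_singleton]; rfl

theorem image_cell_halfEdge (h : M.graph.H) :
    M.toFun '' M.graph.cell h.1 = Set.range (M.ray h) := by
  rw [WeightedMetricGraph.cell_eq_range, ← Set.range_comp]; rfl

/-- One direction takes all elements whose closed cells lie in `A`. For the other, an inner point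
lies only in the cell of its own half-edge and of the flipped one, and these two cells coincide. -/
theorem cellular_iff (A : Set X) : M.Cellular A ↔
    ∃ Δ : M.graph.Subgraph, A = M.toFun '' M.graph.subRealization Δ := by
  constructor
  · intro hA
    refine ⟨⟨{x | M.toFun '' M.graph.cell x ⊆ A}, fun x hx =>
      (Set.image_mono (WeightedMetricGraph.cell_r_subset x)).trans hx, fun x hx => by
      rw [Set.mem_ofPred_eq, WeightedMetricGraph.cell_ι_eq]; exact hx⟩, ?_⟩
    apply Set.Subset.antisymm
    · intro p hp
      have key : ∃ x, M.toFun '' M.graph.cell x ⊆ A ∧ p ∈ M.toFun '' M.graph.cell x := by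
        rcases exists_rep (M := M) p with ⟨w, rfl⟩ | ⟨h, t, ht, rfl⟩
        · refine ⟨w.1, ?_, ?_⟩
          · rw [image_cell_vert]; exact Set.singleton_subset_iff.2 hp
          · rw [image_cell_vert]; rfl
        · refine ⟨h.1, ?_, ?_⟩
          · rw [image_cell_halfEdge]
            rintro _ ⟨s, rfl⟩
            exact hA h t ht hp s
          · rw [image_cell_halfEdge]; exact ⟨t, rfl⟩
      obtain ⟨x, hx, q, hq, rfl⟩ := key
      exact ⟨q, Set.mem_biUnion (show x ∈ {x | M.toFun '' M.graph.cell x ⊆ A} from hx) hq, rfl⟩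
    · rintro _ ⟨q, hq, rfl⟩
      obtain ⟨x, hx, hq⟩ := Set.mem_iUnion₂.1 hq
      exact hx ⟨q, hq, rfl⟩
  · rintro ⟨Δ, rfl⟩ h t ht hp s
    obtain ⟨q, hq, hq'⟩ := hp
    obtain ⟨x, hx, hq⟩ := Set.mem_iUnion₂.1 hq
    have h1 : M.ray h t ∈ M.toFun '' M.graph.cell x := ⟨q, hq, hq'⟩
    have h2 : ∀ x ∈ Δ.carrier, M.toFun '' M.graph.cell x ⊆
        M.toFun '' M.graph.subRealization Δ := fun x hx =>
      Set.image_mono (Set.subset_biUnion_of_mem (u := fun x => M.graph.cell x) hx)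
    refine h2 x hx ?_
    rcases WeightedMetricGraph.isVertex_or x with ⟨w, rfl⟩ | ⟨k, rfl⟩
    · rw [image_cell_vert] at h1
      exact absurd h1 (ray_ne_vert ht w)
    · rw [image_cell_halfEdge] at h1 ⊢
      obtain ⟨a, ha⟩ := h1
      rw [← ray_clamp] at ha
      rcases WeightedMetricGraph.isInner_or (M.graph.clamp_mem k a) with h3 | ⟨he, h3⟩ | h3
      · rw [h3, ray_zero] at ha
        exact absurd ha.symm (ray_ne_vert ht _)
      · rw [h3, ray_length he] at ha
        exact absurd ha.symm (ray_ne_vert ht _)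
      · rcases ray_eq_ray h3 ht ha with ⟨rfl, -⟩ | ⟨he, rfl, -⟩
        · exact ⟨s, rfl⟩
        · exact ⟨_, (ray_flip' he s).symm⟩

end MetricModel

namespace GStratification.FramedModel

variable {G : Type v} [AddCommGroup G] {X : TropicalCurve.{u}} {S : GStratification G X}
  (F : S.FramedModel)

theorem cellular (H : AddSubgroup G) : F.model.Cellular (S.sub H) :=
  (F.model.cellular_iff _).2 (F.compatible H)

theorem datum_vert (w : F.model.graph.V) : F.datum.D w.1 = S.dilation (F.model.vert w) := by
  change sSup {H | F.model.toFun '' F.model.graph.cell w.1 ⊆ S.sub H} = sSup _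
  simp only [MetricModel.image_cell_vert, Set.singleton_subset_iff]

/-- Each `X_H` is a union of closed cells, so a single inner point decides whether it contains the
whole cell. -/
theorem datum_halfEdge {h : F.model.graph.H} {t : ℝ} (ht : F.model.graph.IsInner h t) :
    F.datum.D h.1 = S.dilation (F.model.ray h t) := by
  change sSup {H | F.model.toFun '' F.model.graph.cell h.1 ⊆ S.sub H} = sSup _
  congr 1
  ext H
  simp only [MetricModel.image_cell_halfEdge, Set.mem_ofPred_eq]
  refine ⟨fun h1 => h1 ⟨t, rfl⟩, fun h1 => ?_⟩
  rintro _ ⟨s, rfl⟩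
  exact F.cellular H h t ht h1 s

theorem datum_root (h : F.model.graph.H) :
    F.datum.D (F.model.graph.root h.1).1 = S.dilation (F.model.ray h 0) := by
  rw [MetricModel.ray_zero, datum_vert]

end GStratification.FramedModel

/-! ### Stabilizers and local degrees of a cover -/

namespace GCover

variable {G : Type v} [AddCommGroup G] {X : TropicalCurve.{u}} (τ : GCover G X)

theorem nonempty_localForm (y : τ.total) : Nonempty (LocalForm τ.map τ.degree y) := by
  obtain ⟨M', M, φ, h⟩ := τ.harmonic
  exact h.nonempty_localForm y

theorem continuous_map : Continuous τ.map :=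
  continuous_iff_continuousAt.2 fun y => (τ.nonempty_localForm y).some.continuousAt

theorem continuous_vadd (g : G) : Continuous fun y : τ.total => g +ᵥ y :=
  (Isometry.continuous fun y z => τ.edist_vadd g y z)

/-- An empty fibre would have degree sum `0` instead of the positive number `#G`. -/
theorem surjective_map [Finite G] : Function.Surjective τ.map := by
  intro x
  by_contra h0
  have h1 : {y | τ.map y = x} = ∅ := by
    ext y
    simp only [Set.mem_ofPred_eq, Set.mem_empty_iff_false, iff_false]
    exact fun h2 => h0 ⟨y, h2⟩
  have h2 := τ.degree_eq x
  rw [h1, finsum_mem_empty] at h2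
  exact Nat.card_pos.ne h2

theorem stabilizer_vadd {Y : Type*} [AddAction G Y] (g : G) (y : Y) :
    AddAction.stabilizer G (g +ᵥ y) = AddAction.stabilizer G y := by
  ext k
  simp only [AddAction.mem_stabilizer_iff]
  rw [vadd_vadd, add_comm, ← vadd_vadd, vadd_left_cancel_iff]

theorem stabilizer_eq {y z : τ.total} (h : τ.map y = τ.map z) :
    AddAction.stabilizer G y = AddAction.stabilizer G z := by
  obtain ⟨g, rfl⟩ := τ.transitive y z h
  rw [stabilizer_vadd]

theorem vadd_eq_vadd_iff {Y : Type*} [AddAction G Y] (g k : G) (y : Y) :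
    g +ᵥ y = k +ᵥ y ↔ g - k ∈ AddAction.stabilizer G y := by
  rw [AddAction.mem_stabilizer_iff, sub_eq_neg_add, ← vadd_vadd, neg_vadd_eq_iff]

theorem finsum_orbit_card_stabilizer [Finite G] {Y : Type*} [AddAction G Y] (y : Y) :
    ∑ᶠ z ∈ AddAction.orbit G y, Nat.card (AddAction.stabilizer G y) = Nat.card G := by
  have hf : (AddAction.orbit G y).Finite := Set.finite_range _
  rw [finsum_mem_eq_finite_toFinset_sum _ hf, Finset.sum_const, smul_eq_mul,
    ← Set.ncard_eq_toFinset_card _ hf, ← Nat.card_coe_set_eq,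
    Nat.card_congr (AddAction.orbitEquivQuotientStabilizer G y),
    ← AddSubgroup.card_eq_card_quotient_mul_card_addSubgroup]

theorem fiber_eq_orbit (y : τ.total) : {z | τ.map z = τ.map y} = AddAction.orbit G y := by
  ext z
  constructor
  · intro hz
    obtain ⟨g, rfl⟩ := τ.transitive y z hz.symm
    exact ⟨g, rfl⟩
  · rintro ⟨g, rfl⟩
    exact τ.map_vadd g y

/-- The fibre is an orbit with constant degree. Comparing the degree sum `#G` with the
orbit-stabilizer formula and cancelling the size of the orbit leaves the order of the stabilizer. -/
theorem degree_eq_card [Finite G] (y : τ.total) :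
    τ.degree y = Nat.card (AddAction.stabilizer G y) := by
  have h1 := τ.degree_eq (τ.map y)
  rw [τ.fiber_eq_orbit y, ← finsum_orbit_card_stabilizer y] at h1
  have hf : (AddAction.orbit G y).Finite := Set.finite_range _
  have h2 : ∑ᶠ z ∈ AddAction.orbit G y, τ.degree z = ∑ᶠ z ∈ AddAction.orbit G y, τ.degree y := by
    refine finsum_mem_congr rfl ?_
    rintro _ ⟨g, rfl⟩
    exact τ.degree_vadd g y
  rw [h2, finsum_mem_eq_finite_toFinset_sum _ hf, finsum_mem_eq_finite_toFinset_sum _ hf,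
    Finset.sum_const, Finset.sum_const, smul_eq_mul, smul_eq_mul] at h1
  have h3 : 0 < hf.toFinset.card := Finset.card_pos.2
    ⟨y, hf.mem_toFinset.2 (AddAction.mem_orbit_self y)⟩
  exact Nat.eq_of_mul_eq_mul_left h3 h1

theorem isClosed_le_stabilizer (H : AddSubgroup G) :
    IsClosed {y : τ.total | H ≤ AddAction.stabilizer G y} := by
  have h1 : {y : τ.total | H ≤ AddAction.stabilizer G y} = ⋂ g ∈ H, {y | g +ᵥ y = y} := by
    ext y
    simp only [Set.mem_ofPred_eq, Set.mem_iInter]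
    rfl
  rw [h1]
  exact isClosed_biInter fun g _ => isClosed_eq (τ.continuous_vadd g) continuous_id

/-- Along a path on which the local degree is constant, the stabilizer is constant. -/
theorem stabilizer_const [Finite G] {I : Set ℝ} (hI : IsPreconnected I) {σ : ℝ → τ.total}
    (hσ : ContinuousOn σ I) (hd : ∀ s ∈ I, ∀ t ∈ I, τ.degree (σ s) = τ.degree (σ t))
    {s t : ℝ} (hs : s ∈ I) (ht : t ∈ I) :
    AddAction.stabilizer G (σ s) = AddAction.stabilizer G (σ t) := by
  have : Finite (AddSubgroup G) := inferInstance
  -- Containing a given subgroup is a closed condition on points. As the order of the stabilizer is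
  -- the constant degree, containment of the stabilizer at one time already means equality with it,
  -- so the fibres are closed.
  refine hI.eq_of_isClosed_fibers (fun t => AddAction.stabilizer G (σ t)) (fun K => ?_) hs ht
  by_cases hK : ∃ a ∈ I, AddAction.stabilizer G (σ a) = K
  · obtain ⟨a, ha, rfl⟩ := hK
    obtain ⟨U, hU, h1⟩ := continuousOn_iff_isClosed.1 hσ _
      (τ.isClosed_le_stabilizer (AddAction.stabilizer G (σ a)))
    refine ⟨U, hU, ?_⟩
    rw [Set.inter_comm, ← h1, Set.inter_comm]
    ext b
    refine and_congr_right fun hb => ?_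
    simp only [Set.mem_preimage, Set.mem_ofPred_eq, Set.mem_singleton_iff]
    refine ⟨fun h2 => (?_ : _ = _), fun h2 => h2.symm.le⟩
    have h3 := hd a ha b hb
    rw [τ.degree_eq_card, τ.degree_eq_card] at h3
    exact (AddSubgroup.eq_of_le_of_card_ge h2 h3.symm.le).symm
  · push Not at hK
    refine ⟨∅, isClosed_empty, ?_⟩
    ext b
    simp only [Set.inter_empty, Set.mem_empty_iff_false, Set.mem_inter_iff, Set.mem_preimage,
      Set.mem_singleton_iff, false_iff, not_and]
    exact fun hb => hK b hb

/-- Two lifts of a path differ by an element of the group, if stabilizers are constant. -/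
theorem exists_vadd_eq [Finite G] {I : Set ℝ} (hI : IsPreconnected I) {σ σ' : ℝ → τ.total}
    (hσ : ContinuousOn σ I) (hσ' : ContinuousOn σ' I)
    (hm : ∀ t ∈ I, τ.map (σ t) = τ.map (σ' t))
    (hs : ∀ s ∈ I, ∀ t ∈ I, AddAction.stabilizer G (σ s) = AddAction.stabilizer G (σ t)) :
    ∃ g : G, ∀ t ∈ I, σ' t = g +ᵥ σ t := by
  rcases I.eq_empty_or_nonempty with rfl | ⟨a, ha⟩
  · exact ⟨0, fun t ht => absurd ht (Set.notMem_empty t)⟩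
  have h1 : ∀ t ∈ I, ∃ g : G, g +ᵥ σ t = σ' t := fun t ht => τ.transitive _ _ (hm t ht)
  choose! f hf using h1
  refine ⟨f a, fun t ht => ?_⟩
  -- The element `f s` is an arbitrary choice; only its coset modulo the common stabilizer is
  -- meaningful. The locus of a fixed coset is where `σ'` and `g +ᵥ σ` agree, which is closed.
  have h2 : ∀ s ∈ I, ∀ g : G, (σ' s = g +ᵥ σ s ↔
      (QuotientAddGroup.mk (f s) : G ⧸ AddAction.stabilizer G (σ a)) = QuotientAddGroup.mk g) := by
    intro s hs' g
    rw [← hf s hs', vadd_eq_vadd_iff, hs s hs' a ha, QuotientAddGroup.eq, neg_add_eq_sub,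
      ← neg_mem_iff, neg_sub]
  rw [h2 t ht]
  refine hI.eq_of_isClosed_fibers
    (fun s => (QuotientAddGroup.mk (f s) : G ⧸ AddAction.stabilizer G (σ a))) (fun b => ?_) ht ha
  obtain ⟨g, rfl⟩ := QuotientAddGroup.mk_surjective b
  have h3 : ContinuousOn (fun s => (σ' s, g +ᵥ σ s)) I :=
    hσ'.prodMk ((τ.continuous_vadd g).comp_continuousOn hσ)
  obtain ⟨U, hU, h4⟩ := continuousOn_iff_isClosed.1 h3 _ (isClosed_diagonal (X := τ.total))
  refine ⟨U, hU, ?_⟩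
  rw [Set.inter_comm, ← h4, Set.inter_comm]
  ext s
  refine and_congr_right fun hs' => ?_
  simp only [Set.mem_preimage, Set.mem_diagonal_iff, Set.mem_singleton_iff]
  exact h2 s hs' g

theorem HasStratification.dilation_eq [Finite G] {τ : GCover G X} {S : GStratification G X}
    (hS : τ.HasStratification S) (y : τ.total) :
    S.dilation (τ.map y) = AddAction.stabilizer G y := by
  have h1 : ∀ H, H ≤ S.dilation (τ.map y) ↔ H ≤ AddAction.stabilizer G y := by
    intro H
    rw [← S.mem_sub_iff, hS H]
    constructor
    · rintro ⟨z, hz, h2⟩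
      rwa [← τ.stabilizer_eq hz]
    · exact fun h2 => ⟨y, rfl, h2⟩
  exact le_antisymm ((h1 _).1 le_rfl) ((h1 _).2 le_rfl)

theorem hasStratification_of_dilation [Finite G] {S : GStratification G X}
    (h : ∀ y : τ.total, S.dilation (τ.map y) = AddAction.stabilizer G y) :
    τ.HasStratification S := by
  intro H
  ext x
  rw [S.mem_sub_iff]
  obtain ⟨y, rfl⟩ := τ.surjective_map x
  rw [h y]
  constructor
  · exact fun h2 => ⟨y, rfl, h2⟩
  · rintro ⟨z, hz, h2⟩
    rwa [← τ.stabilizer_eq hz]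

variable {τ} in
/-- The loci of large stabilizers are subcurves in the base of any model of the cover. -/
theorem cellular_of_isModelOf [Finite G] {M' : τ.total.Model} {M : X.Model}
    {φ : HarmonicMorphism M'.graph M.graph} (h : IsModelOf τ.map τ.degree M' M φ)
    (H : AddSubgroup G) : M.Cellular {x | ∃ y, τ.map y = x ∧ H ≤ AddAction.stabilizer G y} := by
  intro k t ht hk s
  obtain ⟨y, hy, hH⟩ := hk
  have hmap : ∀ h' : M'.graph.H, ∀ a, M'.graph.IsInner h' a →
      H ≤ AddAction.stabilizer G (M'.ray h' a) → ∀ b, M.ray (φ.mapH h') b ∈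
        {x | ∃ y, τ.map y = x ∧ H ≤ AddAction.stabilizer G y} := by
    intro h' a ha hle b
    -- The stabilizer is constant at inner parameters, and containing `H` is a closed condition, so
    -- it extends to the ends of the interval.
    have h1 : M'.graph.Param h' ⊆ {c | H ≤ AddAction.stabilizer G (M'.ray h' c)} := by
      refine (WeightedMetricGraph.param_subset_closure h').trans ?_
      refine closure_minimal (fun c hc => ?_)
        ((τ.isClosed_le_stabilizer H).preimage (MetricModel.continuous_ray h'))
      have h2 := τ.stabilizer_const (WeightedMetricGraph.isPreconnected_isInner h')
        (MetricModel.continuous_ray h').continuousOn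
        (fun s hs t ht => by rw [h.degree_ray hs, h.degree_ray ht]) hc ha
      exact hle.trans h2.symm.le
    refine ⟨M'.ray h' (b / φ.deg h'.1), ?_, ?_⟩
    · rw [h.map_ray, mul_div_cancel₀ _ (φ.deg_pos_real _).ne']
    · rw [← MetricModel.ray_clamp]
      exact h1 (M'.graph.clamp_mem _ _)
  rcases MetricModel.exists_rep (M := M') y with ⟨w, rfl⟩ | ⟨h', a, ha, rfl⟩
  · rw [h.map_vert] at hy
    exact absurd hy.symm (MetricModel.ray_ne_vert ht _)
  · rw [h.map_ray] at hy
    rcases MetricModel.ray_eq_ray (φ.isInner_map_iff.2 ha) ht hy with ⟨rfl, -⟩ | ⟨he, rfl, -⟩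
    · exact hmap h' a ha hH s
    · rw [MetricModel.ray_flip' he]
      exact hmap h' a ha hH _

/-- Every cover has a dilation stratification. -/
theorem exists_hasStratification [Finite G] : ∃ S : GStratification G X,
    τ.HasStratification S := by
  have hmem : ∀ H (y : τ.total), τ.map y ∈
      {x | ∃ y, τ.map y = x ∧ H ≤ AddAction.stabilizer G y} ↔ H ≤ AddAction.stabilizer G y := by
    intro H y
    constructor
    · rintro ⟨z, hz, h2⟩
      rwa [← τ.stabilizer_eq hz]
    · exact fun h2 => ⟨y, rfl, h2⟩
  refine ⟨{
    sub := fun H => {x | ∃ y, τ.map y = x ∧ H ≤ AddAction.stabilizer G y}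
    exists_model := ?_
    sub_bot := ?_
    anti := ?_
    inter := ?_ }, fun H => rfl⟩
  · obtain ⟨M', M, φ, h⟩ := τ.harmonic
    exact ⟨M, fun H => (M.cellular_iff _).1 (cellular_of_isModelOf h H)⟩
  · ext x
    obtain ⟨y, rfl⟩ := τ.surjective_map x
    simp only [Set.mem_univ, iff_true]
    exact ⟨y, rfl, bot_le⟩
  · rintro H K hHK x ⟨y, hy, h1⟩
    exact ⟨y, hy, hHK.trans h1⟩
  · intro H K
    ext x
    obtain ⟨y, rfl⟩ := τ.surjective_map x
    rw [Set.mem_inter_iff, hmem, hmem, hmem, sup_le_iff]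

end GCover

/-! ### Lifting paths -/

namespace GCover

variable {G : Type v} [AddCommGroup G] {X : TropicalCurve.{u}} (τ : GCover G X)

/-- The path `γ` lifts over `[a, b]`. -/
def Lifts (γ : ℝ → X) (a b : ℝ) : Prop :=
  ∃ σ : ℝ → τ.total, ContinuousOn σ (Set.Icc a b) ∧ ∀ t ∈ Set.Icc a b, τ.map (σ t) = γ t

variable {τ}

theorem Lifts.mono {γ : ℝ → X} {a b c d : ℝ} (h : τ.Lifts γ a b) (hc : a ≤ c) (hd : d ≤ b) :
    τ.Lifts γ c d := by
  obtain ⟨σ, h1, h2⟩ := h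
  exact ⟨σ, h1.mono (Set.Icc_subset_Icc hc hd), fun t ht => h2 t (Set.Icc_subset_Icc hc hd ht)⟩

/-- The fibre over the common time is an orbit, so the second lift can be translated to continue the
first one. -/
theorem Lifts.trans {γ : ℝ → X} {a b c : ℝ} (hab : a ≤ b) (hbc : b ≤ c) (h1 : τ.Lifts γ a b)
    (h2 : τ.Lifts γ b c) : τ.Lifts γ a c := by
  obtain ⟨σ, s1, s2⟩ := h1
  obtain ⟨ρ, r1, r2⟩ := h2
  obtain ⟨g, hg⟩ := τ.transitive (ρ b) (σ b) (by
    rw [r2 b ⟨le_rfl, hbc⟩, s2 b ⟨hab, le_rfl⟩])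
  refine ⟨fun t => if t ≤ b then σ t else g +ᵥ ρ t, ?_, fun t ht => ?_⟩
  · rw [← Set.Icc_union_Icc_eq_Icc hab hbc]
    refine ContinuousOn.union_of_isClosed ?_ ?_ isClosed_Icc isClosed_Icc
    · exact s1.congr fun t ht => if_pos ht.2
    · refine ((τ.continuous_vadd g).comp_continuousOn r1).congr fun t ht => ?_
      by_cases h1 : t ≤ b
      · have : t = b := le_antisymm h1 ht.1
        subst this
        simp [hg]
      · exact if_neg h1
  · dsimp only
    split_ifs with h1
    · exact s2 t ⟨ht.1, h1⟩
    · rw [τ.map_vadd, r2 t ⟨(not_le.1 h1).le, ht.2⟩]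

theorem lifts_right [Finite G] {γ : ℝ → X} {a δ : ℝ} (hδ : 0 < δ) (hγ : Continuous γ)
    (h : ∀ t, 0 ≤ t → t < δ → edist (γ a) (γ (a + t)) = ENNReal.ofReal t) :
    ∃ b > a, τ.Lifts γ a b := by
  obtain ⟨y, hy⟩ := τ.surjective_map (γ a)
  obtain ⟨L⟩ := τ.nonempty_localForm y
  obtain ⟨σ, hσ, δ', d0, h1⟩ := L.exists_lift (γ := fun t => γ (a + t)) hδ
    (hγ.comp (by fun_prop)).continuousOn (fun t t0 t1 => by rw [hy]; exact h t t0 t1)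
  refine ⟨a + δ' / 2, by linarith, fun t => σ (t - a), (hσ.comp (by fun_prop)).continuousOn,
    fun t ht => ?_⟩
  rw [h1 (t - a) (by linarith [ht.1]) (by linarith [ht.2]), add_sub_cancel]

theorem lifts_left [Finite G] {γ : ℝ → X} {a δ : ℝ} (hδ : 0 < δ) (hγ : Continuous γ)
    (h : ∀ t, 0 ≤ t → t < δ → edist (γ a) (γ (a - t)) = ENNReal.ofReal t) :
    ∃ b < a, τ.Lifts γ b a := by
  obtain ⟨b, hb, σ, h1, h2⟩ := lifts_right (τ := τ) (γ := fun t => γ (-t)) (a := -a) hδ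
    (hγ.comp (by fun_prop)) (fun t t0 t1 => by
      have := h t t0 t1
      simpa [sub_eq_add_neg, add_comm] using this)
  refine ⟨-b, by linarith, fun t => σ (-t), h1.comp (by fun_prop) (fun t ht => ?_),
    fun t ht => ?_⟩
  · exact ⟨by linarith [ht.2], by linarith [ht.1]⟩
  · rw [h2 (-t) ⟨by linarith [ht.2], by linarith [ht.1]⟩]
    simp only [neg_neg]

/-- Compactness subdivides `[0, L]` into finitely many intervals over which the path lifts, and
these lifts are concatenated. -/
theorem lifts_of_locally {γ : ℝ → X} {L : ℝ} (hL : 0 ≤ L)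
    (h : ∀ t ∈ Set.Icc 0 L, ∃ δ > 0, ∀ a b, t - δ < a → a ≤ b → b < t + δ → 0 ≤ a → b ≤ L →
      τ.Lifts γ a b) : τ.Lifts γ 0 L := by
  choose! δ hδ h1 using h
  obtain ⟨t, t0, tm, ⟨n, tn⟩, ht⟩ := exists_monotone_Icc_subset_open_cover_Icc hL
    (c := fun s : Set.Icc (0 : ℝ) L =>
      ((↑) : Set.Icc (0 : ℝ) L → ℝ) ⁻¹' Set.Ioo (s.1 - δ s.1) (s.1 + δ s.1))
    (fun s => isOpen_Ioo.preimage continuous_subtype_val)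
    (fun s _ => Set.mem_iUnion.2 ⟨s, by
      constructor <;> simp [hδ s.1 s.2]⟩)
  have key : ∀ n, τ.Lifts γ 0 (t n) := by
    intro n
    induction n with
    | zero =>
      rw [t0]
      exact h1 0 ⟨le_rfl, hL⟩ 0 0 (by linarith [hδ 0 ⟨le_rfl, hL⟩]) le_rfl
        (by linarith [hδ 0 ⟨le_rfl, hL⟩]) le_rfl hL
    | succ n ih =>
      obtain ⟨s, hs⟩ := ht n
      have hle : t n ≤ t (n + 1) := tm (Nat.le_succ n)
      refine ih.trans (t n).2.1 hle ?_
      have h2 : t n ∈ Set.Icc (t n) (t (n + 1)) := ⟨le_rfl, hle⟩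
      have h3 : t (n + 1) ∈ Set.Icc (t n) (t (n + 1)) := ⟨hle, le_rfl⟩
      exact h1 s.1 s.2 _ _ (hs h2).1 hle (hs h3).2 (t n).2.1 (t (n + 1)).2.2
  have := key n
  rwa [tn n le_rfl] at this

/-- Rays of a model lift over compact intervals. -/
theorem lifts_ray [Finite G] {M : X.Model} (h : M.graph.H) {L : ℝ} (hL : L ∈ M.graph.Param h) :
    τ.Lifts (M.ray h) 0 L := by
  have hmem : ∀ t ∈ Set.Icc 0 L, t ∈ M.graph.Param h := fun t ht =>
    ⟨ht.1, fun he => ht.2.trans (hL.2 he)⟩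
  refine lifts_of_locally hL.1 fun t ht => ?_
  obtain ⟨δ, d0, h1⟩ := MetricModel.exists_edist_ray_eq (hmem t ht)
  have hleft : ∃ δ' > 0, ∀ a, t - δ' < a → a ≤ t → 0 ≤ a → τ.Lifts (M.ray h) a t := by
    -- At the ends of the range the ray leaves in one direction only; on the other side the interval
    -- is a single point and a constant lift suffices.
    by_cases ht0 : t = 0
    · obtain ⟨y, hy⟩ := τ.surjective_map (M.ray h t)
      refine ⟨1, one_pos, fun a _ a1 a2 => ⟨fun _ => y, continuousOn_const, fun s hs => ?_⟩⟩
      have : s = t := le_antisymm hs.2 (by rw [ht0]; exact a2.trans hs.1)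
      rw [this, hy]
    · have htp : 0 < t := lt_of_le_of_ne ht.1 (Ne.symm ht0)
      obtain ⟨b, hb, h2⟩ := lifts_left (τ := τ) (γ := M.ray h) (a := t) (lt_min d0 htp)
        (MetricModel.continuous_ray h) (fun s s0 s1 => by
          have h3 := h1 (t - s) (hmem _ ⟨by linarith [s1.trans_le (min_le_right _ _)],
            by linarith [ht.2]⟩) (by
              rw [sub_sub_cancel_left, abs_neg, abs_of_nonneg s0]
              exact s1.trans_le (min_le_left _ _))
          rwa [sub_sub_cancel_left, abs_neg, abs_of_nonneg s0] at h3)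
      exact ⟨t - b, by linarith, fun a a0 a1 _ => h2.mono (by linarith) le_rfl⟩
  have hright : ∃ δ' > 0, ∀ a, a < t + δ' → t ≤ a → a ≤ L → τ.Lifts (M.ray h) t a := by
    by_cases ht0 : t = L
    · obtain ⟨y, hy⟩ := τ.surjective_map (M.ray h t)
      refine ⟨1, one_pos, fun a _ a1 a2 => ⟨fun _ => y, continuousOn_const, fun s hs => ?_⟩⟩
      have : s = t := le_antisymm (by rw [ht0]; exact hs.2.trans a2) hs.1
      rw [this, hy]
    · have htp : 0 < L - t := sub_pos.2 (lt_of_le_of_ne ht.2 ht0)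
      obtain ⟨b, hb, h2⟩ := lifts_right (τ := τ) (γ := M.ray h) (a := t) (lt_min d0 htp)
        (MetricModel.continuous_ray h) (fun s s0 s1 => by
          have h3 := h1 (t + s) (hmem _ ⟨by linarith [ht.1],
            by linarith [s1.trans_le (min_le_right _ _)]⟩) (by
              rw [add_sub_cancel_left, abs_of_nonneg s0]
              exact s1.trans_le (min_le_left _ _))
          rwa [add_sub_cancel_left, abs_of_nonneg s0] at h3)
      exact ⟨b - t, by linarith, fun a a0 a1 _ => h2.mono le_rfl (by linarith)⟩
  obtain ⟨δ₁, p1, l1⟩ := hleft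
  obtain ⟨δ₂, p2, l2⟩ := hright
  refine ⟨min δ₁ δ₂, lt_min p1 p2, fun a b ha hab hb a0 bL => ?_⟩
  have ha' : t - δ₁ < a := by linarith [min_le_left δ₁ δ₂]
  have hb' : b < t + δ₂ := by linarith [min_le_right δ₁ δ₂]
  rcases le_total b t with hbt | hbt
  · exact (l1 a ha' (hab.trans hbt) a0).mono le_rfl hbt
  · rcases le_total a t with hat | hat
    · exact (l1 a ha' hat a0).trans hat hbt (l2 b hb' hbt bL)
    · exact (l2 b hb' hbt bL).mono hat le_rfl

variable {S : GStratification G X} (hS : τ.HasStratification S) (F : S.FramedModel)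

include hS in
theorem HasStratification.stabilizer_eq_datum [Finite G] {h : F.model.graph.H} {t : ℝ}
    (ht : F.model.graph.IsInner h t) {y : τ.total} (hy : τ.map y = F.model.ray h t) :
    AddAction.stabilizer G y = F.datum.D h.1 := by
  rw [F.datum_halfEdge ht, ← hy, hS.dilation_eq]

include hS in
/-- Two lifts of a ray of a framed model differ by an element of the group. -/
theorem HasStratification.exists_vadd_eq [Finite G] {h : F.model.graph.H} {I : Set ℝ}
    (hI : I.OrdConnected)
    (hI1 : I ⊆ closure (I ∩ {t | F.model.graph.IsInner h t}))
    {σ σ' : ℝ → τ.total} (hσ : ContinuousOn σ I) (hσ' : ContinuousOn σ' I)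
    (hm : ∀ t ∈ I, τ.map (σ t) = F.model.ray h t) (hm' : ∀ t ∈ I, τ.map (σ' t) = F.model.ray h t) :
    ∃ g : G, ∀ t ∈ I, σ' t = g +ᵥ σ t := by
  have hin : (I ∩ {t | F.model.graph.IsInner h t}).OrdConnected :=
    hI.inter (WeightedMetricGraph.isPreconnected_isInner h).ordConnected
  obtain ⟨g, hg⟩ := τ.exists_vadd_eq hin.isPreconnected (hσ.mono Set.inter_subset_left)
    (hσ'.mono Set.inter_subset_left) (fun t ht => by rw [hm t ht.1, hm' t ht.1])
    (fun s hs t ht => by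
      rw [hS.stabilizer_eq_datum F hs.2 (hm s hs.1), hS.stabilizer_eq_datum F ht.2 (hm t ht.1)])
  refine ⟨g, fun t ht => ?_⟩
  have h1 : Set.EqOn σ' (fun t => g +ᵥ σ t) I :=
    Set.EqOn.of_subset_closure (fun t ht => hg t ht) hσ' ((τ.continuous_vadd g).comp_continuousOn hσ)
      Set.inter_subset_left hI1
  exact h1 ht

include hS in
theorem HasStratification.exists_vadd_eq_param [Finite G] {h : F.model.graph.H}
    {σ σ' : ℝ → τ.total} (hσ : ContinuousOn σ (F.model.graph.Param h))
    (hσ' : ContinuousOn σ' (F.model.graph.Param h))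
    (hm : ∀ t ∈ F.model.graph.Param h, τ.map (σ t) = F.model.ray h t)
    (hm' : ∀ t ∈ F.model.graph.Param h, τ.map (σ' t) = F.model.ray h t) :
    ∃ g : G, ∀ t ∈ F.model.graph.Param h, σ' t = g +ᵥ σ t := by
  refine hS.exists_vadd_eq F ⟨?_⟩ ?_ hσ hσ' hm hm'
  · exact fun a ha b hb t ht => ⟨ha.1.trans ht.1, fun he => ht.2.trans (hb.2 he)⟩
  · have h1 : F.model.graph.Param h ∩ {t | F.model.graph.IsInner h t} =
        {t | F.model.graph.IsInner h t} :=
      Set.inter_eq_right.2 fun t ht => WeightedMetricGraph.IsInner.mem ht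
    rw [h1]
    exact WeightedMetricGraph.param_subset_closure h

include hS in
/-- Rays of a framed model lift. -/
theorem HasStratification.exists_lift [Finite G] (h : F.model.graph.H) :
    ∃ σ : ℝ → τ.total, ContinuousOn σ (F.model.graph.Param h) ∧
      ∀ t ∈ F.model.graph.Param h, τ.map (σ t) = F.model.ray h t := by
  by_cases he : F.model.graph.IsEdge h.1
  · have h1 : F.model.graph.Param h = Set.Icc 0 (F.model.graph.length h.1) := by
      ext t; exact F.model.graph.mem_param_iff_of_edge he
    rw [h1]
    exact lifts_ray h (F.model.graph.length_mem_param he)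
  · have hP : F.model.graph.Param h = Set.Ici 0 := by
      ext t; exact F.model.graph.mem_param_iff_of_not_edge he
    have hin : {t | F.model.graph.IsInner h t} = Set.Ioi 0 := by
      ext t; simp [WeightedMetricGraph.IsInner, he]
    obtain ⟨y₁, hy₁⟩ := τ.surjective_map (F.model.ray h 1)
    -- A leg is exhausted by compact intervals, and all lifts are normalized to pass through the
    -- same point `y₁` at time `1`. The bound `n + 1` puts `1` into every interval, including the
    -- first.
    have h1 : ∀ n : ℕ, ∃ σ : ℝ → τ.total, ContinuousOn σ (Set.Icc 0 (n + 1 : ℝ)) ∧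
        (∀ t ∈ Set.Icc 0 (n + 1 : ℝ), τ.map (σ t) = F.model.ray h t) ∧ σ 1 = y₁ := by
      intro n
      obtain ⟨σ, s1, s2⟩ := lifts_ray (τ := τ) h (L := (n + 1 : ℝ)) (by
        rw [hP]; exact Set.mem_Ici.2 (by positivity))
      have hm : (1 : ℝ) ∈ Set.Icc 0 (n + 1 : ℝ) := ⟨zero_le_one, by simp⟩
      obtain ⟨g, hg⟩ := τ.transitive (σ 1) y₁ (by rw [s2 1 hm, hy₁])
      exact ⟨fun t => g +ᵥ σ t, (τ.continuous_vadd g).comp_continuousOn s1,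
        fun t ht => by rw [τ.map_vadd, s2 t ht], hg⟩
    choose σ s1 s2 s3 using h1
    have hle : ∀ m n : ℕ, m ≤ n → ∀ t ∈ Set.Icc 0 (m + 1 : ℝ), σ n t = σ m t := by
      intro m n hmn t ht
      have hsub : Set.Icc 0 (m + 1 : ℝ) ⊆ Set.Icc 0 (n + 1 : ℝ) :=
        Set.Icc_subset_Icc_right (by simpa using hmn)
      have hpos : (0 : ℝ) ≠ m + 1 := by positivity
      obtain ⟨g, hg⟩ := hS.exists_vadd_eq F (h := h) (I := Set.Icc 0 (m + 1 : ℝ))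
        Set.ordConnected_Icc (by
          rw [hin]
          have h2 : Set.Ioo 0 (m + 1 : ℝ) ⊆ Set.Icc 0 (m + 1 : ℝ) ∩ Set.Ioi 0 :=
            fun s hs => ⟨⟨hs.1.le, hs.2.le⟩, hs.1⟩
          have h3 := closure_mono h2
          rwa [closure_Ioo hpos] at h3) (s1 m) ((s1 n).mono hsub) (s2 m)
          (fun t ht => s2 n t (hsub ht))
      have hm : (1 : ℝ) ∈ Set.Icc 0 (m + 1 : ℝ) := ⟨zero_le_one, by simp⟩
      have h4 := hg 1 hm
      rw [s3, s3] at h4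
      have h5 : g ∈ AddAction.stabilizer G y₁ := h4.symm
      have hin1 : F.model.graph.IsInner h 1 := ⟨one_pos, fun h1 => absurd h1 he⟩
      rw [hS.stabilizer_eq_datum F hin1 hy₁] at h5
      -- The element comparing two normalized lifts fixes `y₁`, so it lies in `D(h)`. It then fixes
      -- every point of the lift, including the one at the root, where the stabilizer may be larger.
      have h6 : ∀ s ∈ Set.Icc 0 (m + 1 : ℝ), F.datum.D h.1 ≤ AddAction.stabilizer G (σ m s) := by
        intro s hs
        rcases hs.1.eq_or_lt with rfl | hs0
        · rw [← hS.dilation_eq, s2 m 0 hs, ← F.datum_root]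
          exact F.datum.le_root _ h.2
        · exact (hS.stabilizer_eq_datum F ⟨hs0, fun h1 => absurd h1 he⟩ (s2 m s hs)).symm.le
      rw [hg t ht]
      exact h6 t ht h5
    -- The glued lift uses at time `t` the interval of index `⌊t⌋₊`, the first that contains `t` for
    -- sure; near `t` it coincides with one fixed `σ n`.
    have heq : ∀ (n : ℕ) (t : ℝ), t ∈ Set.Icc 0 (n + 1 : ℝ) → σ ⌊t⌋₊ t = σ n t := by
      intro n t ht
      rcases le_total ⌊t⌋₊ n with h2 | h2
      · exact (hle _ _ h2 t ⟨ht.1, (Nat.lt_floor_add_one t).le⟩).symm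
      · exact hle _ _ h2 t ht
    rw [hP]
    refine ⟨fun t => σ ⌊t⌋₊ t, fun t ht => ?_, fun t ht =>
      s2 _ t ⟨ht, (Nat.lt_floor_add_one t).le⟩⟩
    obtain ⟨n, hn⟩ := exists_nat_gt t
    have h2 : ContinuousWithinAt (σ n) (Set.Ici 0) t := by
      refine ((s1 n) t ⟨ht, by linarith⟩).mono_of_mem_nhdsWithin ?_
      rw [← Set.Ici_inter_Iic]
      exact inter_mem self_mem_nhdsWithin (mem_nhdsWithin_of_mem_nhds
        (Iic_mem_nhds (by linarith)))
    refine h2.congr_of_eventuallyEq ?_ (heq n t ⟨ht, by linarith⟩)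
    filter_upwards [self_mem_nhdsWithin, mem_nhdsWithin_of_mem_nhds
      (Iic_mem_nhds (show t < n + 1 by linarith))] with s hs hs'
    exact heq n s ⟨hs, hs'⟩

end GCover

/-- A path which is locally `1`-Lipschitz around each time is `1`-Lipschitz. -/
theorem edist_le_of_locally {Y : Type*} [PseudoEMetricSpace Y] {γ : ℝ → Y} (hγ : Continuous γ)
    (h : ∀ t, ∃ δ > 0, ∀ s, |s - t| < δ → edist (γ t) (γ s) ≤ ENNReal.ofReal |s - t|) (s t : ℝ) :
    edist (γ s) (γ t) ≤ ENNReal.ofReal |s - t| := by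
  wlog hst : s ≤ t generalizing s t
  · rw [edist_comm, abs_sub_comm]
    exact this t s (not_le.1 hst).le
  have key : Set.Icc s t ⊆ {a | edist (γ s) (γ a) ≤ ENNReal.ofReal (a - s)} := by
    refine IsClosed.Icc_subset_of_forall_exists_gt ?_ ?_ ?_
    · refine IsClosed.inter (isClosed_le ?_ ?_) isClosed_Icc
      · exact continuous_const.edist hγ
      · exact ENNReal.continuous_ofReal.comp (by fun_prop)
    · simp
    · rintro a ⟨ha, ha'⟩ b hb
      obtain ⟨δ, d0, h1⟩ := h a
      have hab : a < b := hb
      refine ⟨min b (a + δ / 2), ?_, lt_min hab (by linarith), min_le_left _ _⟩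
      have h2 : a ≤ min b (a + δ / 2) := le_min hab.le (by linarith)
      have h3 := h1 (min b (a + δ / 2)) (by
        rw [abs_of_nonneg (by linarith)]
        linarith [min_le_right b (a + δ / 2)])
      rw [abs_of_nonneg (by linarith)] at h3
      have ha2 : edist (γ s) (γ a) ≤ ENNReal.ofReal (a - s) := ha
      calc edist (γ s) (γ (min b (a + δ / 2)))
          ≤ edist (γ s) (γ a) + edist (γ a) (γ (min b (a + δ / 2))) := edist_triangle _ _ _
        _ ≤ ENNReal.ofReal (a - s) + ENNReal.ofReal (min b (a + δ / 2) - a) :=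
            add_le_add ha2 h3
        _ = ENNReal.ofReal (min b (a + δ / 2) - s) := by
            rw [← ENNReal.ofReal_add (sub_nonneg.2 ha'.1) (by linarith)]
            congr 1; ring
  have h1 := key ⟨hst, le_rfl⟩
  rwa [abs_sub_comm, abs_of_nonneg (sub_nonneg.2 hst)]

/-- Rays are proper. -/
theorem MetricModel.exists_ray_bound {X : Type u} [EMetricSpace X] {g : X → ℕ}
    {M : MetricModel X g} (h : M.graph.H) (x : X) :
    ∃ U ∈ 𝓝 x, ∃ N : ℝ, ∀ t ∈ M.graph.Param h, M.ray h t ∈ U → t ≤ N := by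
  by_cases he : M.graph.IsEdge h.1
  · exact ⟨Set.univ, univ_mem, M.graph.length h.1, fun t ht _ => ht.2 he⟩
  have hin : ∀ t, 0 < t → M.graph.IsInner h t := fun t t0 => ⟨t0, fun h1 => absurd h1 he⟩
  rcases exists_rep (M := M) x with ⟨w, rfl⟩ | ⟨k, a, ha, rfl⟩
  · obtain ⟨ε, e0, e1⟩ := M.graph.exists_length_bound
    refine ⟨Metric.eball (M.vert w) (ENNReal.ofReal ε), Metric.eball_mem_nhds _ (by simpa using e0),
      ε, fun t ht h1 => ?_⟩
    rcases ht.1.eq_or_lt with rfl | t0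
    · exact e0.le
    rw [Metric.mem_eball, edist_comm] at h1
    rcases (near_vert e0 e1 w).2 _ h1 with h2 | ⟨l, hl, s, s0, s1, h2⟩
    · exact absurd h2 (ray_ne_vert (hin t t0) w)
    · rcases ray_eq_ray (hin t t0) ⟨s0, fun h3 => by linarith [e1 _ h3]⟩ h2 with
        ⟨-, rfl⟩ | ⟨h3, -⟩
      · exact s1.le
      · exact absurd h3 he
  · have h1 : IsOpen (M.ray k '' {t | M.graph.IsInner k t ∧ t < a + 1}) := by
      refine isOpen_ray_image ?_ fun t ht => ht.1
      refine IsOpen.inter ?_ isOpen_Iio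
      by_cases hk : M.graph.IsEdge k.1
      · simp only [hk, true_imp_iff]
        exact isOpen_Ioo
      · simp only [hk, false_imp_iff, and_true]
        exact isOpen_Ioi
    refine ⟨_, h1.mem_nhds ⟨a, ⟨ha, by linarith⟩, rfl⟩, a + 1, ?_⟩
    rintro t ht ⟨s, ⟨hs, hs'⟩, h2⟩
    rcases ht.1.eq_or_lt with rfl | t0
    · linarith [ha.1]
    rcases ray_eq_ray (hin t t0) hs h2.symm with ⟨-, rfl⟩ | ⟨h3, -⟩
    · exact hs'.le
    · exact absurd h3 he

/-! ### Framings -/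

namespace GStratification.FramedModel

variable {G : Type v} [AddCommGroup G] {X : TropicalCurve.{u}} {S : GStratification G X}
  (F : S.FramedModel)

/-- `h` is the selected half-edge of an edge, or a leg. -/
def IsArc (h : F.model.graph.H) : Prop :=
  h.1 ∈ F.orientation.edges ∨ ¬ F.model.graph.IsEdge h.1

theorem exists_arc_rep (x : X) : (∃ w, x = F.model.vert w) ∨
    ∃ h t, F.IsArc h ∧ F.model.graph.IsInner h t ∧ x = F.model.ray h t := by
  rcases MetricModel.exists_rep (M := F.model) x with h1 | ⟨h, t, ht, rfl⟩
  · exact Or.inl h1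
  · right
    by_cases he : F.model.graph.IsEdge h.1
    · by_cases ho : h.1 ∈ F.orientation.edges
      · exact ⟨h, t, Or.inl ho, ht, rfl⟩
      · refine ⟨F.model.graph.flip h, _, Or.inl ?_, ht.flip he, (MetricModel.ray_flip he t).symm⟩
        rw [F.orientation.mem_iff _ he, not_not] at ho
        exact ho
    · exact ⟨h, t, Or.inr he, ht, rfl⟩

theorem arc_rep_unique {h k : F.model.graph.H} {s t : ℝ} (hh : F.IsArc h) (hk : F.IsArc k)
    (hs : F.model.graph.IsInner h s) (ht : F.model.graph.IsInner k t)
    (h0 : F.model.ray h s = F.model.ray k t) : k = h ∧ t = s := by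
  rcases MetricModel.ray_eq_ray hs ht h0 with h1 | ⟨he, rfl, -⟩
  · exact h1
  · rcases hh with hh | hh
    · rcases hk with hk | hk
      · exact absurd hk ((F.orientation.mem_iff _ he).1 hh)
      · exact absurd (WeightedMetricGraph.isEdge_flip he) hk
    · exact absurd he hh

/-- Points over the vertices and lifts of the edges and legs, for a map `π : Z → X` and a group
acting on `Z`. -/
structure IsFraming {Z : Type*} [TopologicalSpace Z] {Γ : Type*} [AddGroup Γ] [AddAction Γ Z]
    (π : Z → X) (y : F.model.graph.V → Z) (σ : F.model.graph.H → ℝ → Z)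
    (A B : F.model.graph.H → Γ) : Prop where
  map_y : ∀ w, π (y w) = F.model.vert w
  cont : ∀ h, F.IsArc h → ContinuousOn (σ h) (F.model.graph.Param h)
  map_σ : ∀ h, F.IsArc h → ∀ t ∈ F.model.graph.Param h, π (σ h t) = F.model.ray h t
  source : ∀ h, F.IsArc h → σ h 0 = A h +ᵥ y (F.model.graph.root h.1)
  target : ∀ h : F.model.graph.H, h.1 ∈ F.orientation.edges →
    σ h (F.model.graph.length h.1) = B h +ᵥ y (F.model.graph.root (F.model.graph.ι h.1))

variable {F}

/-- `Z` is covered by the finitely many translates of the framing points and lifted rays. An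
ultrafilter converging to `z` contains one of these pieces and comes from an ultrafilter of
parameters. These parameters are bounded because rays are proper, so they converge, and the
Hausdorff property identifies the limit with `z`. Continuity along the pieces then suffices. -/
theorem IsFraming.continuous_of_comp {Z : Type*} [TopologicalSpace Z] [T2Space Z] {Γ : Type*}
    [AddGroup Γ] [Finite Γ] [AddAction Γ Z] {π : Z → X} {y : F.model.graph.V → Z}
    {σ : F.model.graph.H → ℝ → Z} {A B : F.model.graph.H → Γ} (hZ : F.IsFraming π y σ A B)
    (hπ : Continuous π) (hc : ∀ g : Γ, Continuous fun z : Z => g +ᵥ z)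
    (hm : ∀ (g : Γ) z, π (g +ᵥ z) = π z)
    (ht : ∀ z z', π z = π z' → ∃ g : Γ, g +ᵥ z = z')
    {Y : Type*} [TopologicalSpace Y] (k : Z → Y)
    (hk : ∀ h, F.IsArc h → ∀ g : Γ, ContinuousOn (fun t => k (g +ᵥ σ h t))
      (F.model.graph.Param h)) : Continuous k := by
  rw [continuous_iff_ultrafilter]
  intro z 𝒰 hz
  have hcov : ∀ᶠ z' in (𝒰 : Filter Z), ∃ i : (F.model.graph.V × Γ) ⊕ (F.model.graph.H × Γ),
      match i with
      | Sum.inl (w, g) => z' = g +ᵥ y w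
      | Sum.inr (h, g) => F.IsArc h ∧ z' ∈ (fun t => g +ᵥ σ h t) '' F.model.graph.Param h := by
    refine Eventually.of_forall fun z' => ?_
    rcases F.exists_arc_rep (π z') with ⟨w, hw⟩ | ⟨h, t, hh, hi, hx⟩
    · obtain ⟨g, hg⟩ := ht (y w) z' (by rw [hZ.map_y, hw])
      exact ⟨Sum.inl (w, g), hg.symm⟩
    · obtain ⟨g, hg⟩ := ht (σ h t) z' (by rw [hZ.map_σ h hh t hi.mem, hx])
      exact ⟨Sum.inr (h, g), hh, t, hi.mem, hg⟩
  rw [Ultrafilter.eventually_exists_iff] at hcov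
  obtain ⟨⟨w, g⟩ | ⟨h, g⟩, hi⟩ := hcov
  · have hi' : ∀ᶠ z' in (𝒰 : Filter Z), z' = g +ᵥ y w := hi
    have h1 : Tendsto id (𝒰 : Filter Z) (𝓝 (g +ᵥ y w)) :=
      tendsto_nhds_of_eventually_eq hi'
    have h2 : z = g +ᵥ y w := tendsto_nhds_unique (f := id) (show Tendsto id _ (𝓝 z) from hz) h1
    refine tendsto_nhds_of_eventually_eq ?_
    filter_upwards [hi'] with z' hz'
    rw [hz', h2]
  · have hi' : ∀ᶠ z' in (𝒰 : Filter Z), F.IsArc h ∧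
        z' ∈ (fun t => g +ᵥ σ h t) '' F.model.graph.Param h := hi
    have hh : F.IsArc h := (hi'.exists.choose_spec).1
    have him : (fun t => g +ᵥ σ h t) '' F.model.graph.Param h ∈ 𝒰 := hi'.mono fun _ => And.right
    let 𝒱 := Ultrafilter.ofComapInfPrincipal him
    have hV : F.model.graph.Param h ∈ 𝒱 := Ultrafilter.ofComapInfPrincipal_mem him
    have hVU : 𝒱.map (fun t => g +ᵥ σ h t) = 𝒰 := Ultrafilter.ofComapInfPrincipal_eq_of_map him
    have hVU' : Filter.map (fun t => g +ᵥ σ h t) (𝒱 : Filter ℝ) = 𝒰 := by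
      rw [← Ultrafilter.coe_map, hVU]
    -- On a leg the parameters could escape to infinity; properness of the ray in `X` prevents this.
    obtain ⟨U, hU, N, hN⟩ := MetricModel.exists_ray_bound (M := F.model) h (π z)
    have hb : ∀ᶠ t in (𝒱 : Filter ℝ), t ∈ F.model.graph.Param h ∩ Set.Iic N := by
      have h1 : ∀ᶠ z' in (𝒰 : Filter Z), π z' ∈ U := hz (hπ.continuousAt hU)
      rw [← hVU', eventually_map] at h1
      filter_upwards [h1, hV] with t h1 h2
      rw [hm, hZ.map_σ h hh t h2] at h1
      exact ⟨h2, hN t h2 h1⟩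
    have hK : IsCompact (F.model.graph.Param h ∩ Set.Iic N) := by
      refine Metric.isCompact_of_isClosed_isBounded
        ((F.model.graph.isClosed_param h).inter isClosed_Iic) ?_
      exact (Metric.isBounded_Icc 0 N).subset fun t ht => ⟨ht.1.1, ht.2⟩
    obtain ⟨a, ha, hVa⟩ := hK.ultrafilter_le_nhds 𝒱 (le_principal_iff.2 hb)
    have hVa' : (𝒱 : Filter ℝ) ≤ 𝓝[F.model.graph.Param h] a :=
      le_inf hVa (le_principal_iff.2 hV)
    have h1 : Tendsto id (𝒰 : Filter Z) (𝓝 (g +ᵥ σ h a)) := by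
      rw [← hVU', tendsto_map'_iff]
      exact (((hc g).comp_continuousOn (hZ.cont h hh)) a ha.1).mono_left hVa'
    have h2 : z = g +ᵥ σ h a := tendsto_nhds_unique (f := id) (show Tendsto id _ (𝓝 z) from hz) h1
    rw [← hVU', tendsto_map'_iff, h2]
    exact ((hk h hh g) a ha.1).mono_left hVa'

/-- Compatible framings induce an equivariant continuous map over `X` to a cover. -/
theorem IsFraming.exists_map [Finite G] {Z : Type*} [TopologicalSpace Z] [T2Space Z] {Γ : Type*}
    [AddGroup Γ] [Finite Γ] [AddAction Γ Z] {π : Z → X} {y : F.model.graph.V → Z}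
    {σ : F.model.graph.H → ℝ → Z} {A B : F.model.graph.H → Γ} (hZ : F.IsFraming π y σ A B)
    (hπ : Continuous π) (hc : ∀ g : Γ, Continuous fun z : Z => g +ᵥ z)
    (hm : ∀ (g : Γ) z, π (g +ᵥ z) = π z)
    (ht : ∀ z z', π z = π z' → ∃ g : Γ, g +ᵥ z = z')
    {τ : GCover G X} (hS : τ.HasStratification S) {y' : F.model.graph.V → τ.total}
    {σ' : F.model.graph.H → ℝ → τ.total} {A' B' : F.model.graph.H → G}
    (hY : F.IsFraming τ.map y' σ' A' B') (ρ : Γ →+ G)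
    (hρ : ∀ (z : Z) (g : Γ), g +ᵥ z = z → ρ g ∈ S.dilation (π z))
    (hA : ∀ h, F.IsArc h → ρ (A h) = A' h)
    (hB : ∀ h : F.model.graph.H, h.1 ∈ F.orientation.edges → ρ (B h) = B' h) :
    ∃ k : Z → τ.total, Continuous k ∧ (∀ z, τ.map (k z) = π z) ∧
      (∀ (g : Γ) z, k (g +ᵥ z) = ρ g +ᵥ k z) ∧ (∀ w, k (y w) = y' w) ∧
      ∀ h, F.IsArc h → ∀ t ∈ F.model.graph.Param h, k (σ h t) = σ' h t := by
  have key : ∀ (z : Z) (g g' : Γ), g +ᵥ z = g' +ᵥ z → ∀ q : τ.total, τ.map q = π z →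
      ρ g +ᵥ q = ρ g' +ᵥ q := by
    intro z g g' h1 q hq
    have h2 : (-g' + g) +ᵥ z = z := by rw [← vadd_vadd, h1, neg_vadd_vadd]
    have h3 := hρ z _ h2
    rw [← hq, hS.dilation_eq, AddAction.mem_stabilizer_iff, map_add, map_neg, ← vadd_vadd,
      neg_vadd_eq_iff] at h3
    exact h3
  -- The map is prescribed on translates of framing points and of inner points of the lifts. Over
  -- `X` such a representation is unique up to the group element, and `hρ` makes the image
  -- independent of that element.
  let Rel : Z → τ.total → Prop := fun z q =>
    (∃ w g, z = g +ᵥ y w ∧ q = ρ g +ᵥ y' w) ∨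
    ∃ h t g, F.IsArc h ∧ F.model.graph.IsInner h t ∧ z = g +ᵥ σ h t ∧ q = ρ g +ᵥ σ' h t
  have hex : ∀ z, ∃ q, Rel z q := by
    intro z
    rcases F.exists_arc_rep (π z) with ⟨w, hw⟩ | ⟨h, t, hh, hi, hx⟩
    · obtain ⟨g, hg⟩ := ht (y w) z (by rw [hZ.map_y, hw])
      exact ⟨_, Or.inl ⟨w, g, hg.symm, rfl⟩⟩
    · obtain ⟨g, hg⟩ := ht (σ h t) z (by rw [hZ.map_σ h hh t hi.mem, hx])
      exact ⟨_, Or.inr ⟨h, t, g, hh, hi, hg.symm, rfl⟩⟩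
  have huni : ∀ z q q', Rel z q → Rel z q' → q = q' := by
    rintro z q q' (⟨w, g, rfl, rfl⟩ | ⟨h, t, g, hh, hi, rfl, rfl⟩)
      (⟨w', g', h1, rfl⟩ | ⟨h', t', g', hh', hi', h1, rfl⟩)
    · have h2 := congrArg π h1
      rw [hm, hm, hZ.map_y, hZ.map_y] at h2
      obtain rfl := MetricModel.vert_injective h2
      exact key _ _ _ h1 _ (by rw [hY.map_y, hZ.map_y])
    · have h2 := congrArg π h1
      rw [hm, hm, hZ.map_y, hZ.map_σ _ hh' _ hi'.mem] at h2
      exact absurd h2.symm (MetricModel.ray_ne_vert hi' _)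
    · have h2 := congrArg π h1
      rw [hm, hm, hZ.map_y, hZ.map_σ _ hh _ hi.mem] at h2
      exact absurd h2 (MetricModel.ray_ne_vert hi _)
    · have h2 := congrArg π h1
      rw [hm, hm, hZ.map_σ _ hh _ hi.mem, hZ.map_σ _ hh' _ hi'.mem] at h2
      obtain ⟨rfl, rfl⟩ := F.arc_rep_unique hh hh' hi hi' h2
      exact key _ _ _ h1 _ (by rw [hY.map_σ _ hh _ hi.mem, hZ.map_σ _ hh _ hi.mem])
  choose k hk using hex
  have hkeq : ∀ z q, Rel z q → k z = q := fun z q h1 => huni z _ _ (hk z) h1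
  have hmap : ∀ z, τ.map (k z) = π z := by
    intro z
    rcases hk z with ⟨w, g, h1, h2⟩ | ⟨h, t, g, hh, hi, h1, h2⟩
    · rw [h2, τ.map_vadd, hY.map_y, h1, hm, hZ.map_y]
    · rw [h2, τ.map_vadd, hY.map_σ _ hh _ hi.mem, h1, hm, hZ.map_σ _ hh _ hi.mem]
  have hequi : ∀ (g : Γ) z, k (g +ᵥ z) = ρ g +ᵥ k z := by
    intro g z
    apply hkeq
    rcases hk z with ⟨w, g', h1, h2⟩ | ⟨h, t, g', hh, hi, h1, h2⟩
    · exact Or.inl ⟨w, g + g', by rw [h1, vadd_vadd], by rw [h2, vadd_vadd, map_add]⟩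
    · exact Or.inr ⟨h, t, g + g', hh, hi, by rw [h1, vadd_vadd], by rw [h2, vadd_vadd, map_add]⟩
  have hy : ∀ w, k (y w) = y' w := fun w => hkeq _ _ (Or.inl ⟨w, 0, by simp, by simp⟩)
  have hσ : ∀ h, F.IsArc h → ∀ t ∈ F.model.graph.Param h, k (σ h t) = σ' h t := by
    intro h hh t ht
    rcases WeightedMetricGraph.isInner_or ht with rfl | ⟨he, rfl⟩ | hi
    -- At the ends of a lift the two prescriptions agree precisely because `ρ` carries `A` to `A'`
    -- and `B` to `B'`.
    · rw [hZ.source h hh, hY.source h hh, hequi, hy, hA h hh]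
    · have ho : h.1 ∈ F.orientation.edges := by
        rcases hh with hh | hh
        · exact hh
        · exact absurd he hh
      rw [hZ.target h ho, hY.target h ho, hequi, hy, hB h ho]
    · exact hkeq _ _ (Or.inr ⟨h, t, 0, hh, hi, by simp, by simp⟩)
  refine ⟨k, hZ.continuous_of_comp hπ hc hm ht k fun h hh g => ?_, hmap, hequi, hy, hσ⟩
  refine ((τ.continuous_vadd (ρ g)).comp_continuousOn (hY.cont h hh)).congr fun t ht => ?_
  rw [hequi, hσ h hh t ht]
  rfl

end GStratification.FramedModel

/-! ### Classes of covers and their comparison through framings -/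

namespace GCover

variable {G : Type v} [AddCommGroup G] {X : TropicalCurve.{u}} {S : GStratification G X}

open GStratification.FramedModel

/-- Near a point both projections multiply the distance to it by the local degree. The degrees agree
under `ψ`, so `ψ` preserves small distances to the point, does not increase lengths of segments, and
hence does not increase the path metric. -/
theorem edist_map_le [Finite G] {τ₁ τ₂ : GCover G X} {ψ : τ₁.total → τ₂.total}
    (hψ : Continuous ψ) (hm : ∀ y, τ₂.map (ψ y) = τ₁.map y)
    (hd : ∀ y, τ₂.degree (ψ y) = τ₁.degree y) (y z : τ₁.total) :
    edist (ψ y) (ψ z) ≤ edist y z := by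
  have hloc : ∀ y, ∀ᶠ z in 𝓝 y, edist (ψ y) (ψ z) = edist y z := by
    intro y
    obtain ⟨δ₁, p1, h1⟩ := (τ₁.nonempty_localForm y).some.exists_edist_eq
    obtain ⟨δ₂, p2, h2⟩ := (τ₂.nonempty_localForm (ψ y)).some.exists_edist_eq
    filter_upwards [Metric.eball_mem_nhds y (ENNReal.ofReal_pos.2 p1),
      hψ.continuousAt (Metric.eball_mem_nhds (ψ y) (ENNReal.ofReal_pos.2 p2))] with z hz hz'
    rw [Metric.mem_eball, edist_comm] at hz
    rw [Set.mem_preimage, Metric.mem_eball, edist_comm] at hz'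
    have h3 := h1 z hz
    have h4 := h2 (ψ z) hz'
    rw [hm, hm, hd, h3] at h4
    have hpos : τ₁.degree z ≠ 0 := by
      rw [τ₁.degree_eq_card]; exact Nat.card_pos.ne'
    exact ((ENNReal.mul_right_inj (Nat.cast_ne_zero.2 hpos) (ENNReal.natCast_ne_top _)).1 h4).symm
  obtain ⟨M⟩ := τ₁.total.exists_model
  obtain ⟨p, rfl⟩ := M.bijective.2 y
  obtain ⟨q, rfl⟩ := M.bijective.2 z
  rw [M.isometry]
  refine WeightedMetricGraph.le_pathEDist (fun p => ψ (M.toFun p)) (fun h s t => ?_) p q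
  rw [WeightedMetricGraph.pt_eq_ray, WeightedMetricGraph.pt_eq_ray]
  refine edist_le_of_locally (γ := fun t => ψ (M.ray h t))
    (hψ.comp (MetricModel.continuous_ray h)) (fun t => ?_) s.1 t.1
  have h1 := (MetricModel.continuous_ray (M := M) h).continuousAt (x := t) (hloc (M.ray h t))
  obtain ⟨δ, d0, h2⟩ := Metric.mem_nhds_iff.1 h1
  refine ⟨δ, d0, fun s hs => ?_⟩
  have h3 : edist (ψ (M.ray h t)) (ψ (M.ray h s)) = edist (M.ray h t) (M.ray h s) :=
    h2 (by rwa [Metric.mem_ball, Real.dist_eq])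
  rw [h3, abs_sub_comm]
  exact MetricModel.edist_ray_le h t s

/-- A framing also involves lifts of the legs, but these carry no information: a lift of a leg can
be translated to start at the chosen point over its root. Clamping parameters replaces functions on
intervals by functions on the line. -/
theorem hasCochain_iff [Finite G] {τ : GCover G X} (hS : τ.HasStratification S)
    {F : S.FramedModel} {η : F.datum.C1 F.orientation} : τ.HasCochain F η ↔
    ∃ y σ A B, F.IsFraming τ.map y σ A B ∧
      ∀ e, η e = QuotientAddGroup.mk (A (F.orientation.half e) - B (F.orientation.half e)) := by
  classical
  constructor
  · rintro ⟨y, σ, a, b, hy, h1⟩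
    have hleg : ∀ h : F.model.graph.H, ∃ ρ : ℝ → τ.total,
        ContinuousOn ρ (F.model.graph.Param h) ∧
        (∀ t ∈ F.model.graph.Param h, τ.map (ρ t) = F.model.ray h t) ∧
        ρ 0 = y (F.model.graph.root h.1) := by
      intro h
      obtain ⟨ρ, r1, r2⟩ := hS.exists_lift F h
      obtain ⟨g, hg⟩ := τ.transitive (ρ 0) (y (F.model.graph.root h.1)) (by
        rw [r2 0 (F.model.graph.zero_mem_param h), hy, MetricModel.ray_zero]; rfl)
      exact ⟨fun t => g +ᵥ ρ t, (τ.continuous_vadd g).comp_continuousOn r1,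
        fun t ht => by rw [τ.map_vadd, r2 t ht], hg⟩
    choose ρ r1 r2 r3 using hleg
    let σ' : F.model.graph.H → ℝ → τ.total := fun h t =>
      if ho : h.1 ∈ F.orientation.edges then
        σ ⟨h.1, ho⟩ ⟨F.model.graph.clamp h t, F.model.graph.clamp_mem h t⟩ else ρ h t
    have hσ' : ∀ (h : F.model.graph.H) (ho : h.1 ∈ F.orientation.edges) (t : ℝ)
        (ht : t ∈ F.model.graph.Param h), σ' h t = σ ⟨h.1, ho⟩ ⟨t, ht⟩ := by
      intro h ho t ht
      simp only [σ', ho, dif_pos]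
      congr
      exact F.model.graph.clamp_of_mem ht
    refine ⟨y, σ', fun h => if ho : h.1 ∈ F.orientation.edges then a ⟨h.1, ho⟩ else 0,
      fun h => if ho : h.1 ∈ F.orientation.edges then b ⟨h.1, ho⟩ else 0,
      ⟨hy, fun h hh => ?_, fun h hh t ht => ?_, fun h hh => ?_, fun h ho => ?_⟩, fun e => ?_⟩
    · by_cases ho : h.1 ∈ F.orientation.edges
      · rw [continuousOn_iff_continuous_domRestrict]
        refine ((h1 ⟨h.1, ho⟩).1).congr fun t => (hσ' h ho t.1 t.2).symm
      · refine (r1 h).congr fun t ht => ?_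
        simp only [σ', ho, dif_neg, not_false_eq_true]
    · by_cases ho : h.1 ∈ F.orientation.edges
      · rw [hσ' h ho t ht, (h1 ⟨h.1, ho⟩).2.1]
        exact MetricModel.toFun_pt (h := h) ht
      · simp only [σ', ho, dif_neg, not_false_eq_true]
        exact r2 h t ht
    · by_cases ho : h.1 ∈ F.orientation.edges
      · rw [hσ' h ho 0 (F.model.graph.zero_mem_param h), dif_pos ho]
        exact (h1 ⟨h.1, ho⟩).2.2.1
      · simp only [σ', ho, dif_neg, not_false_eq_true, zero_vadd]
        exact r3 h
    · rw [hσ' h ho _ (F.model.graph.length_mem_param (F.orientation.isEdge _ ho)), dif_pos ho]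
      exact (h1 ⟨h.1, ho⟩).2.2.2.1
    · rw [(h1 e).2.2.2.2]
      have : (F.orientation.half e).1 ∈ F.orientation.edges := e.2
      dsimp only
      rw [dif_pos this, dif_pos this]
      rfl
  · rintro ⟨y, σ, A, B, hF, h1⟩
    refine ⟨y, fun e t => σ (F.orientation.half e) t.1, fun e => A (F.orientation.half e),
      fun e => B (F.orientation.half e), hF.map_y, fun e => ?_⟩
    have hh : F.IsArc (F.orientation.half e) := Or.inl e.2
    refine ⟨?_, fun t => ?_, hF.source _ hh, hF.target _ e.2, h1 e⟩
    · exact continuousOn_iff_continuous_domRestrict.1 (hF.cont _ hh)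
    · rw [hF.map_σ _ hh t.1 t.2, ← MetricModel.toFun_pt t.2]

variable {τ : GCover G X} (hS : τ.HasStratification S) (F : S.FramedModel)

include hS in
theorem HasStratification.exists_hasClass [Finite G] : ∃ c, τ.HasClass F c := by
  have hy : ∀ w, ∃ y, τ.map y = F.model.vert w := fun w => τ.surjective_map _
  choose y hy using hy
  choose σ s1 s2 using hS.exists_lift F
  have hA : ∀ h : F.model.graph.H, ∃ g : G, g +ᵥ y (F.model.graph.root h.1) = σ h 0 := fun h =>
    τ.transitive _ _ (by
      rw [hy, s2 h 0 (F.model.graph.zero_mem_param h), MetricModel.ray_zero])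
  choose A hA using hA
  have hB : ∀ h : F.model.graph.H, h.1 ∈ F.orientation.edges →
      ∃ g : G, g +ᵥ y (F.model.graph.root (F.model.graph.ι h.1)) =
        σ h (F.model.graph.length h.1) := fun h ho => by
    have he := F.orientation.isEdge _ ho
    exact τ.transitive _ _ (by
      rw [hy, s2 h _ (F.model.graph.length_mem_param he), MetricModel.ray_length he])
  choose! B hB using hB
  exact ⟨_, _, (hasCochain_iff hS).2 ⟨y, σ, A, B, ⟨hy, fun h _ => s1 h, fun h _ => s2 h,
    fun h _ => (hA h).symm, fun h ho => (hB h ho).symm⟩, fun e => rfl⟩, rfl⟩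

include hS in
theorem HasStratification.stabilizer_y [Finite G] {F : S.FramedModel} {w : F.model.graph.V}
    {y : τ.total} (hy : τ.map y = F.model.vert w) :
    AddAction.stabilizer G y = F.datum.D w.1 := by
  rw [F.datum_vert, ← hy, hS.dilation_eq]

-- Let `g` move the first points over the vertices to the second ones, and let `k` move the first
-- lift of an edge to the second. Comparing the ends gives one relation modulo `D(s(e))` and one
-- modulo `D(t(e))`; in their difference `k` cancels, and the coboundary of `g` remains modulo
-- `C(e)`.
include hS in
theorem HasStratification.hasClass_unique [Finite G] {F : S.FramedModel} {c c' : F.H1}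
    (h : τ.HasClass F c) (h' : τ.HasClass F c') : c = c' := by
  obtain ⟨η, h1, rfl⟩ := h
  obtain ⟨η', h1', rfl⟩ := h'
  obtain ⟨y, σ, A, B, hF, h2⟩ := (hasCochain_iff hS).1 h1
  obtain ⟨y', σ', A', B', hF', h2'⟩ := (hasCochain_iff hS).1 h1'
  have hg : ∀ w, ∃ g : G, g +ᵥ y w = y' w := fun w =>
    τ.transitive _ _ (by rw [hF.map_y, hF'.map_y])
  choose g hg using hg
  rw [QuotientAddGroup.eq]
  refine ⟨fun w => QuotientAddGroup.mk (g w), ?_⟩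
  funext e
  have hh : F.IsArc (F.orientation.half e) := Or.inl e.2
  have he := F.orientation.isEdge _ e.2
  obtain ⟨k, hk⟩ := hS.exists_vadd_eq_param F (hF.cont _ hh) (hF'.cont _ hh) (hF.map_σ _ hh)
    (hF'.map_σ _ hh)
  have h3 := hk 0 (F.model.graph.zero_mem_param _)
  have h4 := hk (F.model.graph.length e.1)
    (F.model.graph.length_mem_param (h := F.orientation.half e) he)
  have h5 := hF.target (F.orientation.half e) e.2
  have h5' := hF'.target (F.orientation.half e) e.2
  rw [hF.source _ hh, hF'.source _ hh, ← hg, vadd_vadd, vadd_vadd, vadd_eq_vadd_iff,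
    hS.stabilizer_y (hF.map_y _)] at h3
  change σ (F.orientation.half e) (F.model.graph.length e.1) = _ at h5
  change σ' (F.orientation.half e) (F.model.graph.length e.1) = _ at h5'
  rw [h5, h5', ← hg, vadd_vadd, vadd_vadd, vadd_eq_vadd_iff, hS.stabilizer_y (hF.map_y _)] at h4
  change (QuotientAddGroup.mk (g (F.orientation.target e)) : G ⧸ F.datum.C F.orientation e) -
    QuotientAddGroup.mk (g (F.orientation.source e)) = - η e + η' e
  rw [h2, h2', ← QuotientAddGroup.mk_sub, ← QuotientAddGroup.mk_neg, ← QuotientAddGroup.mk_add,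
    QuotientAddGroup.eq]
  have h6 := add_mem ((le_sup_left : _ ≤ F.datum.C F.orientation e) h3)
    (neg_mem ((le_sup_right : _ ≤ F.datum.C F.orientation e) h4))
  have h7 : ∀ a a' b b' p q : G, -(q - p) + (-(a - b) + (a' - b')) =
      a' + p - (k + a) + -(b' + q - (k + b)) := by intros; abel
  rw [h7]
  exact h6

include hS in
/-- A cover has framings representing all cocycles of its class. -/
theorem HasStratification.exists_framing [Finite G] {F : S.FramedModel}
    {η : F.datum.C1 F.orientation} (h : τ.HasClass F (QuotientAddGroup.mk η))
    (A B : F.model.graph.H → G)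
    (hη : ∀ e, η e = QuotientAddGroup.mk (A (F.orientation.half e) - B (F.orientation.half e))) :
    ∃ y σ, F.IsFraming τ.map y σ A B := by
  classical
  obtain ⟨η', h1, h0⟩ := h
  obtain ⟨y, σ, A', B', hF, h2⟩ := (hasCochain_iff hS).1 h1
  rw [QuotientAddGroup.eq] at h0
  obtain ⟨ξ, hξ⟩ := h0
  have hg : ∀ w, ∃ g : G, (QuotientAddGroup.mk g : G ⧸ F.datum.D w.1) = ξ w := fun w =>
    QuotientAddGroup.mk_surjective _
  choose g hg using hg
  -- the lift of `h` has to be translated by `k h`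
  have hk : ∀ h : F.model.graph.H, F.IsArc h → ∃ k : G,
      A' h + k - A h - g (F.model.graph.root h.1) ∈ F.datum.D (F.model.graph.root h.1).1 ∧
      (h.1 ∈ F.orientation.edges → B' h + k - B h - g (F.model.graph.root (F.model.graph.ι h.1)) ∈
        F.datum.D (F.model.graph.root (F.model.graph.ι h.1)).1) := by
    intro h hh
    by_cases ho : h.1 ∈ F.orientation.edges
    · have h3 := congrFun hξ ⟨h.1, ho⟩
      change F.datum.targetMap F.orientation ⟨h.1, ho⟩ (ξ _) -
        F.datum.sourceMap F.orientation ⟨h.1, ho⟩ (ξ _) = - η' _ + η _ at h3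
      rw [← hg, ← hg, h2, hη] at h3
      change (QuotientAddGroup.mk (g (F.orientation.target ⟨h.1, ho⟩)) :
        G ⧸ F.datum.C F.orientation ⟨h.1, ho⟩) -
        QuotientAddGroup.mk (g (F.orientation.source ⟨h.1, ho⟩)) =
        - QuotientAddGroup.mk (A' h - B' h) + QuotientAddGroup.mk (A h - B h) at h3
      rw [← QuotientAddGroup.mk_sub, ← QuotientAddGroup.mk_neg, ← QuotientAddGroup.mk_add,
        QuotientAddGroup.eq] at h3
      -- The discrepancy in `C(e)` splits into `p` in `D(s(e))` and `q` in `D(t(e))`. The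
      -- translation is chosen so that the error is `-p` at the source and `q` at the target, and
      -- both are absorbed by stabilizers.
      obtain ⟨p, hp, q, hq, hpq⟩ := AddSubgroup.mem_sup.1 h3
      refine ⟨A h + g (F.model.graph.root h.1) - A' h - p, ?_, fun _ => ?_⟩
      · have : A' h + (A h + g (F.model.graph.root h.1) - A' h - p) - A h -
            g (F.model.graph.root h.1) = -p := by abel
        rw [this]
        exact neg_mem hp
      · have : B' h + (A h + g (F.model.graph.root h.1) - A' h - p) - B h -
            g (F.model.graph.root (F.model.graph.ι h.1)) = q := by
          have h5 : q = (-(g (F.orientation.target ⟨h.1, ho⟩) - g (F.orientation.source ⟨h.1, ho⟩)) +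
              (-(A' h - B' h) + (A h - B h))) - p := by rw [← hpq]; abel
          rw [h5]
          change _ = (-(g (F.model.graph.root (F.model.graph.ι h.1)) -
            g (F.model.graph.root h.1)) + (-(A' h - B' h) + (A h - B h))) - p
          abel
        rw [this]
        exact hq
    · refine ⟨A h + g (F.model.graph.root h.1) - A' h, ?_, fun h3 => absurd h3 ho⟩
      have : A' h + (A h + g (F.model.graph.root h.1) - A' h) - A h -
            g (F.model.graph.root h.1) = 0 := by abel
      rw [this]
      exact zero_mem _
  choose! k hk1 hk2 using hk
  refine ⟨fun w => g w +ᵥ y w, fun h t => k h +ᵥ σ h t,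
    ⟨fun w => by rw [τ.map_vadd, hF.map_y],
    fun h hh => (τ.continuous_vadd _).comp_continuousOn (hF.cont h hh),
    fun h hh t ht => by rw [τ.map_vadd, hF.map_σ h hh t ht], fun h hh => ?_, fun h ho => ?_⟩⟩
  · rw [hF.source h hh, vadd_vadd, vadd_vadd, vadd_eq_vadd_iff, hS.stabilizer_y (hF.map_y _)]
    convert hk1 h hh using 1
    abel
  · rw [hF.target h ho, vadd_vadd, vadd_vadd, vadd_eq_vadd_iff, hS.stabilizer_y (hF.map_y _)]
    convert hk2 h (Or.inl ho) ho using 1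
    abel

theorem HasStratification.mem_dilation [Finite G] {τ : GCover G X} (hS : τ.HasStratification S)
    {y : τ.total} {g : G} : g ∈ S.dilation (τ.map y) ↔ g +ᵥ y = y := by
  rw [hS.dilation_eq, AddAction.mem_stabilizer_iff]

/-- The second cover admits a framing with the same `A` and `B` as the first. The maps extended from
the framings in both directions are equivariant, and their composites fix the framings, whose
translates fill the covers. -/
theorem HasClass.exists_equiv [Finite G] {τ₁ τ₂ : GCover G X} (h₁ : τ₁.HasStratification S)
    (h₂ : τ₂.HasStratification S) {F : S.FramedModel} {c : F.H1} (c₁ : τ₁.HasClass F c)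
    (c₂ : τ₂.HasClass F c) : ∃ ψ : τ₁.total ≃ τ₂.total, Continuous ψ ∧ Continuous ψ.symm ∧
      (∀ y, τ₂.map (ψ y) = τ₁.map y) ∧ ∀ (g : G) y, ψ (g +ᵥ y) = g +ᵥ ψ y := by
  obtain ⟨η, hη, rfl⟩ := c₁
  obtain ⟨y, σ, A, B, hF, h1⟩ := (hasCochain_iff h₁).1 hη
  obtain ⟨y', σ', hF'⟩ := h₂.exists_framing c₂ A B h1
  obtain ⟨ψ, p1, p2, p3, p4, p5⟩ := hF.exists_map τ₁.continuous_map τ₁.continuous_vadd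
    τ₁.map_vadd τ₁.transitive h₂ hF' (AddMonoidHom.id G) (fun z g hg => h₁.mem_dilation.2 hg)
    (fun _ _ => rfl) (fun _ _ => rfl)
  obtain ⟨χ, q1, q2, q3, q4, q5⟩ := hF'.exists_map τ₂.continuous_map τ₂.continuous_vadd
    τ₂.map_vadd τ₂.transitive h₁ hF (AddMonoidHom.id G) (fun z g hg => h₂.mem_dilation.2 hg)
    (fun _ _ => rfl) (fun _ _ => rfl)
  have hrep : ∀ {τ : GCover G X} {y : F.model.graph.V → τ.total} {σ : F.model.graph.H → ℝ → τ.total}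
      (_ : F.IsFraming τ.map y σ A B) (z : τ.total), ∃ (g : G) (z₀ : τ.total), z = g +ᵥ z₀ ∧
      ((∃ w, z₀ = y w) ∨ ∃ h t, F.IsArc h ∧ t ∈ F.model.graph.Param h ∧ z₀ = σ h t) := by
    intro τ y σ hF z
    rcases F.exists_arc_rep (τ.map z) with ⟨w, hw⟩ | ⟨h, t, hh, hi, hx⟩
    · obtain ⟨g, hg⟩ := τ.transitive (y w) z (by rw [hF.map_y, hw])
      exact ⟨g, _, hg.symm, Or.inl ⟨w, rfl⟩⟩
    · obtain ⟨g, hg⟩ := τ.transitive (σ h t) z (by rw [hF.map_σ h hh t hi.mem, hx])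
      exact ⟨g, _, hg.symm, Or.inr ⟨h, t, hh, hi.mem, rfl⟩⟩
  refine ⟨⟨ψ, χ, fun z => ?_, fun z => ?_⟩, p1, q1, p2, p3⟩
  · obtain ⟨g, z₀, rfl, ⟨w, rfl⟩ | ⟨h, t, hh, ht, rfl⟩⟩ := hrep hF z
    · rw [p3, q3, p4, q4]; rfl
    · rw [p3, q3, p5 h hh t ht, q5 h hh t ht]; rfl
  · obtain ⟨g, z₀, rfl, ⟨w, rfl⟩ | ⟨h, t, hh, ht, rfl⟩⟩ := hrep hF' z
    · rw [q3, p3, q4, p4]; rfl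
    · rw [q3, p3, q5 h hh t ht, p5 h hh t ht]; rfl

/-- Covers with equal classes in one model have equal classes in all models. -/
theorem HasClass.transfer [Finite G] {τ₁ τ₂ : GCover G X} (h₁ : τ₁.HasStratification S)
    (h₂ : τ₂.HasStratification S) {F : S.FramedModel} {c : F.H1} (c₁ : τ₁.HasClass F c)
    (c₂ : τ₂.HasClass F c) {F' : S.FramedModel} {c' : F'.H1} (hc : τ₁.HasClass F' c') :
    τ₂.HasClass F' c' := by
  -- This homeomorphism does not remember the model `F`, so it transports framings in `F'` as well.
  obtain ⟨ψ, p1, p2, p3, p4⟩ := HasClass.exists_equiv h₁ h₂ c₁ c₂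
  obtain ⟨η, hη, rfl⟩ := hc
  obtain ⟨y, σ, A, B, hF, h1⟩ := (hasCochain_iff h₁).1 hη
  refine ⟨η, (hasCochain_iff h₂).2 ⟨fun w => ψ (y w), fun h t => ψ (σ h t), A, B,
    ⟨fun w => by rw [p3, hF.map_y], fun h hh => p1.comp_continuousOn (hF.cont h hh),
    fun h hh t ht => by rw [p3, hF.map_σ h hh t ht], fun h hh => by rw [hF.source h hh, p4],
    fun h ho => by rw [hF.target h ho, p4]⟩, h1⟩, rfl⟩

/-- The homeomorphism given by equal classes preserves degrees, since these are orders of the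
subgroups `D(x)`. It and its inverse are then nonexpanding, hence isometric. -/
theorem HasClass.iso [Finite G] {τ₁ τ₂ : GCover G X} (h₁ : τ₁.HasStratification S)
    (h₂ : τ₂.HasStratification S) {F : S.FramedModel} {c : F.H1} (c₁ : τ₁.HasClass F c)
    (c₂ : τ₂.HasClass F c)
    (hg : ∀ y z, τ₁.map y = τ₂.map z → τ₁.total.genus y = τ₂.total.genus z) : Iso τ₁ τ₂ := by
  obtain ⟨ψ, p1, p2, p3, p4⟩ := HasClass.exists_equiv h₁ h₂ c₁ c₂
  have hd : ∀ y, τ₂.degree (ψ y) = τ₁.degree y := fun y => by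
    rw [τ₁.degree_eq_card, τ₂.degree_eq_card, ← h₁.dilation_eq, ← h₂.dilation_eq, p3]
  refine ⟨ψ, fun y z => le_antisymm (edist_map_le p1 p3 hd y z) ?_,
    fun y => (hg y (ψ y) (p3 y).symm).symm, p3, hd, p4⟩
  have h1 := edist_map_le (ψ := ψ.symm) p2 (fun y => by rw [← p3, ψ.apply_symm_apply])
    (fun y => by rw [← hd, ψ.apply_symm_apply]) (ψ y) (ψ z)
  rwa [ψ.symm_apply_apply, ψ.symm_apply_apply] at h1

/-! ### Sums of covers -/

section Sum

variable (τ₁ τ₂ : GCover G X)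

/-- The fibre product of two covers. -/
abbrev FiberProduct : Type u := {p : τ₁.total × τ₂.total // τ₁.map p.1 = τ₂.map p.2}

instance : AddAction (G × G) (FiberProduct τ₁ τ₂) where
  vadd g p := ⟨(g.1 +ᵥ p.1.1, g.2 +ᵥ p.1.2), by rw [τ₁.map_vadd, τ₂.map_vadd]; exact p.2⟩
  zero_vadd p := Subtype.ext (Prod.ext (zero_vadd _ _) (zero_vadd _ _))
  add_vadd g k p := Subtype.ext (Prod.ext (add_vadd _ _ _) (add_vadd _ _ _))

variable {τ₁ τ₂}

/-- Framings of two covers induce a framing of the fibre product. -/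
theorem exists_framing_fiberProduct {F : S.FramedModel} {y₁ : F.model.graph.V → τ₁.total}
    {σ₁ : F.model.graph.H → ℝ → τ₁.total} {A₁ B₁ : F.model.graph.H → G}
    (hF₁ : F.IsFraming τ₁.map y₁ σ₁ A₁ B₁) {y₂ : F.model.graph.V → τ₂.total}
    {σ₂ : F.model.graph.H → ℝ → τ₂.total} {A₂ B₂ : F.model.graph.H → G}
    (hF₂ : F.IsFraming τ₂.map y₂ σ₂ A₂ B₂) :
    ∃ y σ, F.IsFraming (Z := FiberProduct τ₁ τ₂) (Γ := G × G) (fun p => τ₁.map p.1.1) y σ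
      (fun h => (A₁ h, A₂ h)) (fun h => (B₁ h, B₂ h)) := by
  classical
  let y : F.model.graph.V → FiberProduct τ₁ τ₂ := fun w =>
    ⟨(y₁ w, y₂ w), by rw [hF₁.map_y, hF₂.map_y]⟩
  -- Outside the parameter range the two lifts need not lie over the same point; the default value
  -- there is irrelevant.
  let σ : F.model.graph.H → ℝ → FiberProduct τ₁ τ₂ := fun h t =>
    if hc : τ₁.map (σ₁ h t) = τ₂.map (σ₂ h t) then ⟨(σ₁ h t, σ₂ h t), hc⟩
      else y (F.model.graph.root h.1)
  have hσ : ∀ h, F.IsArc h → ∀ t ∈ F.model.graph.Param h, (σ h t).1 = (σ₁ h t, σ₂ h t) := by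
    intro h hh t ht
    have hc : τ₁.map (σ₁ h t) = τ₂.map (σ₂ h t) := by
      rw [hF₁.map_σ h hh t ht, hF₂.map_σ h hh t ht]
    simp only [σ, dif_pos hc]
  refine ⟨y, σ, fun w => hF₁.map_y w, fun h hh => ?_, fun h hh t ht => ?_, fun h hh => ?_,
    fun h ho => ?_⟩
  · refine Topology.IsInducing.subtypeVal.continuousOn_iff.2 ?_
    exact ((hF₁.cont h hh).prodMk (hF₂.cont h hh)).congr fun t ht => hσ h hh t ht
  · rw [hσ h hh t ht]
    exact hF₁.map_σ h hh t ht
  · apply Subtype.ext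
    rw [hσ h hh 0 (F.model.graph.zero_mem_param h)]
    exact Prod.ext (hF₁.source h hh) (hF₂.source h hh)
  · apply Subtype.ext
    rw [hσ h (Or.inl ho) _ (F.model.graph.length_mem_param (F.orientation.isEdge _ ho))]
    exact Prod.ext (hF₁.target h ho) (hF₂.target h ho)

/-- Additivity of classes does not depend on the model. -/
theorem HasClass.add_transfer [Finite G] {τ₃ : GCover G X} (h₁ : τ₁.HasStratification S)
    (h₂ : τ₂.HasStratification S) (h₃ : τ₃.HasStratification S) {F F' : S.FramedModel}
    {c₁ c₂ : F.H1} (hc₁ : τ₁.HasClass F c₁) (hc₂ : τ₂.HasClass F c₂)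
    (hc₃ : τ₃.HasClass F (c₁ + c₂)) {d₁ d₂ : F'.H1} (hd₁ : τ₁.HasClass F' d₁)
    (hd₂ : τ₂.HasClass F' d₂) : τ₃.HasClass F' (d₁ + d₂) := by
  obtain ⟨η₁, hη₁, rfl⟩ := hc₁
  obtain ⟨η₂, hη₂, rfl⟩ := hc₂
  obtain ⟨y₁, σ₁, A₁, B₁, hF₁, e₁⟩ := (hasCochain_iff h₁).1 hη₁
  obtain ⟨y₂, σ₂, A₂, B₂, hF₂, e₂⟩ := (hasCochain_iff h₂).1 hη₂
  obtain ⟨y₃, σ₃, hF₃⟩ := h₃.exists_framing (η := η₁ + η₂) hc₃ (fun h => A₁ h + A₂ h)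
    (fun h => B₁ h + B₂ h) (fun e => by
      rw [Pi.add_apply, e₁, e₂, ← QuotientAddGroup.mk_add, ← add_sub_add_comm])
  obtain ⟨y, σ, hF⟩ := exists_framing_fiberProduct hF₁ hF₂
  -- Adding the framing elements gives a map from the fibre product to the third cover, equivariant
  -- along the addition `G × G → G`. It can be applied to framings in any model, in particular in
  -- `F'`.
  obtain ⟨m, m1, m2, m3, -, -⟩ := hF.exists_map
    (τ₁.continuous_map.comp (continuous_fst.comp continuous_subtype_val))
    (fun g => Continuous.subtype_mk (((τ₁.continuous_vadd g.1).comp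
      (continuous_fst.comp continuous_subtype_val)).prodMk ((τ₂.continuous_vadd g.2).comp
      (continuous_snd.comp continuous_subtype_val))) _)
    (fun g z => τ₁.map_vadd g.1 _)
    (fun z z' hz => by
      obtain ⟨g, hg⟩ := τ₁.transitive z.1.1 z'.1.1 hz
      obtain ⟨k, hk⟩ := τ₂.transitive z.1.2 z'.1.2 (by rw [← z.2, ← z'.2]; exact hz)
      exact ⟨(g, k), Subtype.ext (Prod.ext hg hk)⟩)
    h₃ hF₃ (AddMonoidHom.coprod (AddMonoidHom.id G) (AddMonoidHom.id G))
    -- A pair fixing a point has both components in the same subgroup `D(x)`, so its sum lies there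
    -- too.
    (fun z g hg => by
      have hg' := congrArg Subtype.val hg
      have hg1 : g.1 +ᵥ z.1.1 = z.1.1 := congrArg Prod.fst hg'
      have hg2 : g.2 +ᵥ z.1.2 = z.1.2 := congrArg Prod.snd hg'
      rw [← h₁.mem_dilation] at hg1
      rw [← h₂.mem_dilation, ← z.2] at hg2
      exact add_mem hg1 hg2)
    (fun _ _ => rfl) (fun _ _ => rfl)
  obtain ⟨θ₁, hθ₁, rfl⟩ := hd₁
  obtain ⟨θ₂, hθ₂, rfl⟩ := hd₂
  obtain ⟨z₁, ρ₁, A₁', B₁', hK₁, e₁'⟩ := (hasCochain_iff h₁).1 hθ₁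
  obtain ⟨z₂, ρ₂, A₂', B₂', hK₂, e₂'⟩ := (hasCochain_iff h₂).1 hθ₂
  obtain ⟨z, ρ, hK⟩ := exists_framing_fiberProduct hK₁ hK₂
  refine ⟨θ₁ + θ₂, (hasCochain_iff h₃).2 ⟨fun w => m (z w), fun h t => m (ρ h t),
    fun h => A₁' h + A₂' h, fun h => B₁' h + B₂' h, ⟨fun w => by rw [m2, hK.map_y],
    fun h hh => m1.comp_continuousOn (hK.cont h hh),
    fun h hh t ht => by rw [m2, hK.map_σ h hh t ht],
    fun h hh => by rw [hK.source h hh, m3]; rfl,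
    fun h ho => by rw [hK.target h ho, m3]; rfl⟩, fun e => ?_⟩, rfl⟩
  rw [Pi.add_apply, e₁', e₂', ← QuotientAddGroup.mk_add, ← add_sub_add_comm]

end Sum

end GCover

/-! ### The covering graph of a cochain -/

namespace DilationDatum

variable {G : Type v} [AddCommGroup G] {Γ : LegGraph} (D : DilationDatum G Γ)

theorem le_r (x : Γ.X) : D.D x ≤ D.D (Γ.r x) := by
  by_cases hx : Γ.r x = x
  · rw [hx]
  · exact D.le_root x hx

theorem ι_eq (x : Γ.X) : D.D (Γ.ι x) = D.D x := by
  by_cases h1 : Γ.ι x = x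
  · rw [h1]
  · refine D.flip_eq x ⟨fun hx => h1 ?_, h1⟩
    rw [← hx, Γ.ι_r]

variable [Finite G]

/-- Equality of cosets over the same element; the group is enumerated in order to stay in the
lowest universe. -/
def coverSetoid : Setoid (Γ.X × Fin (Nat.card G)) where
  r p q := p.1 = q.1 ∧ (Finite.equivFin G).symm p.2 - (Finite.equivFin G).symm q.2 ∈ D.D p.1
  iseqv :=
    { refl := fun p => ⟨rfl, by rw [sub_self]; exact zero_mem _⟩
      symm := fun {p q} h => ⟨h.1.symm, by rw [← h.1, ← neg_sub]; exact neg_mem h.2⟩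
      trans := fun {p q r} h k => ⟨h.1.trans k.1, by
        have := add_mem h.2 (h.1 ▸ k.2 : _ ∈ D.D p.1)
        rwa [sub_add_sub_cancel] at this⟩ }

/-- Pairs of an element `x` of the graph and a coset of `D x`. -/
abbrev CoverPt : Type := Quotient D.coverSetoid

instance : Finite D.CoverPt := Quotient.finite _

namespace CoverPt

variable {D}

/-- The coset of `g` over `x`. -/
noncomputable def mk (x : Γ.X) (g : G) : D.CoverPt :=
  Quotient.mk D.coverSetoid (x, Finite.equivFin G g)

theorem mk_eq_mk {x y : Γ.X} {g k : G} :
    (mk x g : D.CoverPt) = mk y k ↔ x = y ∧ g - k ∈ D.D x := by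
  unfold mk
  rw [Quotient.eq]
  change _ ∧ _ ↔ _
  simp

theorem ind {P : D.CoverPt → Prop} (h : ∀ x g, P (mk x g)) (p : D.CoverPt) : P p := by
  induction p using Quotient.ind with
  | _ p =>
    have := h p.1 ((Finite.equivFin G).symm p.2)
    simpa [mk] using this

/-- Functions on the set of pairs. -/
noncomputable def lift {α : Type*} (f : Γ.X → G → α) (hf : ∀ x g k, g - k ∈ D.D x → f x g = f x k) :
    D.CoverPt → α :=
  Quotient.lift (fun p => f p.1 ((Finite.equivFin G).symm p.2)) (by
    rintro ⟨x, i⟩ ⟨y, j⟩ ⟨h1, h2⟩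
    obtain rfl : x = y := h1
    exact hf _ _ _ h2)

theorem lift_mk {α : Type*} (f : Γ.X → G → α) (hf : ∀ x g k, g - k ∈ D.D x → f x g = f x k)
    (x : Γ.X) (g : G) : lift f hf (mk x g : D.CoverPt) = f x g := by
  simp [lift, mk]

variable (D) in
/-- The projection to the graph. -/
noncomputable def proj : D.CoverPt → Γ.X := lift (fun x _ => x) fun _ _ _ _ => rfl

theorem proj_mk (x : Γ.X) (g : G) : proj D (mk x g) = x := lift_mk _ _ _ _

variable (D) in
/-- The action of `G`. -/
noncomputable def act (k : G) : D.CoverPt → D.CoverPt := lift (fun x g => mk x (k + g))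
  fun _ _ _ h => mk_eq_mk.2 ⟨rfl, by rwa [add_sub_add_left_eq_sub]⟩

theorem act_mk (k : G) (x : Γ.X) (g : G) : act D k (mk x g) = mk x (k + g) := lift_mk _ _ _ _

theorem act_act (k l : G) (p : D.CoverPt) : act D k (act D l p) = act D (k + l) p := by
  induction p using ind with
  | h x g => rw [act_mk, act_mk, act_mk, add_assoc]

theorem act_zero (p : D.CoverPt) : act D 0 p = p := by
  induction p using ind with
  | h x g => rw [act_mk, zero_add]

theorem proj_act (k : G) (p : D.CoverPt) : proj D (act D k p) = proj D p := by
  induction p using ind with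
  | h x g => rw [act_mk, proj_mk, proj_mk]

end CoverPt

end DilationDatum

/-! ### The covering graph with its projection and its group action -/

namespace WeightedMetricGraph

open DilationDatum

variable {G : Type v} [AddCommGroup G] [Finite G] (Γ : WeightedMetricGraph)
  (D : DilationDatum G Γ.toLegGraph)

/-- Shifts of the half-edges by group elements. -/
structure Shift (G : Type v) [AddCommGroup G] where
  val : Γ.X → G
  vertex : ∀ x, Γ.IsVertex x → val x = 0

variable {Γ} (A : Γ.Shift G) (g' : Γ.V → ℕ)

/-- The root map of the covering graph. -/
noncomputable def coverRoot : D.CoverPt → D.CoverPt :=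
  CoverPt.lift (fun x g => CoverPt.mk (Γ.r x) (g + A.val x)) fun x g k h =>
    CoverPt.mk_eq_mk.2 ⟨rfl, by rw [add_sub_add_right_eq_sub]; exact D.le_r x h⟩

/-- The involution of the covering graph. -/
noncomputable def coverFlip : D.CoverPt → D.CoverPt :=
  CoverPt.lift (fun x g => CoverPt.mk (Γ.ι x) g) fun x g k h =>
    CoverPt.mk_eq_mk.2 ⟨rfl, by rwa [D.ι_eq]⟩

theorem coverRoot_mk (x : Γ.X) (g : G) :
    coverRoot D A (CoverPt.mk x g) = CoverPt.mk (Γ.r x) (g + A.val x) :=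
  CoverPt.lift_mk _ _ _ _

theorem coverFlip_mk (x : Γ.X) (g : G) :
    coverFlip D (CoverPt.mk x g) = CoverPt.mk (Γ.ι x) g :=
  CoverPt.lift_mk _ _ _ _

/-- The legs-and-edges structure of the covering graph. -/
noncomputable abbrev coverLegGraph : LegGraph where
  X := D.CoverPt
  r := coverRoot D A
  ι := coverFlip D
  r_r := CoverPt.ind fun x g => by
    rw [coverRoot_mk, coverRoot_mk, Γ.r_r, A.vertex (Γ.r x) (Γ.r_r x), add_zero]
  ι_ι := CoverPt.ind fun x g => by
    rw [coverFlip_mk, coverFlip_mk, Γ.ι_ι]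
  ι_r := CoverPt.ind fun x g => by
    rw [coverRoot_mk, coverFlip_mk, Γ.ι_r]

theorem cover_r_mk (x : Γ.X) (g : G) :
    (coverLegGraph D A).r (CoverPt.mk x g) = CoverPt.mk (Γ.r x) (g + A.val x) :=
  coverRoot_mk D A x g

theorem cover_ι_mk (x : Γ.X) (g : G) :
    (coverLegGraph D A).ι (CoverPt.mk x g) = CoverPt.mk (Γ.ι x) g :=
  coverFlip_mk D x g

theorem proj_r (p : D.CoverPt) : CoverPt.proj D ((coverLegGraph D A).r p) =
    Γ.r (CoverPt.proj D p) := by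
  induction p using CoverPt.ind with
  | h x g => rw [cover_r_mk, CoverPt.proj_mk, CoverPt.proj_mk]

theorem proj_ι (p : D.CoverPt) : CoverPt.proj D ((coverLegGraph D A).ι p) =
    Γ.ι (CoverPt.proj D p) := by
  induction p using CoverPt.ind with
  | h x g => rw [cover_ι_mk, CoverPt.proj_mk, CoverPt.proj_mk]

theorem act_r (k : G) (p : D.CoverPt) : CoverPt.act D k ((coverLegGraph D A).r p) =
    (coverLegGraph D A).r (CoverPt.act D k p) := by
  induction p using CoverPt.ind with
  | h x g => rw [cover_r_mk, CoverPt.act_mk, CoverPt.act_mk, cover_r_mk, add_assoc]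

theorem act_ι (k : G) (p : D.CoverPt) : CoverPt.act D k ((coverLegGraph D A).ι p) =
    (coverLegGraph D A).ι (CoverPt.act D k p) := by
  induction p using CoverPt.ind with
  | h x g => rw [cover_ι_mk, CoverPt.act_mk, CoverPt.act_mk, cover_ι_mk]

theorem cover_isVertex {p : D.CoverPt} :
    (coverLegGraph D A).IsVertex p ↔ Γ.IsVertex (CoverPt.proj D p) := by
  induction p using CoverPt.ind with
  | h x g =>
    unfold LegGraph.IsVertex
    rw [cover_r_mk, CoverPt.mk_eq_mk, CoverPt.proj_mk]
    refine ⟨fun h => h.1, fun h => ⟨h, ?_⟩⟩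
    rw [A.vertex x h, add_zero, sub_self]
    exact zero_mem _

theorem cover_isHalfEdge {p : D.CoverPt} :
    (coverLegGraph D A).IsHalfEdge p ↔ Γ.IsHalfEdge (CoverPt.proj D p) :=
  (cover_isVertex D A).not

theorem cover_ι_eq {p : D.CoverPt} :
    (coverLegGraph D A).ι p = p ↔ Γ.ι (CoverPt.proj D p) = CoverPt.proj D p := by
  induction p using CoverPt.ind with
  | h x g =>
    rw [cover_ι_mk, CoverPt.mk_eq_mk, CoverPt.proj_mk, sub_self]
    exact ⟨fun h => h.1, fun h => ⟨h, zero_mem _⟩⟩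

theorem cover_isEdge {p : D.CoverPt} :
    (coverLegGraph D A).IsEdge p ↔ Γ.IsEdge (CoverPt.proj D p) :=
  and_congr (cover_isHalfEdge D A) (cover_ι_eq D A).not

theorem cover_isLeg {p : D.CoverPt} :
    (coverLegGraph D A).IsLeg p ↔ Γ.IsLeg (CoverPt.proj D p) :=
  and_congr (cover_isHalfEdge D A) (cover_ι_eq D A)

theorem card_pos_real (H : AddSubgroup G) : (0 : ℝ) < Nat.card H := Nat.cast_pos.2 Nat.card_pos

/-- The covering graph, with the genus function pulled back from the base. -/
noncomputable abbrev coverGraph : WeightedMetricGraph where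
  toLegGraph := coverLegGraph D A
  genus w := g' ⟨CoverPt.proj D w.1, (cover_isVertex D A).1 w.2⟩
  length p := Γ.length (CoverPt.proj D p) / Nat.card (D.D (CoverPt.proj D p))
  length_pos p hp := div_pos (Γ.length_pos _ ((cover_isEdge D A).1 hp)) (card_pos_real _)
  length_ι p hp := by
    rw [proj_ι, D.ι_eq, Γ.length_ι _ ((cover_isEdge D A).1 hp)]

/-- The half-edge of the covering graph given by a coset. -/
noncomputable def coverHalf (h : Γ.H) (g : G) : (coverGraph D A g').H :=
  ⟨CoverPt.mk h.1 g, (cover_isHalfEdge D A).2 (by rw [CoverPt.proj_mk]; exact h.2)⟩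

/-- The vertex of the covering graph given by a coset. -/
noncomputable def coverVert (w : Γ.V) (g : G) : (coverGraph D A g').V :=
  ⟨CoverPt.mk w.1 g, (cover_isVertex D A).2 (by rw [CoverPt.proj_mk]; exact w.2)⟩

theorem exists_coverHalf (h : (coverGraph D A g').H) : ∃ k g, h = coverHalf D A g' k g := by
  obtain ⟨p, hp⟩ := h
  induction p using CoverPt.ind with
  | h x g =>
    have h1 := (cover_isHalfEdge D A).1 hp
    rw [CoverPt.proj_mk] at h1
    exact ⟨⟨x, h1⟩, g, rfl⟩

theorem exists_coverVert (w : (coverGraph D A g').V) : ∃ k g, w = coverVert D A g' k g := by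
  obtain ⟨p, hp⟩ := w
  induction p using CoverPt.ind with
  | h x g =>
    have h1 := (cover_isVertex D A).1 hp
    rw [CoverPt.proj_mk] at h1
    exact ⟨⟨x, h1⟩, g, rfl⟩

/-- Translation by `c` identifies these cosets with `K / H`. This is the count behind harmonicity:
`[D(v) : D(h)]` half-edges over `h`, each of degree `#D(h)`, have total degree `#D(v)`. -/
theorem ncard_coset (H K : AddSubgroup G) (hHK : H ≤ K) (x : Γ.X) (hx : D.D x = H) (c : G) :
    {p : D.CoverPt | ∃ k : G, p = CoverPt.mk x k ∧ k - c ∈ K}.ncard * Nat.card H = Nat.card K := by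
  let f : K → D.CoverPt := fun k => CoverPt.mk x (k.1 + c)
  have h1 : {p : D.CoverPt | ∃ k : G, p = CoverPt.mk x k ∧ k - c ∈ K} = Set.range f := by
    ext p
    constructor
    · rintro ⟨k, rfl, hk⟩
      exact ⟨⟨k - c, hk⟩, by simp [f]⟩
    · rintro ⟨k, rfl⟩
      exact ⟨_, rfl, by simp⟩
  have h2 : (K ⧸ H.addSubgroupOf K) ≃ Set.range f := by
    refine Equiv.ofBijective (fun q => Quotient.liftOn' q (fun k => ⟨f k, k, rfl⟩) ?_) ⟨?_, ?_⟩
    · intro a b hab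
      rw [QuotientAddGroup.leftRel_apply, AddSubgroup.mem_addSubgroupOf] at hab
      refine Subtype.ext (CoverPt.mk_eq_mk.2 ⟨rfl, ?_⟩)
      rw [hx, add_sub_add_right_eq_sub, ← neg_sub]
      refine neg_mem ?_
      rw [sub_eq_neg_add]
      exact hab
    · intro a b hab
      induction a using QuotientAddGroup.induction_on with
      | H a =>
        induction b using QuotientAddGroup.induction_on with
        | H b =>
          have h3 := congrArg Subtype.val hab
          have h4 := (CoverPt.mk_eq_mk.1 h3).2
          rw [QuotientAddGroup.eq, AddSubgroup.mem_addSubgroupOf]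
          rw [hx, add_sub_add_right_eq_sub, ← neg_sub] at h4
          have h5 := neg_mem h4
          rw [neg_neg, sub_eq_neg_add] at h5
          exact h5
    · rintro ⟨_, k, rfl⟩
      exact ⟨QuotientAddGroup.mk k, rfl⟩
  rw [h1, ← Nat.card_coe_set_eq, ← Nat.card_congr h2,
    ← Nat.card_congr (AddSubgroup.addSubgroupOfEquivOfLe hHK).toEquiv]
  exact (AddSubgroup.card_eq_card_quotient_mul_card_addSubgroup (H.addSubgroupOf K)).symm

/-- The projection of the covering graph, with local degrees the orders of the dilation groups. -/
noncomputable def coverProj : HarmonicMorphism (coverGraph D A g') Γ where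
  toFun := CoverPt.proj D
  map_r := proj_r D A
  map_ι := proj_ι D A
  map_edge p hp := (cover_isEdge D A).1 hp
  map_leg p hp := (cover_isLeg D A).1 hp
  deg p := Nat.card (D.D (CoverPt.proj D p))
  deg_pos p := Nat.card_pos
  deg_ι p hp := by
    change Nat.card (D.D (CoverPt.proj D ((coverLegGraph D A).ι p))) = _
    rw [proj_ι, D.ι_eq]
  length_eq p hp := (mul_div_cancel₀ _ (card_pos_real _).ne').symm
  harmonic w h hh hr := by
    obtain ⟨v, g, rfl⟩ := exists_coverVert D A g' w
    have hr' : Γ.r h = v.1 := by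
      rw [hr]; exact CoverPt.proj_mk _ _
    -- The half-edge over `h` with coset of `k` is rooted at the coset of `k + A h`, so the
    -- half-edges at the coset of `g` are those with `k` in `g - A h + D(v)`.
    have h1 : {p | p ∈ (coverGraph D A g').tangent (coverVert D A g' v g) ∧
        CoverPt.proj D p = h} = {p : D.CoverPt | ∃ k : G, p = CoverPt.mk h k ∧
          k - (g - A.val h) ∈ D.D v.1} := by
      ext p
      induction p using CoverPt.ind with
      | h x k =>
        constructor
        · rintro ⟨⟨h2, h3⟩, h4⟩
          rw [CoverPt.proj_mk] at h4
          subst h4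
          have h5 : (coverLegGraph D A).r (CoverPt.mk x k) = CoverPt.mk v.1 g := h3
          rw [cover_r_mk, CoverPt.mk_eq_mk] at h5
          refine ⟨k, rfl, ?_⟩
          rw [← hr', ← sub_add, sub_add_eq_add_sub]
          exact h5.2
        · rintro ⟨l, h2, h3⟩
          rw [h2]
          refine ⟨⟨(cover_isHalfEdge D A).2 (by rwa [CoverPt.proj_mk]), ?_⟩, CoverPt.proj_mk _ _⟩
          change (coverLegGraph D A).r (CoverPt.mk h l) = CoverPt.mk v.1 g
          rw [cover_r_mk, CoverPt.mk_eq_mk]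
          refine ⟨hr', ?_⟩
          rwa [hr', ← sub_add_eq_add_sub, sub_add]
    have h2 : ∑ᶠ p ∈ {p | p ∈ (coverGraph D A g').tangent (coverVert D A g' v g) ∧
        CoverPt.proj D p = h}, Nat.card (D.D (CoverPt.proj D p)) =
        ∑ᶠ p ∈ {p | p ∈ (coverGraph D A g').tangent (coverVert D A g' v g) ∧
        CoverPt.proj D p = h}, Nat.card (D.D h) := by
      refine finsum_mem_congr rfl ?_
      rintro p ⟨-, hp⟩
      rw [hp]
    refine Eq.trans ?_ h2.symm
    rw [h1, finsum_mem_eq_finite_toFinset_sum _ (Set.toFinite _), Finset.sum_const, smul_eq_mul,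
      ← Set.ncard_eq_toFinset_card]
    rw [ncard_coset D (D.D h) (D.D v.1) (by rw [← hr']; exact D.le_r h) h rfl]
    change Nat.card (D.D (CoverPt.proj D (CoverPt.mk v.1 g))) = _
    rw [CoverPt.proj_mk]

/-- The action of an element of the group on the covering graph. -/
noncomputable def coverAct (k : G) : HarmonicMorphism (coverGraph D A g') (coverGraph D A g') where
  toFun := CoverPt.act D k
  map_r := act_r D A k
  map_ι := act_ι D A k
  map_edge p hp := by
    refine (cover_isEdge D A).2 ?_
    rw [CoverPt.proj_act]
    exact (cover_isEdge D A).1 hp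
  map_leg p hp := by
    refine (cover_isLeg D A).2 ?_
    rw [CoverPt.proj_act]
    exact (cover_isLeg D A).1 hp
  deg _ := 1
  deg_pos _ := one_pos
  deg_ι _ _ := rfl
  length_eq p hp := by
    rw [Nat.cast_one, one_mul]
    change Γ.length (CoverPt.proj D (CoverPt.act D k p)) /
      Nat.card (D.D (CoverPt.proj D (CoverPt.act D k p))) = _
    rw [CoverPt.proj_act]
  harmonic w h hh hr := by
    have h1 : {h' | h' ∈ (coverGraph D A g').tangent w ∧ CoverPt.act D k h' = h} =
        {CoverPt.act D (-k) h} := by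
      ext p
      constructor
      · rintro ⟨-, rfl⟩
        rw [CoverPt.act_act, neg_add_cancel, CoverPt.act_zero]
        rfl
      · rintro rfl
        have h2 : CoverPt.act D k (CoverPt.act D (-k) h) = h := by
          rw [CoverPt.act_act, add_neg_cancel, CoverPt.act_zero]
        refine ⟨⟨(cover_isHalfEdge D A).2 ?_, ?_⟩, h2⟩
        · rw [CoverPt.proj_act]
          exact (cover_isHalfEdge D A).1 hh
        · change (coverLegGraph D A).r _ = _
          rw [← act_r]
          change CoverPt.act D (-k) ((coverGraph D A g').r h) = _
          rw [hr, CoverPt.act_act, neg_add_cancel, CoverPt.act_zero]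
    rw [h1, finsum_mem_singleton]

variable {D A g'}

theorem coverAct_vert (k : G) (w : Γ.V) (g : G) :
    (coverAct D A g' k).realize ((coverGraph D A g').vert (coverVert D A g' w g)) =
      (coverGraph D A g').vert (coverVert D A g' w (k + g)) := by
  refine congrArg (coverGraph D A g').vert (Subtype.ext ?_)
  exact CoverPt.act_mk (D := D) k w.1 g

theorem coverAct_ray (k : G) (h : Γ.H) (g : G) (t : ℝ) :
    (coverAct D A g' k).realize ((coverGraph D A g').ray (coverHalf D A g' h g) t) =
      (coverGraph D A g').ray (coverHalf D A g' h (k + g)) t := by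
  rw [HarmonicMorphism.realize_ray]
  have h1 : (coverAct D A g' k).mapH (coverHalf D A g' h g) = coverHalf D A g' h (k + g) :=
    Subtype.ext (CoverPt.act_mk (D := D) k h.1 g)
  rw [h1]
  congr 1
  change ((1 : ℕ) : ℝ) * t = t
  rw [Nat.cast_one, one_mul]

theorem coverProj_vert (w : Γ.V) (g : G) :
    (coverProj D A g').realize ((coverGraph D A g').vert (coverVert D A g' w g)) = Γ.vert w := by
  refine congrArg Γ.vert (Subtype.ext ?_)
  exact CoverPt.proj_mk (D := D) w.1 g

theorem coverProj_mapH (h : Γ.H) (g : G) : (coverProj D A g').mapH (coverHalf D A g' h g) = h :=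
  Subtype.ext (CoverPt.proj_mk (D := D) h.1 g)

theorem coverProj_deg (h : Γ.H) (g : G) :
    (coverProj D A g').deg (coverHalf D A g' h g).1 = Nat.card (D.D h.1) := by
  change Nat.card (D.D (CoverPt.proj D (CoverPt.mk h.1 g))) = _
  rw [CoverPt.proj_mk]

theorem coverProj_ray (h : Γ.H) (g : G) (t : ℝ) :
    (coverProj D A g').realize ((coverGraph D A g').ray (coverHalf D A g' h g) t) =
      Γ.ray h (Nat.card (D.D h.1) * t) := by
  rw [HarmonicMorphism.realize_ray, coverProj_mapH, coverProj_deg]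

theorem cover_isInner (h : Γ.H) (g : G) (t : ℝ) :
    (coverGraph D A g').IsInner (coverHalf D A g' h g) t ↔
      Γ.IsInner h (Nat.card (D.D h.1) * t) := by
  rw [← HarmonicMorphism.isInner_map_iff (coverProj D A g'), coverProj_mapH, coverProj_deg]

theorem cover_exists_rep (p : (coverGraph D A g').Realization) :
    (∃ w g, p = (coverGraph D A g').vert (coverVert D A g' w g)) ∨
    ∃ h g t, Γ.IsInner h (Nat.card (D.D h.1) * t) ∧
      p = (coverGraph D A g').ray (coverHalf D A g' h g) t := by
  rcases exists_rep p with ⟨w, rfl⟩ | ⟨h, t, ht, rfl⟩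
  · obtain ⟨v, g, rfl⟩ := exists_coverVert D A g' w
    exact Or.inl ⟨v, g, rfl⟩
  · obtain ⟨k, g, rfl⟩ := exists_coverHalf D A g' h
    exact Or.inr ⟨k, g, t, (cover_isInner k g t).1 ht, rfl⟩

theorem coverHalf_flip (h : Γ.H) (g : G) : (coverGraph D A g').flip (coverHalf D A g' h g) =
    coverHalf D A g' (Γ.flip h) g := Subtype.ext (cover_ι_mk D A _ _)

theorem coverHalf_isEdge (h : Γ.H) (g : G) :
    (coverGraph D A g').IsEdge (coverHalf D A g' h g).1 ↔ Γ.IsEdge h.1 := by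
  refine (cover_isEdge D A).trans ?_
  rw [show (coverHalf D A g' h g).1 = CoverPt.mk h.1 g from rfl, CoverPt.proj_mk]

theorem coverHalf_length (h : Γ.H) (g : G) :
    (coverGraph D A g').length (coverHalf D A g' h g).1 = Γ.length h.1 / Nat.card (D.D h.1) := by
  change Γ.length (CoverPt.proj D (CoverPt.mk h.1 g)) /
    Nat.card (D.D (CoverPt.proj D (CoverPt.mk h.1 g))) = _
  rw [CoverPt.proj_mk]

theorem cover_over_vert {p : (coverGraph D A g').Realization} {w : Γ.V}
    (hp : (coverProj D A g').realize p = Γ.vert w) :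
    ∃ g, p = (coverGraph D A g').vert (coverVert D A g' w g) := by
  rcases cover_exists_rep p with ⟨v, g, rfl⟩ | ⟨h, g, t, ht, rfl⟩
  · rw [coverProj_vert] at hp
    exact ⟨g, by rw [vert_injective hp]⟩
  · rw [coverProj_ray] at hp
    exact absurd hp (ray_ne_vert ht w)

theorem cover_over_ray {p : (coverGraph D A g').Realization} {h : Γ.H} {t : ℝ}
    (ht : Γ.IsInner h t) (hp : (coverProj D A g').realize p = Γ.ray h t) :
    ∃ g, p = (coverGraph D A g').ray (coverHalf D A g' h g) (t / Nat.card (D.D h.1)) := by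
  rcases cover_exists_rep p with ⟨v, g, rfl⟩ | ⟨k, g, s, hs, rfl⟩
  · rw [coverProj_vert] at hp
    exact absurd hp.symm (ray_ne_vert ht v)
  · rw [coverProj_ray] at hp
    have hpos := card_pos_real (D.D k.1)
    rcases ray_eq_ray hs ht hp with ⟨rfl, rfl⟩ | ⟨he, rfl, rfl⟩
    · exact ⟨g, by rw [mul_div_cancel_left₀ _ hpos.ne']⟩
    · refine ⟨g, ?_⟩
      rw [← ray_flip ((coverHalf_isEdge k g).2 he), coverHalf_flip, coverHalf_length]
      congr 1
      have h1 : D.D (Γ.flip k).1 = D.D k.1 := D.ι_eq k.1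
      rw [h1, sub_div, mul_div_cancel_left₀ _ hpos.ne']

theorem cover_vert_eq {w : Γ.V} {g k : G} : (coverGraph D A g').vert (coverVert D A g' w g) =
    (coverGraph D A g').vert (coverVert D A g' w k) ↔ g - k ∈ D.D w.1 := by
  rw [vert_injective.eq_iff, Subtype.ext_iff]
  change (CoverPt.mk w.1 g : D.CoverPt) = CoverPt.mk w.1 k ↔ _
  rw [CoverPt.mk_eq_mk]
  simp

theorem cover_ray_eq {h : Γ.H} {t : ℝ} (ht : Γ.IsInner h (Nat.card (D.D h.1) * t)) {g k : G} :
    (coverGraph D A g').ray (coverHalf D A g' h g) t =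
      (coverGraph D A g').ray (coverHalf D A g' h k) t ↔ g - k ∈ D.D h.1 := by
  constructor
  · intro h0
    rcases ray_eq_ray ((cover_isInner h g t).2 ht) ((cover_isInner h k t).2 ht) h0 with
      ⟨h1, -⟩ | ⟨he, h1, -⟩
    · exact (CoverPt.mk_eq_mk.1 (congrArg Subtype.val h1.symm)).2
    -- A half-edge and its flip project to different half-edges, so the action never reverses an
    -- edge.
    · rw [coverHalf_flip] at h1
      have h2 := (CoverPt.mk_eq_mk.1 (congrArg Subtype.val h1)).1
      exact absurd h2.symm ((coverHalf_isEdge h g).1 he).2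
  · intro h1
    have h2 : coverHalf D A g' h g = coverHalf D A g' h k :=
      Subtype.ext (CoverPt.mk_eq_mk.2 ⟨rfl, h1⟩)
    rw [h2]

noncomputable instance : AddAction G (coverGraph D A g').Realization where
  vadd k := (coverAct D A g' k).realize
  zero_vadd p := by
    change (coverAct D A g' 0).realize p = p
    rcases cover_exists_rep p with ⟨v, g, rfl⟩ | ⟨h, g, t, ht, rfl⟩
    · rw [coverAct_vert, zero_add]
    · rw [coverAct_ray, zero_add]
  add_vadd k l p := by
    change (coverAct D A g' (k + l)).realize p =
      (coverAct D A g' k).realize ((coverAct D A g' l).realize p)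
    rcases cover_exists_rep p with ⟨v, g, rfl⟩ | ⟨h, g, t, ht, rfl⟩
    · rw [coverAct_vert, coverAct_vert, coverAct_vert, add_assoc]
    · rw [coverAct_ray, coverAct_ray, coverAct_ray, add_assoc]

theorem vadd_vert (k : G) (w : Γ.V) (g : G) :
    k +ᵥ ((coverGraph D A g').vert (coverVert D A g' w g)) =
      (coverGraph D A g').vert (coverVert D A g' w (k + g)) := coverAct_vert k w g

theorem vadd_ray (k : G) (h : Γ.H) (g : G) (t : ℝ) :
    k +ᵥ ((coverGraph D A g').ray (coverHalf D A g' h g) t) =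
      (coverGraph D A g').ray (coverHalf D A g' h (k + g)) t := coverAct_ray k h g t

theorem coverProj_vadd (k : G) (p : (coverGraph D A g').Realization) :
    (coverProj D A g').realize (k +ᵥ p) = (coverProj D A g').realize p := by
  rcases cover_exists_rep p with ⟨v, g, rfl⟩ | ⟨h, g, t, ht, rfl⟩
  · rw [vadd_vert, coverProj_vert, coverProj_vert]
  · rw [vadd_ray, coverProj_ray, coverProj_ray]

theorem coverProj_transitive (p q : (coverGraph D A g').Realization)
    (hpq : (coverProj D A g').realize p = (coverProj D A g').realize q) :
    ∃ k : G, k +ᵥ p = q := by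
  rcases cover_exists_rep p with ⟨v, g, rfl⟩ | ⟨h, g, t, ht, rfl⟩
  · rw [coverProj_vert] at hpq
    obtain ⟨k, rfl⟩ := cover_over_vert hpq.symm
    exact ⟨k - g, by rw [vadd_vert, sub_add_cancel]⟩
  · rw [coverProj_ray] at hpq
    obtain ⟨k, rfl⟩ := cover_over_ray ht hpq.symm
    exact ⟨k - g, by rw [vadd_ray, sub_add_cancel, mul_div_cancel_left₀ _ (card_pos_real _).ne']⟩

theorem coverProj_surjective : Function.Surjective (coverProj D A g').realize := by
  intro p
  rcases exists_rep p with ⟨w, rfl⟩ | ⟨h, t, ht, rfl⟩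
  · exact ⟨_, coverProj_vert w 0⟩
  · refine ⟨(coverGraph D A g').ray (coverHalf D A g' h 0) (t / Nat.card (D.D h.1)), ?_⟩
    rw [coverProj_ray, mul_div_cancel₀ _ (card_pos_real _).ne']

theorem stabilizer_vert (w : Γ.V) (g : G) : AddAction.stabilizer G
    ((coverGraph D A g').vert (coverVert D A g' w g)) = D.D w.1 := by
  ext k
  rw [AddAction.mem_stabilizer_iff, vadd_vert, cover_vert_eq, add_sub_cancel_right]

theorem stabilizer_ray {h : Γ.H} {t : ℝ} (ht : Γ.IsInner h (Nat.card (D.D h.1) * t)) (g : G) :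
    AddAction.stabilizer G ((coverGraph D A g').ray (coverHalf D A g' h g) t) = D.D h.1 := by
  ext k
  rw [AddAction.mem_stabilizer_iff, vadd_ray, cover_ray_eq ht, add_sub_cancel_right]

end WeightedMetricGraph

/-- The tropical curve given by a weighted metric graph. -/
noncomputable def WeightedMetricGraph.toCurve (Γ : WeightedMetricGraph) (γ : Γ.Realization → ℕ)
    (h1 : ∀ w, γ (Γ.vert w) = Γ.genus w) (h2 : ∀ p, (∀ w, p ≠ Γ.vert w) → γ p = 0) :
    TropicalCurve.{u} :=
  letI : EMetricSpace (ULift.{u} Γ.Realization) :=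
    { edist := fun p q => Γ.pathEDist p.down q.down
      edist_self := fun p => pathEDist_self _
      edist_comm := fun p q => pathEDist_comm _ _
      edist_triangle := fun p q r => pathEDist_triangle _ _ _
      eq_of_edist_eq_zero := fun {p q} h => ULift.ext _ _ (eq_of_pathEDist_eq_zero h) }
  { carrier := ULift.{u} Γ.Realization
    genus := fun p => γ p.down
    exists_model := ⟨{
      graph := Γ
      toFun := ULift.up
      bijective := ⟨fun _ _ h => congrArg ULift.down h, fun p => ⟨p.down, rfl⟩⟩
      isometry := fun _ _ => rfl
      genus_vert := h1
      genus_zero := fun p hp => h2 p.down fun w hw => hp w (ULift.ext _ _ hw) }⟩ }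

/-- The tautological model. -/
def WeightedMetricGraph.toCurveModel (Γ : WeightedMetricGraph) (γ : Γ.Realization → ℕ)
    (h1 : ∀ w, γ (Γ.vert w) = Γ.genus w) (h2 : ∀ p, (∀ w, p ≠ Γ.vert w) → γ p = 0) :
    (Γ.toCurve γ h1 h2 : TropicalCurve.{u}).Model where
  graph := Γ
  toFun := ULift.up
  bijective := ⟨fun _ _ h => congrArg ULift.down h, fun p => ⟨p.down, rfl⟩⟩
  isometry := fun _ _ => rfl
  genus_vert := h1
  genus_zero := fun p hp => h2 p.down fun w hw => hp w (ULift.ext _ _ hw)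

/-! ### The cover of a cochain -/

namespace GStratification.FramedModel

open WeightedMetricGraph

variable {G : Type v} [AddCommGroup G] [Finite G] {X : TropicalCurve.{u}}
  {S : GStratification G X} (F : S.FramedModel) (A : F.model.graph.Shift G) (g' : X → ℕ)

/-- The graph of the cover. -/
noncomputable abbrev cGraph : WeightedMetricGraph :=
  coverGraph F.datum A fun w => g' (F.model.vert w)

/-- The projection of the graph of the cover. -/
noncomputable abbrev cProj : HarmonicMorphism (F.cGraph A g') F.model.graph :=
  coverProj F.datum A fun w => g' (F.model.vert w)

/-- Over each cell both sides are the subgroup attached to that cell by the datum: the fibres were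
built as its cosets. -/
theorem dilation_cProj (p : (F.cGraph A g').Realization) :
    S.dilation (F.model.toFun ((F.cProj A g').realize p)) = AddAction.stabilizer G p := by
  rcases cover_exists_rep p with ⟨w, g, rfl⟩ | ⟨h, g, t, ht, rfl⟩
  · rw [stabilizer_vert, coverProj_vert]
    exact (F.datum_vert w).symm
  · rw [stabilizer_ray ht, coverProj_ray]
    exact (F.datum_halfEdge ht).symm

theorem card_dilation_cProj (h : (F.cGraph A g').H) {t : (F.cGraph A g').Param h}
    (ht : (F.cGraph A g').IsInner h t) :
    Nat.card (S.dilation (F.model.toFun ((F.cProj A g').realize ((F.cGraph A g').pt h t)))) =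
      (F.cProj A g').deg h.1 := by
  rw [pt_eq_ray, HarmonicMorphism.realize_ray]
  have h2 := F.datum_halfEdge ((HarmonicMorphism.isInner_map_iff (F.cProj A g')).2 ht)
  change Nat.card (S.dilation (F.model.ray _ _)) = _
  rw [← h2]
  rfl

variable (hg : ∀ x, (∀ w, x ≠ F.model.vert w) → g' x = 0)

/-- The cover defined by shifts of the half-edges and by a genus function. -/
noncomputable def cover : GCover G X where
  total := (F.cGraph A g').toCurve (fun p => g' (F.model.toFun ((F.cProj A g').realize p)))
    (fun w => rfl) (fun p hp => by
      rcases cover_exists_rep p with ⟨w, g, rfl⟩ | ⟨h, g, t, ht, rfl⟩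
      · exact absurd rfl (hp _)
      · apply hg
        intro w
        rw [coverProj_ray]
        exact MetricModel.ray_ne_vert ht w)
  act :=
    { vadd := fun k p => ULift.up (k +ᵥ p.down)
      zero_vadd := fun p => ULift.ext _ _ (zero_vadd G p.down)
      add_vadd := fun k l p => ULift.ext _ _ (add_vadd k l p.down) }
  map p := F.model.toFun ((F.cProj A g').realize p.down)
  degree p := Nat.card (S.dilation (F.model.toFun ((F.cProj A g').realize p.down)))
  harmonic := by
    refine ⟨toCurveModel _ _ _ _, F.model, F.cProj A g', fun p => rfl, fun w => ?_,
      fun h t t0 t1 => ?_⟩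
    · change Nat.card (S.dilation (F.model.vert ((F.cProj A g').mapV w))) = _
      rw [← F.datum_vert]
      rfl
    · exact F.card_dilation_cProj A g' h ⟨t0, t1⟩
  edist_vadd := by
    -- The action carries segments to segments of equal length, so it does not increase the path
    -- metric; the inverse element gives equality.
    have key : ∀ (k : G) (p q : (F.cGraph A g').Realization),
        (F.cGraph A g').pathEDist (k +ᵥ p) (k +ᵥ q) ≤ (F.cGraph A g').pathEDist p q := by
      intro k p q
      let _ : PseudoEMetricSpace (F.cGraph A g').Realization :=
        { edist := (F.cGraph A g').pathEDist
          edist_self := fun p => pathEDist_self _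
          edist_comm := fun p q => pathEDist_comm _ _
          edist_triangle := fun p q r => pathEDist_triangle _ _ _ }
      refine le_pathEDist (fun p => k +ᵥ p) (fun h s t => ?_) p q
      obtain ⟨h, g, rfl⟩ := exists_coverHalf _ _ _ h
      rw [pt_eq_ray, pt_eq_ray, vadd_ray, vadd_ray]
      exact pathEDist_ray_le _ _ _
    intro k p q
    refine le_antisymm (key k p.down q.down) ?_
    have h1 := key (-k) (k +ᵥ p.down) (k +ᵥ q.down)
    rwa [neg_vadd_vadd, neg_vadd_vadd] at h1
  genus_vadd k p := congrArg (fun q => g' (F.model.toFun q)) (coverProj_vadd k p.down)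
  map_vadd k p := congrArg F.model.toFun (coverProj_vadd k p.down)
  degree_vadd k p := congrArg (fun q => Nat.card (S.dilation (F.model.toFun q)))
    (coverProj_vadd k p.down)
  transitive p q hpq := by
    obtain ⟨k, hk⟩ := coverProj_transitive p.down q.down (F.model.bijective.1 hpq)
    exact ⟨k, ULift.ext _ _ hk⟩
  degree_eq x := by
    obtain ⟨p, rfl⟩ := F.model.bijective.2 x
    obtain ⟨p, rfl⟩ := coverProj_surjective (D := F.datum) (A := A)
      (g' := fun w => g' (F.model.vert w)) p
    let _ : AddAction G (ULift.{u} (F.cGraph A g').Realization) :=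
      { vadd := fun k p => ULift.up (k +ᵥ p.down)
        zero_vadd := fun p => ULift.ext _ _ (zero_vadd G p.down)
        add_vadd := fun k l p => ULift.ext _ _ (add_vadd k l p.down) }
    -- The fibre is an orbit and the degree is the order of the stabilizer, so the degree sum is
    -- given by the orbit-stabilizer formula.
    rw [← GCover.finsum_orbit_card_stabilizer (G := G) (ULift.up.{u} p)]
    refine finsum_mem_congr ?_ ?_
    · ext q
      constructor
      · intro hq
        obtain ⟨k, hk⟩ := coverProj_transitive p q.down (F.model.bijective.1 hq.symm)
        exact ⟨k, ULift.ext _ _ hk⟩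
      · rintro ⟨k, rfl⟩
        exact congrArg F.model.toFun (coverProj_vadd k p)
    · rintro q ⟨k, rfl⟩
      have h1 : AddAction.stabilizer G (ULift.up.{u} p) = AddAction.stabilizer G p := by
        ext l
        rw [AddAction.mem_stabilizer_iff, AddAction.mem_stabilizer_iff]
        exact ⟨fun h => congrArg ULift.down h, fun h => ULift.ext _ _ h⟩
      rw [h1, ← dilation_cProj]
      exact congrArg (fun q => Nat.card (S.dilation (F.model.toFun q))) (coverProj_vadd k p)

theorem cover_hasStratification : (F.cover A g' hg).HasStratification S := by
  refine GCover.hasStratification_of_dilation _ fun y => ?_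
  refine (F.dilation_cProj A g' y.down).trans ?_
  ext l
  rw [AddAction.mem_stabilizer_iff, AddAction.mem_stabilizer_iff]
  exact ⟨fun h => ULift.ext _ _ h, fun h => congrArg ULift.down h⟩

theorem cover_genus (y : (F.cover A g' hg).total) :
    (F.cover A g' hg).total.genus y = g' ((F.cover A g' hg).map y) := rfl

end GStratification.FramedModel

namespace GStratification.FramedModel

open WeightedMetricGraph

variable {G : Type v} [AddCommGroup G] [Finite G] {X : TropicalCurve.{u}}
  {S : GStratification G X} (F : S.FramedModel)

/-- Every class and every genus function supported on the vertices is realized by a cover. -/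
theorem exists_cover (g' : X → ℕ) (hg : ∀ x, (∀ w, x ≠ F.model.vert w) → g' x = 0) (c : F.H1) :
    ∃ τ : GCover G X, τ.HasStratification S ∧ τ.HasClass F c ∧
      ∀ y, τ.total.genus y = g' (τ.map y) := by
  classical
  obtain ⟨η, rfl⟩ := QuotientAddGroup.mk_surjective c
  have hA : ∀ e, ∃ a : G, (QuotientAddGroup.mk a : G ⧸ F.datum.C F.orientation e) = η e :=
    fun e => QuotientAddGroup.mk_surjective _
  choose a ha using hA
  -- Only the selected half-edge of each edge is shifted, by a representative of the cocycle. The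
  -- tautological lift of the edge then starts at `a e` and ends at `0`, so its cochain is `a e -
  -- 0`.
  let A : F.model.graph.Shift G :=
    { val := fun x => if hx : x ∈ F.orientation.edges then a ⟨x, hx⟩ else 0
      vertex := fun x hx => dif_neg fun h => (F.orientation.isEdge x h).1 hx }
  refine ⟨F.cover A g' hg, F.cover_hasStratification A g' hg, ⟨η,
    (GCover.hasCochain_iff (F.cover_hasStratification A g' hg)).2 ?_, rfl⟩,
    F.cover_genus A g' hg⟩
  let N : (F.cover A g' hg).total.Model := toCurveModel _ _ _ _
  have hdiv : ∀ (h : F.model.graph.H) (t : ℝ),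
      (Nat.card (F.datum.D h.1) : ℝ) * (t / Nat.card (F.datum.D h.1)) = t := fun h t =>
    mul_div_cancel₀ _ (card_pos_real _).ne'
  refine ⟨fun w => ULift.up ((F.cGraph A g').vert (coverVert _ _ _ w 0)),
    -- The parameter is divided by `#D(h)` because half-edges upstairs are shorter by this factor.
    fun h t => ULift.up ((F.cGraph A g').ray (coverHalf _ _ _ h 0) (t / Nat.card (F.datum.D h.1))),
    fun h => A.val h.1, fun _ => 0,
    ⟨fun w => congrArg F.model.toFun (coverProj_vert w 0), fun h _ => ?_, fun h _ t _ => ?_,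
      fun h _ => ?_, fun h ho => ?_⟩, fun e => ?_⟩
  · have h1 : Continuous (N.ray (coverHalf F.datum A (fun w => g' (F.model.vert w)) h 0)) := MetricModel.continuous_ray _
    exact (h1.comp (by fun_prop : Continuous fun t : ℝ =>
      t / (Nat.card (F.datum.D h.1) : ℝ))).continuousOn
  · refine congrArg F.model.toFun ((coverProj_ray h 0 _).trans ?_)
    rw [hdiv]
  · refine ULift.ext _ _ ?_
    change (F.cGraph A g').ray (coverHalf _ _ _ h 0) (0 / _) = A.val h.1 +ᵥ
      (F.cGraph A g').vert (coverVert _ _ _ _ 0)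
    rw [zero_div, ray_zero, vadd_vert]
    refine congrArg (F.cGraph A g').vert (Subtype.ext ?_)
    refine (cover_r_mk F.datum A h.1 0).trans ?_
    rw [zero_add]
    exact congrArg (DilationDatum.CoverPt.mk _) (add_zero _).symm
  · have he := F.orientation.isEdge _ ho
    refine ULift.ext _ _ ?_
    change (F.cGraph A g').ray (coverHalf _ _ _ h 0) _ = (0 : G) +ᵥ
      (F.cGraph A g').vert (coverVert _ _ _ _ 0)
    rw [← coverHalf_length (A := A) (g' := fun w => g' (F.model.vert w)) h 0,
      ray_length ((coverHalf_isEdge h 0).2 he), zero_vadd]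
    refine congrArg (F.cGraph A g').vert (Subtype.ext ?_)
    change (coverLegGraph F.datum A).r ((coverLegGraph F.datum A).ι
      (DilationDatum.CoverPt.mk h.1 0)) = _
    rw [cover_ι_mk, cover_r_mk]
    have h1 : A.val (F.model.graph.ι h.1) = 0 :=
      dif_neg ((F.orientation.mem_iff _ he).1 ho)
    rw [h1, add_zero]
    rfl
  · have h1 : A.val (F.orientation.half e).1 = a e := dif_pos e.2
    change η e = QuotientAddGroup.mk (A.val (F.orientation.half e).1 - 0)
    rw [h1, sub_zero, ha]

end GStratification.FramedModel

/-! ### Subdividing an edge or a leg -/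

namespace WeightedMetricGraph

/-- The new elements after inserting a vertex: the vertex and its two half-edges. -/
inductive Inserted
  | vertex
  | back
  | forth

instance : Finite Inserted :=
  Finite.of_surjective
    (fun i : Option Bool => match i with
      | none => Inserted.vertex
      | some true => Inserted.back
      | some false => Inserted.forth)
    (by
      rintro (_ | _ | _)
      · exact ⟨none, rfl⟩
      · exact ⟨some true, rfl⟩
      · exact ⟨some false, rfl⟩)

open Inserted

variable (Γ : WeightedMetricGraph) (k : Γ.H) (a : ℝ) (ha : Γ.IsInner k a)

theorem r_ne (x : Γ.X) : Γ.r x ≠ k.1 := fun h => k.2 (by rw [← h, Γ.r_r])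

theorem r_ne_ι (x : Γ.X) : Γ.r x ≠ Γ.ι k.1 := fun h => Γ.isHalfEdge_ι k.2 (by rw [← h, Γ.r_r])

open Classical in
/-- The graph with a new vertex on the half-edge `k`. -/
noncomputable abbrev splitLegGraph : LegGraph where
  X := Γ.X ⊕ Inserted
  r x := match x with
    | Sum.inl x => Sum.inl (Γ.r x)
    | Sum.inr _ => Sum.inr vertex
  -- The old half-edge `k` now ends at the new vertex and is paired with `back`; the old opposite
  -- half-edge is paired with `forth`. If `k` is a leg, then `forth` takes over as the leg.
  ι x := match x with
    | Sum.inl x => if x = k.1 then Sum.inr back else if x = Γ.ι k.1 then Sum.inr forth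
        else Sum.inl (Γ.ι x)
    | Sum.inr vertex => Sum.inr vertex
    | Sum.inr back => Sum.inl k.1
    | Sum.inr forth => if Γ.ι k.1 = k.1 then Sum.inr forth else Sum.inl (Γ.ι k.1)
  r_r x := by
    rcases x with x | _
    · simp only [Γ.r_r]
    · rfl
  ι_ι x := by
    rcases x with x | (_ | _ | _)
    · by_cases h1 : x = k.1
      · simp [h1]
      · by_cases h2 : x = Γ.ι k.1
        · have h3 : Γ.ι k.1 ≠ k.1 := fun h => h1 (h2.trans h)
          simp [h2, h3]
        · have h3 : Γ.ι x ≠ k.1 := fun h => h2 (by rw [← h, Γ.ι_ι])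
          have h4 : Γ.ι x ≠ Γ.ι k.1 := fun h => h1 (by
            have := congrArg Γ.ι h
            rwa [Γ.ι_ι, Γ.ι_ι] at this)
          simp [h1, h2, h3, h4, Γ.ι_ι]
    · rfl
    · simp
    · by_cases h1 : Γ.ι k.1 = k.1
      · simp [h1]
      · simp [h1]
  ι_r x := by
    rcases x with x | _
    · simp [Γ.r_ne k, Γ.r_ne_ι k, Γ.ι_r]
    · rfl

theorem split_isHalfEdge_inl {x : Γ.X} :
    (Γ.splitLegGraph k).IsHalfEdge (Sum.inl x) ↔ Γ.IsHalfEdge x := by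
  simp [LegGraph.IsHalfEdge]

theorem split_isVertex_inl {x : Γ.X} :
    (Γ.splitLegGraph k).IsVertex (Sum.inl x) ↔ Γ.IsVertex x := by
  simp [LegGraph.IsVertex]

theorem split_isEdge_inl {x : Γ.X} :
    (Γ.splitLegGraph k).IsEdge (Sum.inl x) ↔ x = k.1 ∨ Γ.IsEdge x := by
  unfold LegGraph.IsEdge
  rw [split_isHalfEdge_inl]
  by_cases h1 : x = k.1
  · subst h1
    simp [k.2]
  · by_cases h2 : x = Γ.ι k.1
    · have h3 : Γ.ι k.1 ≠ k.1 := fun h => h1 (h2.trans h)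
      subst h2
      simp [h3, h3.symm, Γ.ι_ι]
    · simp [h1, h2]

theorem split_isHalfEdge_back : (Γ.splitLegGraph k).IsHalfEdge (Sum.inr back) := by
  simp [LegGraph.IsHalfEdge]

theorem split_isHalfEdge_forth : (Γ.splitLegGraph k).IsHalfEdge (Sum.inr forth) := by
  simp [LegGraph.IsHalfEdge]

theorem split_isVertex_mid : (Γ.splitLegGraph k).IsVertex (Sum.inr vertex) := rfl

theorem split_isEdge_back : (Γ.splitLegGraph k).IsEdge (Sum.inr back) :=
  ⟨Γ.split_isHalfEdge_back k, by simp⟩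

theorem split_isEdge_forth :
    (Γ.splitLegGraph k).IsEdge (Sum.inr forth) ↔ Γ.IsEdge k.1 := by
  unfold LegGraph.IsEdge
  by_cases h1 : Γ.ι k.1 = k.1
  · simp [h1]
  · simp [h1, Γ.split_isHalfEdge_forth k, k.2]

theorem isEdge_of_ι {x : Γ.X} (hx : Γ.ι k.1 = x) (h : x ≠ k.1) : Γ.IsEdge k.1 :=
  ⟨k.2, by rw [hx]; exact h⟩

variable {k a}

open Classical in
/-- The weighted metric graph with a new vertex at the point with parameter `a` on `k`. -/
noncomputable abbrev split : WeightedMetricGraph where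
  toLegGraph := Γ.splitLegGraph k
  genus w := match w with
    | ⟨Sum.inl x, hx⟩ => Γ.genus ⟨x, (Γ.split_isVertex_inl k).1 hx⟩
    | ⟨Sum.inr _, _⟩ => 0
  length x := match x with
    | Sum.inl x => if x = k.1 then a else if x = Γ.ι k.1 then Γ.length k.1 - a else Γ.length x
    | Sum.inr vertex => 0
    | Sum.inr back => a
    | Sum.inr forth => Γ.length k.1 - a
  length_pos x hx := by
    rcases x with x | (_ | _ | _)
    · rw [split_isEdge_inl] at hx
      dsimp only
      split_ifs with h1 h2
      · exact ha.1
      · exact sub_pos.2 (ha.2 (Γ.isEdge_of_ι k h2.symm h1))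
      · exact Γ.length_pos _ (hx.resolve_left h1)
    · exact absurd (Γ.split_isVertex_mid k) hx.1
    · exact ha.1
    · exact sub_pos.2 (ha.2 ((Γ.split_isEdge_forth k).1 hx))
  length_ι x hx := by
    rcases x with x | (_ | _ | _)
    · rw [split_isEdge_inl] at hx
      by_cases h1 : x = k.1
      · simp [h1]
      · by_cases h2 : x = Γ.ι k.1
        · have h3 : Γ.ι k.1 ≠ k.1 := fun h => h1 (h2.trans h)
          simp [h2, h3]
        · have h3 : Γ.ι x ≠ k.1 := fun h => h2 (by rw [← h, Γ.ι_ι])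
          have h4 : Γ.ι x ≠ Γ.ι k.1 := fun h => h1 (by
            have := congrArg Γ.ι h
            rwa [Γ.ι_ι, Γ.ι_ι] at this)
          simp only [h1, h2, h3, h4, if_false]
          exact Γ.length_ι _ (hx.resolve_left h1)
    · exact absurd (Γ.split_isVertex_mid k) hx.1
    · simp
    · have h1 := ((Γ.split_isEdge_forth k).1 hx).2
      simp [h1]

/-- The half-edge containing a half-edge of the subdivided graph. -/
def splitPar (h : (Γ.split ha).H) : Γ.H := match h with
  | ⟨Sum.inl x, hx⟩ => ⟨x, (Γ.split_isHalfEdge_inl k).1 hx⟩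
  | ⟨Sum.inr _, _⟩ => k

/-- The change of parameters. -/
def splitAff (h : (Γ.split ha).H) (t : ℝ) : ℝ := match h with
  | ⟨Sum.inl _, _⟩ => t
  | ⟨Sum.inr vertex, _⟩ => a
  | ⟨Sum.inr back, _⟩ => a - t
  | ⟨Sum.inr forth, _⟩ => a + t

/-- The old half-edge `x`. -/
abbrev splitInl (x : Γ.H) : (Γ.split ha).H := ⟨Sum.inl x.1, (Γ.split_isHalfEdge_inl k).2 x.2⟩

/-- The new half-edge towards the root of `k`. -/
abbrev splitBack : (Γ.split ha).H := ⟨Sum.inr back, Γ.split_isHalfEdge_back k⟩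

/-- The new half-edge pointing away from the root of `k`. -/
abbrev splitForth : (Γ.split ha).H := ⟨Sum.inr forth, Γ.split_isHalfEdge_forth k⟩

/-- The new vertex. -/
abbrev splitMid : (Γ.split ha).V := ⟨Sum.inr vertex, Γ.split_isVertex_mid k⟩

/-- An old vertex. -/
abbrev splitVert (w : Γ.V) : (Γ.split ha).V := ⟨Sum.inl w.1, (Γ.split_isVertex_inl k).2 w.2⟩

variable {Γ} {ha}

theorem split_cases_H (h : (Γ.split ha).H) :
    (∃ x, h = Γ.splitInl ha x) ∨ h = Γ.splitBack ha ∨ h = Γ.splitForth ha := by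
  obtain ⟨x | (_ | _ | _), hx⟩ := h
  · exact Or.inl ⟨⟨x, (Γ.split_isHalfEdge_inl k).1 hx⟩, rfl⟩
  · exact absurd (Γ.split_isVertex_mid k) hx
  · exact Or.inr (Or.inl rfl)
  · exact Or.inr (Or.inr rfl)

theorem split_cases_V (w : (Γ.split ha).V) :
    (∃ x, w = Γ.splitVert ha x) ∨ w = Γ.splitMid ha := by
  obtain ⟨x | (_ | _ | _), hx⟩ := w
  · exact Or.inl ⟨⟨x, (Γ.split_isVertex_inl k).1 hx⟩, rfl⟩
  · exact Or.inr rfl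
  · exact absurd hx (Γ.split_isHalfEdge_back k)
  · exact absurd hx (Γ.split_isHalfEdge_forth k)

theorem split_flip_k : (Γ.split ha).flip (Γ.splitInl ha k) = Γ.splitBack ha :=
  Subtype.ext (if_pos rfl)

theorem split_flip_back : (Γ.split ha).flip (Γ.splitBack ha) = Γ.splitInl ha k := rfl

theorem split_flip_ι (he : Γ.IsEdge k.1) :
    (Γ.split ha).flip (Γ.splitInl ha (Γ.flip k)) = Γ.splitForth ha :=
  Subtype.ext ((if_neg he.2).trans (if_pos rfl))

theorem split_flip_forth (he : Γ.IsEdge k.1) :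
    (Γ.split ha).flip (Γ.splitForth ha) = Γ.splitInl ha (Γ.flip k) :=
  Subtype.ext (if_neg he.2)

theorem split_flip_inl {x : Γ.H} (h1 : x ≠ k) (h2 : x ≠ Γ.flip k) :
    (Γ.split ha).flip (Γ.splitInl ha x) = Γ.splitInl ha (Γ.flip x) :=
  Subtype.ext ((if_neg fun h => h1 (Subtype.ext h)).trans (if_neg fun h => h2 (Subtype.ext h)))

theorem split_length_k : (Γ.split ha).length (Γ.splitInl ha k).1 = a := if_pos rfl

theorem split_length_ι (he : Γ.IsEdge k.1) :
    (Γ.split ha).length (Γ.splitInl ha (Γ.flip k)).1 = Γ.length k.1 - a :=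
  (if_neg he.2).trans (if_pos rfl)

theorem split_length_inl {x : Γ.H} (h1 : x ≠ k) (h2 : x ≠ Γ.flip k) :
    (Γ.split ha).length (Γ.splitInl ha x).1 = Γ.length x.1 :=
  (if_neg fun h => h1 (Subtype.ext h)).trans (if_neg fun h => h2 (Subtype.ext h))

theorem split_edge_inl {x : Γ.H} (h1 : x ≠ k) :
    (Γ.split ha).IsEdge (Γ.splitInl ha x).1 ↔ Γ.IsEdge x.1 :=
  (Γ.split_isEdge_inl k).trans (or_iff_right fun h => h1 (Subtype.ext h))

theorem split_edge_k : (Γ.split ha).IsEdge (Γ.splitInl ha k).1 :=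
  (Γ.split_isEdge_inl k).2 (Or.inl rfl)

theorem splitPar_inl (x : Γ.H) : Γ.splitPar ha (Γ.splitInl ha x) = x := rfl

theorem splitAff_inl (x : Γ.H) (t : ℝ) : Γ.splitAff ha (Γ.splitInl ha x) t = t := rfl

theorem splitAff_mem (h : (Γ.split ha).H) {t : ℝ} (ht : t ∈ (Γ.split ha).Param h) :
    Γ.splitAff ha h t ∈ Γ.Param (Γ.splitPar ha h) := by
  rcases split_cases_H h with ⟨x, rfl⟩ | rfl | rfl
  · rw [splitPar_inl, splitAff_inl]
    by_cases h1 : x = k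
    · subst h1
      have h3 := ht.2 split_edge_k
      rw [split_length_k] at h3
      exact ⟨ht.1, fun he => h3.trans (ha.2 he).le⟩
    · refine ⟨ht.1, fun he => ?_⟩
      have h3 := ht.2 ((split_edge_inl h1).2 he)
      by_cases h2 : x = Γ.flip k
      · subst h2
        have hk : Γ.IsEdge k.1 := by
          have := isEdge_flip he
          rwa [flip_flip] at this
        rw [split_length_ι hk] at h3
        rw [length_flip hk]
        linarith [ha.1]
      · rwa [split_length_inl h1 h2] at h3
  · have h3 : t ≤ a := ht.2 (Γ.split_isEdge_back k)
    exact ⟨sub_nonneg.2 h3, fun he => by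
      have h4 : a < Γ.length k.1 := ha.2 he
      change a - t ≤ Γ.length k.1
      linarith [ht.1]⟩
  · refine ⟨add_nonneg ha.1.le ht.1, fun he => ?_⟩
    have h3 : t ≤ Γ.length k.1 - a := ht.2 ((Γ.split_isEdge_forth k).2 he)
    change a + t ≤ _
    have : Γ.splitPar ha (Γ.splitForth ha) = k := rfl
    rw [this]
    linarith

theorem splitAff_inner (h : (Γ.split ha).H) {t : ℝ} (ht : (Γ.split ha).IsInner h t) :
    Γ.IsInner (Γ.splitPar ha h) (Γ.splitAff ha h t) := by
  have h0 := splitAff_mem h ht.mem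
  rcases split_cases_H h with ⟨x, rfl⟩ | rfl | rfl
  · refine ⟨ht.1, fun he => ?_⟩
    rw [splitPar_inl] at he
    rw [splitPar_inl, splitAff_inl]
    by_cases h1 : x = k
    · subst h1
      have h3 := ht.2 split_edge_k
      rw [split_length_k] at h3
      exact h3.trans (ha.2 he)
    · have h3 := ht.2 ((split_edge_inl h1).2 he)
      by_cases h2 : x = Γ.flip k
      · subst h2
        have hk : Γ.IsEdge k.1 := by
          have := isEdge_flip he
          rwa [flip_flip] at this
        rw [split_length_ι hk] at h3
        rw [length_flip hk]
        linarith [ha.1]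
      · rwa [split_length_inl h1 h2] at h3
  · have h3 : t < a := ht.2 (Γ.split_isEdge_back k)
    exact ⟨sub_pos.2 h3, fun he => by
      change a - t < _
      exact lt_trans (by linarith [ht.1]) (ha.2 he)⟩
  · refine ⟨add_pos ha.1 ht.1, fun he => ?_⟩
    have h3 : t < Γ.length k.1 - a := ht.2 ((Γ.split_isEdge_forth k).2 he)
    change a + t < Γ.length k.1
    linarith

variable (Γ ha) in
/-- The map of realizations from the subdivided graph. -/
noncomputable def unsplit : (Γ.split ha).Realization → Γ.Realization :=
  Quot.lift
    (fun p => match p with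
      | Sum.inl ⟨Sum.inl x, hx⟩ => Γ.vert ⟨x, (Γ.split_isVertex_inl k).1 hx⟩
      | Sum.inl ⟨Sum.inr _, _⟩ => Γ.ray k a
      | Sum.inr ⟨h, t⟩ => Γ.ray (Γ.splitPar ha h) (Γ.splitAff ha h t.1))
    (by
      rintro _ _ (⟨h⟩ | ⟨h, he, t, ht⟩)
      · rcases split_cases_H h with ⟨x, rfl⟩ | rfl | rfl
        · exact ray_zero x
        · change Γ.ray k (a - 0) = Γ.ray k a
          rw [sub_zero]
        · change Γ.ray k (a + 0) = Γ.ray k a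
          rw [add_zero]
      · change Γ.ray (Γ.splitPar ha h) (Γ.splitAff ha h t) =
          Γ.ray (Γ.splitPar ha ((Γ.split ha).flip h))
            (Γ.splitAff ha ((Γ.split ha).flip h) ((Γ.split ha).length h.1 - t))
        rcases split_cases_H h with ⟨x, rfl⟩ | rfl | rfl
        · rw [splitPar_inl, splitAff_inl]
          by_cases h1 : x = k
          · subst h1
            rw [split_flip_k, split_length_k]
            change _ = Γ.ray x (a - (a - t))
            rw [sub_sub_cancel]
          · have he' := (split_edge_inl h1).1 he
            by_cases h2 : x = Γ.flip k
            · subst h2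
              have hk : Γ.IsEdge k.1 := by
                have := isEdge_flip he'
                rwa [flip_flip] at this
              rw [split_flip_ι hk, split_length_ι hk]
              change _ = Γ.ray k (a + (Γ.length k.1 - a - t))
              rw [ray_flip' hk]
              congr 1
              ring
            · rw [split_flip_inl h1 h2, split_length_inl h1 h2, splitPar_inl, splitAff_inl,
                ray_flip he']
        · rw [split_flip_back]
          rfl
        · have hk := (Γ.split_isEdge_forth k).1 he
          rw [split_flip_forth hk, splitPar_inl, splitAff_inl]
          change Γ.ray k (a + t) = Γ.ray (Γ.flip k) (Γ.length k.1 - a - t)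
          rw [ray_flip' hk]
          congr 1
          ring)

theorem unsplit_ray (h : (Γ.split ha).H) {t : ℝ} (ht : t ∈ (Γ.split ha).Param h) :
    Γ.unsplit ha ((Γ.split ha).ray h t) = Γ.ray (Γ.splitPar ha h) (Γ.splitAff ha h t) := by
  rw [ray_of_mem ht]
  rfl

theorem unsplit_mid : Γ.unsplit ha ((Γ.split ha).vert (Γ.splitMid ha)) = Γ.ray k a := rfl

theorem split_ray_k_a : (Γ.split ha).ray (Γ.splitInl ha k) a =
    (Γ.split ha).vert (Γ.splitMid ha) := by
  have h1 := ray_length (Γ := Γ.split ha) (h := Γ.splitInl ha k) split_edge_k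
  rw [split_length_k] at h1
  rw [h1]
  congr 1
  have h2 := congrArg (fun h : (Γ.split ha).H => (Γ.split ha).root h.1) (split_flip_k (ha := ha))
  exact h2

theorem split_ray_forth_zero : (Γ.split ha).ray (Γ.splitForth ha) 0 =
    (Γ.split ha).vert (Γ.splitMid ha) := ray_zero _

variable (Γ ha) in
open Classical in
/-- The interval of `k` in the subdivided graph. -/
noncomputable def splitPath (t : ℝ) : (Γ.split ha).Realization :=
  if t ≤ a then (Γ.split ha).ray (Γ.splitInl ha k) t
    else (Γ.split ha).ray (Γ.splitForth ha) (t - a)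

theorem splitPath_of_ge {t : ℝ} (ht : a ≤ t) :
    Γ.splitPath ha t = (Γ.split ha).ray (Γ.splitForth ha) (t - a) := by
  unfold splitPath
  split_ifs with h1
  · obtain rfl := le_antisymm h1 ht
    rw [split_ray_k_a, sub_self, split_ray_forth_zero]
  · rfl

theorem splitPath_of_le {t : ℝ} (ht : t ≤ a) :
    Γ.splitPath ha t = (Γ.split ha).ray (Γ.splitInl ha k) t := if_pos ht

/-- Only a segment crossing the new vertex needs an argument: it is cut at parameter `a`, and the
two lengths add up. -/
theorem pathEDist_splitPath_le (s t : ℝ) : (Γ.split ha).pathEDist (Γ.splitPath ha s)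
    (Γ.splitPath ha t) ≤ ENNReal.ofReal |s - t| := by
  wlog hst : s ≤ t generalizing s t
  · rw [pathEDist_comm, abs_sub_comm]
    exact this t s (not_le.1 hst).le
  rcases le_total t a with h1 | h1
  · rw [splitPath_of_le h1, splitPath_of_le (hst.trans h1)]
    exact pathEDist_ray_le _ _ _
  · rcases le_total s a with h2 | h2
    · refine (pathEDist_triangle _ (Γ.splitPath ha a) _).trans ?_
      rw [splitPath_of_ge h1, splitPath_of_le h2]
      have h3 := pathEDist_ray_le (Γ.splitInl ha k) s a
      have h4 := pathEDist_ray_le (Γ.splitForth ha) (a - a) (t - a)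
      rw [← splitPath_of_le (ha := ha) (le_refl a)] at h3
      rw [← splitPath_of_ge (ha := ha) (le_refl a)] at h4
      refine (add_le_add h3 h4).trans ?_
      rw [← ENNReal.ofReal_add (abs_nonneg _) (abs_nonneg _)]
      refine ENNReal.ofReal_le_ofReal ?_
      rw [abs_of_nonpos (by linarith), abs_of_nonpos (by linarith), abs_of_nonpos (by linarith)]
      linarith
    · rw [splitPath_of_ge h1, splitPath_of_ge h2]
      have h4 := pathEDist_ray_le (Γ.splitForth ha) (s - a) (t - a)
      rwa [sub_sub_sub_cancel_right] at h4

variable (Γ ha) in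
open Classical in
/-- The image of a ray in the subdivided graph. -/
noncomputable def resplitRay (h : Γ.H) (t : ℝ) : (Γ.split ha).Realization :=
  if h = k then Γ.splitPath ha t
    else if h = Γ.flip k then Γ.splitPath ha (Γ.length k.1 - t)
    else (Γ.split ha).ray (Γ.splitInl ha h) t

theorem edge_of_flip_ne {h : Γ.H} (h1 : h ≠ k) (h2 : h = Γ.flip k) : Γ.IsEdge k.1 :=
  ⟨k.2, fun h3 => h1 (h2.trans (Subtype.ext h3))⟩

variable (Γ ha) in
/-- The map of realizations to the subdivided graph. -/
noncomputable def resplit : Γ.Realization → (Γ.split ha).Realization :=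
  Quot.lift
    (fun p => match p with
      | Sum.inl w => (Γ.split ha).vert (Γ.splitVert ha w)
      | Sum.inr ⟨h, t⟩ => Γ.resplitRay ha h t.1)
    (by
      rintro _ _ (⟨h⟩ | ⟨h, he, t, ht⟩)
      · change Γ.resplitRay ha h 0 = (Γ.split ha).vert (Γ.splitVert ha (Γ.root h.1))
        unfold resplitRay
        split_ifs with h1 h2
        · subst h1
          rw [splitPath_of_le ha.1.le, ray_zero]
          rfl
        · have hk := edge_of_flip_ne h1 h2
          have h3 := ray_length (Γ := Γ.split ha) (h := Γ.splitForth ha)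
            ((Γ.split_isEdge_forth k).2 hk)
          rw [sub_zero, splitPath_of_ge (ha.2 hk).le]
          refine h3.trans (congrArg (Γ.split ha).vert ?_)
          have h4 := congrArg (fun h : (Γ.split ha).H => (Γ.split ha).root h.1)
            (split_flip_forth (ha := ha) hk)
          rw [h2]
          exact h4
        · rw [ray_zero]
          rfl
      · change Γ.resplitRay ha h t = Γ.resplitRay ha (Γ.flip h) (Γ.length h.1 - t)
        by_cases h1 : h = k
        · subst h1
          unfold resplitRay
          rw [if_pos rfl, if_neg (flip_ne he), if_pos rfl, sub_sub_cancel]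
        · by_cases h2 : h = Γ.flip k
          · have hk := edge_of_flip_ne h1 h2
            subst h2
            unfold resplitRay
            rw [if_neg h1, if_pos rfl, flip_flip, if_pos rfl, length_flip hk]
          · have h3 : Γ.flip h ≠ k := fun h3 => h2 (by rw [← h3, flip_flip])
            have h4 : Γ.flip h ≠ Γ.flip k := fun h4 => h1 (by
              have := congrArg Γ.flip h4
              rwa [flip_flip, flip_flip] at this)
            unfold resplitRay
            rw [if_neg h1, if_neg h2, if_neg h3, if_neg h4,
              ← ray_flip ((split_edge_inl h1).2 he) t, split_flip_inl h1 h2,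
              split_length_inl h1 h2])

theorem resplit_ray (h : Γ.H) {t : ℝ} (ht : t ∈ Γ.Param h) :
    Γ.resplit ha (Γ.ray h t) = Γ.resplitRay ha h t := by
  rw [ray_of_mem ht]
  rfl

theorem resplit_unsplit (p : (Γ.split ha).Realization) : Γ.resplit ha (Γ.unsplit ha p) = p := by
  rcases exists_rep p with ⟨w, rfl⟩ | ⟨h, t, ht, rfl⟩
  · rcases split_cases_V w with ⟨w, rfl⟩ | rfl
    · rfl
    · rw [unsplit_mid, resplit_ray k ha.mem]
      unfold resplitRay
      rw [if_pos rfl, splitPath_of_le le_rfl, split_ray_k_a]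
  · rw [unsplit_ray h ht.mem, resplit_ray _ (splitAff_mem h ht.mem)]
    rcases split_cases_H h with ⟨x, rfl⟩ | rfl | rfl
    · rw [splitPar_inl, splitAff_inl]
      unfold resplitRay
      split_ifs with h1 h2
      · subst h1
        have h3 := ht.2 split_edge_k
        rw [split_length_k] at h3
        exact splitPath_of_le h3.le
      · have hk := edge_of_flip_ne h1 h2
        subst h2
        have hE : (Γ.split ha).IsEdge (Γ.splitInl ha (Γ.flip k)).1 :=
          (split_edge_inl h1).2 (isEdge_flip hk)
        have h3 := ht.2 hE
        rw [split_length_ι hk] at h3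
        rw [splitPath_of_ge (by linarith), ← ray_flip hE t, split_flip_ι hk, split_length_ι hk]
        congr 1
        ring
      · rfl
    · have h3 : t < a := ht.2 (Γ.split_isEdge_back k)
      have h4 : Γ.resplitRay ha k (a - t) = Γ.splitPath ha (a - t) := if_pos rfl
      refine h4.trans ?_
      rw [splitPath_of_le (by linarith [ht.1])]
      have h5 := ray_flip (Γ := Γ.split ha) (h := Γ.splitBack ha) (Γ.split_isEdge_back k) t
      exact h5
    · have h4 : Γ.resplitRay ha k (a + t) = Γ.splitPath ha (a + t) := if_pos rfl
      refine h4.trans ?_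
      rw [splitPath_of_ge (by linarith [ht.1]), add_sub_cancel_left]

theorem unsplit_splitPath {t : ℝ} (ht : t ∈ Γ.Param k) :
    Γ.unsplit ha (Γ.splitPath ha t) = Γ.ray k t := by
  rcases le_total t a with h1 | h1
  · rw [splitPath_of_le h1, unsplit_ray]
    · rfl
    · exact ⟨ht.1, fun _ => by rw [split_length_k]; exact h1⟩
  · rw [splitPath_of_ge h1, unsplit_ray]
    · change Γ.ray k (a + (t - a)) = _
      rw [add_sub_cancel]
    · refine ⟨sub_nonneg.2 h1, fun he => ?_⟩
      have h2 := ht.2 ((Γ.split_isEdge_forth k).1 he)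
      change t - a ≤ Γ.length k.1 - a
      linarith

theorem unsplit_resplit (p : Γ.Realization) : Γ.unsplit ha (Γ.resplit ha p) = p := by
  rcases exists_rep p with ⟨w, rfl⟩ | ⟨h, t, ht, rfl⟩
  · rfl
  · rw [resplit_ray h ht.mem]
    unfold resplitRay
    split_ifs with h1 h2
    · subst h1
      exact unsplit_splitPath ht.mem
    · have hk := edge_of_flip_ne h1 h2
      subst h2
      rw [unsplit_splitPath, ← ray_flip' hk]
      have h3 := ht.flip (isEdge_flip hk)
      rw [flip_flip, length_flip hk] at h3
      exact h3.mem
    · rw [unsplit_ray]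
      · rfl
      · exact ⟨ht.1.le, fun he => by
          rw [split_length_inl h1 h2]
          exact (ht.2 ((split_edge_inl h1).1 he)).le⟩

/-- The path metric as a pseudometric. -/
noncomputable abbrev pathPseudoEMetric (Γ : WeightedMetricGraph) :
    PseudoEMetricSpace Γ.Realization where
  edist := Γ.pathEDist
  edist_self := pathEDist_self
  edist_comm := pathEDist_comm
  edist_triangle := pathEDist_triangle

theorem abs_splitAff_sub (h : (Γ.split ha).H) (s t : ℝ) :
    |Γ.splitAff ha h s - Γ.splitAff ha h t| = |s - t| := by
  rcases split_cases_H h with ⟨x, rfl⟩ | rfl | rfl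
  · rfl
  · change |a - s - (a - t)| = _
    rw [sub_sub_sub_cancel_left, abs_sub_comm]
  · change |a + s - (a + t)| = _
    rw [add_sub_add_left_eq_sub]

/-- Both `unsplit` and its inverse `resplit` are nonexpanding on segments, hence for the path
metrics. -/
theorem pathEDist_unsplit (p q : (Γ.split ha).Realization) :
    Γ.pathEDist (Γ.unsplit ha p) (Γ.unsplit ha q) = (Γ.split ha).pathEDist p q := by
  apply le_antisymm
  · let _ := Γ.pathPseudoEMetric
    refine le_pathEDist (Γ.unsplit ha) (fun h s t => ?_) p q
    rw [pt_eq_ray, pt_eq_ray, unsplit_ray h s.2, unsplit_ray h t.2, ← abs_splitAff_sub h]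
    exact pathEDist_ray_le _ _ _
  · let _ := (Γ.split ha).pathPseudoEMetric
    have h1 := le_pathEDist (Γ.resplit ha) (fun h s t => ?_) (Γ.unsplit ha p) (Γ.unsplit ha q)
    · rwa [resplit_unsplit, resplit_unsplit] at h1
    · rw [pt_eq_ray, pt_eq_ray, resplit_ray h s.2, resplit_ray h t.2]
      change (Γ.split ha).pathEDist _ _ ≤ _
      unfold resplitRay
      split_ifs
      · exact pathEDist_splitPath_le _ _
      · refine (pathEDist_splitPath_le _ _).trans (le_of_eq ?_)
        rw [sub_sub_sub_cancel_left, abs_sub_comm]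
      · exact pathEDist_ray_le _ _ _

end WeightedMetricGraph

/-! ### Refinements of models -/

namespace MetricModel

open WeightedMetricGraph

variable {X : Type u} [EMetricSpace X] {g : X → ℕ} {M : MetricModel X g}

/-- The model with a new vertex. -/
noncomputable def split (M : MetricModel X g) {k : M.graph.H} {a : ℝ} (ha : M.graph.IsInner k a) :
    MetricModel X g where
  graph := M.graph.split ha
  toFun p := M.toFun (M.graph.unsplit ha p)
  bijective := M.bijective.comp ⟨Function.LeftInverse.injective resplit_unsplit,
    Function.RightInverse.surjective unsplit_resplit⟩
  isometry p q := by rw [M.isometry, pathEDist_unsplit]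
  genus_vert w := by
    rcases split_cases_V w with ⟨w, rfl⟩ | rfl
    · exact M.genus_vert w
    · exact genus_ray ha
  genus_zero x hx := M.genus_zero x fun w hw => hx (M.graph.splitVert ha w) hw

/-- Every finite set of points consists of vertices of a refinement of the model. -/
theorem exists_refinement (M : MetricModel X g) {P : Set X} (hP : P.Finite) :
    ∃ N : MetricModel X g, (∀ x ∈ P, ∃ w, x = N.vert w) ∧
      ∀ A, M.Cellular A → N.Cellular A := by
  induction P, hP using Set.Finite.induction_on with
  | empty => exact ⟨M, fun x hx => absurd hx (Set.notMem_empty x), fun _ h => h⟩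
  | @insert x P _ _ ih =>
    obtain ⟨N, h1, h2⟩ := ih
    rcases exists_rep (M := N) x with ⟨w, rfl⟩ | ⟨k, a, ha, rfl⟩
    · refine ⟨N, ?_, h2⟩
      rintro y (rfl | hy)
      · exact ⟨w, rfl⟩
      · exact h1 y hy
    · refine ⟨N.split ha, ?_, fun A hA h t ht hm s => ?_⟩
      · rintro y (rfl | hy)
        · exact ⟨N.graph.splitMid ha, rfl⟩
        · obtain ⟨w, rfl⟩ := h1 y hy
          exact ⟨N.graph.splitVert ha w, rfl⟩
      · have h3 : ∀ s ∈ (N.graph.split ha).Param h, (N.split ha).ray h s =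
            N.ray (N.graph.splitPar ha h) (N.graph.splitAff ha h s) := fun s hs =>
          congrArg N.toFun (unsplit_ray h hs)
        rw [h3 t ht.mem] at hm
        -- The interior of a new cell is part of the interior of an old one, so a union of old cells
        -- is a union of new cells.
        have h4 := h2 A hA _ _ (splitAff_inner h ht) hm
          (N.graph.splitAff ha h ((N.graph.split ha).clamp h s))
        rw [← h3 _ (clamp_mem _ _ _)] at h4
        have h5 := ray_clamp (M := N.split ha) h s
        exact h5 ▸ h4

end MetricModel

namespace GStratification.FramedModel

variable {G : Type v} [AddCommGroup G] {X : TropicalCurve.{u}} {S : GStratification G X}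

theorem exists_refinement (F : S.FramedModel) {P : Set X} (hP : P.Finite) :
    ∃ F' : S.FramedModel, ∀ x ∈ P, ∃ w, x = F'.model.vert w := by
  obtain ⟨N, h1, h2⟩ := F.model.exists_refinement hP
  exact ⟨⟨N, fun H => (N.cellular_iff _).1 (h2 _ (F.cellular H)),
    N.graph.nonempty_orientation.some⟩, h1⟩

/-- Every class and every genus function with finite support is realized by a cover. -/
theorem exists_cover_of_finite [Finite G] (F : S.FramedModel) (c : F.H1) (g' : X → ℕ)
    (hg : (Function.support g').Finite) :
    ∃ τ : GCover G X, τ.HasStratification S ∧ τ.HasClass F c ∧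
      ∀ y, τ.total.genus y = g' (τ.map y) := by
  -- The support of `g'` may consist of vertices only after refining `F` to `F'`, while `c` lives in
  -- `F`. A cover `τ₀` of genus zero with class `c` tells which class in `F'` to realize with genus
  -- `g'`, and `HasClass.transfer` brings it back to `F`.
  obtain ⟨τ₀, s₀, c₀, -⟩ := F.exists_cover (fun _ => 0) (fun _ _ => rfl) c
  obtain ⟨F', hF'⟩ := F.exists_refinement hg
  obtain ⟨c', hc'⟩ := s₀.exists_hasClass F'
  obtain ⟨τ, s, h1, h2⟩ := F'.exists_cover g' (fun x hx => by
    by_contra h0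
    obtain ⟨w, hw⟩ := hF' x h0
    exact hx w hw) c'
  exact ⟨τ, s, GCover.HasClass.transfer s₀ s hc' h1 c₀, h2⟩

end GStratification.FramedModel

/-! ### The index function and the local Riemann-Hurwitz condition -/

/-- The sets partition the space into open pieces, so each is clopen and contains the components of
its points; being preconnected, it is a single component. -/
theorem Nat.card_connectedComponents_of_isOpen {Y R : Type*} [TopologicalSpace Y] (U : R → Set Y)
    (ho : ∀ r, IsOpen (U r)) (hn : ∀ r, (U r).Nonempty) (hp : ∀ r, IsPreconnected (U r))
    (hd : ∀ r s y, y ∈ U r → y ∈ U s → r = s) (hc : ∀ y, ∃ r, y ∈ U r) :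
    Nat.card (ConnectedComponents Y) = Nat.card R := by
  choose p hp' using hn
  have hclopen : ∀ r, IsClopen (U r) := fun r => by
    refine ⟨⟨?_⟩, ho r⟩
    have h1 : (U r)ᶜ = ⋃ s ∈ {s | s ≠ r}, U s := by
      ext y
      simp only [Set.mem_compl_iff, Set.mem_iUnion, Set.mem_ofPred_eq, exists_prop]
      constructor
      · intro hy
        obtain ⟨s, hs⟩ := hc y
        exact ⟨s, fun h => hy (h ▸ hs), hs⟩
      · rintro ⟨s, hs, hy⟩ hy'
        exact hs (hd _ _ y hy hy')
    rw [h1]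
    exact isOpen_biUnion fun s _ => ho s
  refine (Nat.card_eq_of_bijective
    (fun r => (ConnectedComponents.mk (p r) : ConnectedComponents Y)) ⟨fun r s h => ?_, fun q => ?_⟩).symm
  · have h1 := ConnectedComponents.coe_eq_coe.1 h
    have h2 : p s ∈ connectedComponent (p r) := h1 ▸ mem_connectedComponent
    exact hd _ _ (p s) ((hclopen r).connectedComponent_subset (hp' r) h2) (hp' s)
  · obtain ⟨y, rfl⟩ := ConnectedComponents.surjective_coe q
    obtain ⟨r, hr⟩ := hc y
    refine ⟨r, ConnectedComponents.coe_eq_coe.2 (connectedComponent_eq ?_).symm⟩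
    exact (hp r).subset_connectedComponent hr (hp' r)

theorem AddSubgroup.card_mul_relIndex {G : Type*} [AddGroup G] {H K : AddSubgroup G} (h : H ≤ K) :
    Nat.card H * H.relIndex K = Nat.card K := by
  rw [← AddSubgroup.relIndex_bot_left, ← AddSubgroup.relIndex_bot_left]
  exact AddSubgroup.relIndex_mul_relIndex _ _ _ bot_le h

namespace StarNhd

variable {G : Type v} [AddCommGroup G] [Finite G] {X : TropicalCurve.{u}}
  {S : GStratification G X} {x : X} {R : Type} {c : R → ℝ → X} {ε : ℝ}

/-- In the punctured star the stratum of `K` is the disjoint union of the open rays along which the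
dilation group is `K`. -/
theorem card_connectedComponents (hs : StarNhd x c ε) {D : R → AddSubgroup G}
    (hD : ∀ r t, 0 < t → t < ε → S.dilation (c r t) = D r) (K : AddSubgroup G) :
    Nat.card (ConnectedComponents
      ↥({y : X | edist y x < ENNReal.ofReal ε ∧ y ≠ x} ∩ S.stratum K)) =
      Nat.card {r // D r = K} := by
  set A := {y : X | edist y x < ENNReal.ofReal ε ∧ y ≠ x} ∩ S.stratum K with hA
  have hmem : ∀ r t, 0 < t → t < ε → D r = K → c r t ∈ A := fun r t t0 t1 hr => by
    refine ⟨⟨?_, hs.ne r t0 t1⟩, (S.mem_stratum_iff _ _).2 ((hD r t t0 t1).trans hr)⟩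
    rw [edist_comm, hs.edist_eq r t t0.le t1]
    exact (ENNReal.ofReal_lt_ofReal_iff hs.pos).2 t1
  have hsub : ∀ r : {r // D r = K}, c r.1 '' Set.Ioo 0 ε ⊆ A := by
    rintro r _ ⟨t, ht, rfl⟩
    exact hmem _ _ ht.1 ht.2 r.2
  refine Nat.card_connectedComponents_of_isOpen
    (fun r : {r // D r = K} => (Subtype.val ⁻¹' (c r.1 '' Set.Ioo 0 ε) : Set A))
    (fun r => (hs.isOpen r.1).preimage continuous_subtype_val) (fun r => ?_) (fun r => ?_) ?_ ?_
  · have h1 : ε / 2 ∈ Set.Ioo 0 ε := ⟨by linarith [hs.pos], by linarith [hs.pos]⟩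
    exact ⟨⟨_, hsub r ⟨_, h1, rfl⟩⟩, _, h1, rfl⟩
  · rw [← Topology.IsInducing.subtypeVal.isPreconnected_image, Subtype.image_preimage_coe,
      Set.inter_eq_right.2 (hsub r)]
    exact isPreconnected_Ioo.image _ (hs.continuous r.1).continuousOn
  · rintro r s y ⟨a, ha, h1⟩ ⟨b, hb, h2⟩
    exact Subtype.ext (hs.inj _ _ a b ha.1 ha.2 hb.1 hb.2 (h1.trans h2.symm))
  · rintro ⟨y, hy⟩
    rcases hs.cover y (by rw [edist_comm]; exact hy.1.1) with h1 | ⟨r, t, t0, t1, rfl⟩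
    · exact absurd h1 hy.1.2
    · refine ⟨⟨r, ?_⟩, t, ⟨t0, t1⟩, rfl⟩
      rw [← hD r t t0 t1]
      exact (S.mem_stratum_iff _ _).1 hy.2

/-- The number of components is the same for every radius below `ε`, so the limit defining `index`
is this number. -/
theorem index_eq (hs : StarNhd x c ε) {D : R → AddSubgroup G}
    (hD : ∀ r t, 0 < t → t < ε → S.dilation (c r t) = D r) (K : AddSubgroup G) :
    S.index x K = Nat.card {r // D r = K} := by
  refine Tendsto.limUnder_eq (tendsto_const_nhds.congr' ?_)
  filter_upwards [Ioo_mem_nhdsGT (ENNReal.ofReal_pos.2 hs.pos)] with δ hδ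
  have h1 : δ ≠ ⊤ := (hδ.2.trans ENNReal.ofReal_lt_top).ne
  have h2 : 0 < δ.toReal := ENNReal.toReal_pos hδ.1.ne' h1
  have h3 : δ.toReal ≤ ε := ENNReal.toReal_le_of_le_ofReal hs.pos.le hδ.2.le
  have h4 := (hs.mono h2 h3).card_connectedComponents
    (fun r t t0 t1 => hD r t t0 (t1.trans_le h3)) K
  rw [ENNReal.ofReal_toReal h1] at h4
  exact h4.symm

/-- The genus formula in terms of the tangent directions. -/
theorem coverGenus_eq [Fintype R] (hs : StarNhd x c ε) {D : R → AddSubgroup G}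
    (hD : ∀ r t, 0 < t → t < ε → S.dilation (c r t) = D r) (hle : ∀ r, D r ≤ S.dilation x) :
    S.coverGenus x = (Nat.card (S.dilation x) : ℚ) * ((X.genus x : ℚ) - 1) + 1 +
      1 / 2 * ∑ r, ((Nat.card (S.dilation x) : ℚ) - ((D r).relIndex (S.dilation x) : ℚ)) := by
  classical
  unfold GStratification.coverGenus
  have hf : {K : AddSubgroup G | K ≤ S.dilation x}.Finite := Set.toFinite _
  -- The rays are grouped by their dilation group; a subgroup `K` that occurs on no ray contributes
  -- zero on both sides.
  rw [finsum_mem_eq_finite_toFinset_sum _ hf, ← Finset.sum_fiberwise_of_maps_to (g := D)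
    (t := hf.toFinset) fun r _ => hf.mem_toFinset.2 (hle r)]
  congr 2
  refine Finset.sum_congr rfl fun K _ => ?_
  rw [Finset.sum_congr rfl (g := fun _ => (Nat.card (S.dilation x) : ℚ) -
    (K.relIndex (S.dilation x) : ℚ)) fun r hr => by rw [(Finset.mem_filter.1 hr).2],
    Finset.sum_const, nsmul_eq_mul, hs.index_eq hD, Nat.card_eq_fintype_card,
    Fintype.card_subtype]

end StarNhd

namespace GStratification

variable {G : Type v} [AddCommGroup G] [Finite G] {X : TropicalCurve.{u}}
  {S : GStratification G X}

/-- An inner point has genus zero and two directions whose dilation group is that of the point. With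
`n = #D(x)` the formula gives `-n + 1 + ½ · 2(n - 1) = 0`. -/
theorem coverGenus_ray (F : S.FramedModel) {h : F.model.graph.H} {t : ℝ}
    (ht : F.model.graph.IsInner h t) : S.coverGenus (F.model.ray h t) = 0 := by
  obtain ⟨ε, e0, e1, e2⟩ := WeightedMetricGraph.exists_inner_bound ht
  have hD : ∀ (b : Bool) s, 0 < s → s < ε →
      S.dilation (F.model.ray h (t + if b then s else -s)) = F.datum.D h.1 := by
    intro b s s0 s1
    refine (F.datum_halfEdge ⟨?_, fun he => ?_⟩).symm
    · cases b
      · simp only [Bool.false_eq_true, if_false]; linarith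
      · simp only [if_true]; linarith
    · have := e2 he
      cases b
      · simp only [Bool.false_eq_true, if_false]; linarith
      · simp only [if_true]; linarith
  rw [(MetricModel.star_inner e0 h t e1 e2).coverGenus_eq hD
    (fun _ => (F.datum_halfEdge ht).le), F.datum_halfEdge ht, F.model.genus_ray ht]
  simp only [AddSubgroup.relIndex_self, Fintype.sum_bool, Nat.cast_zero, Nat.cast_one]
  ring

omit [Finite G] in
theorem FramedModel.datum_le_of_root (F : S.FramedModel) {h : F.model.graph.H}
    {w : F.model.graph.V} (hw : F.model.graph.root h.1 = w) : F.datum.D h.1 ≤ F.datum.D w.1 := by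
  subst hw
  exact F.datum.le_root _ h.2

theorem coverGenus_vert (F : S.FramedModel) (w : F.model.graph.V)
    [Fintype {h : F.model.graph.H // F.model.graph.root h.1 = w}] :
    S.coverGenus (F.model.vert w) = (Nat.card (F.datum.D w.1) : ℚ) *
      ((F.model.graph.genus w : ℚ) - 1) + 1 +
      1 / 2 * ∑ h : {h : F.model.graph.H // F.model.graph.root h.1 = w},
        ((Nat.card (F.datum.D w.1) : ℚ) - ((F.datum.D h.1.1).relIndex (F.datum.D w.1) : ℚ)) := by
  obtain ⟨ε, e0, e1⟩ := F.model.graph.exists_length_bound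
  have hle : ∀ h : {h : F.model.graph.H // F.model.graph.root h.1 = w},
      F.datum.D h.1.1 ≤ S.dilation (F.model.vert w) := fun h => by
    rw [← F.datum_vert]
    exact F.datum_le_of_root h.2
  rw [(MetricModel.star_vert e0 e1 w).coverGenus_eq (D := fun h => F.datum.D h.1.1)
    (fun h t t0 t1 => (F.datum_halfEdge ⟨t0, fun he => by linarith [e1 _ he]⟩).symm) hle,
    ← F.datum_vert]
  congr 4
  exact congrArg _ (F.model.genus_vert w)

end GStratification

namespace HarmonicMorphism

variable {Γ' Γ : WeightedMetricGraph} (φ : HarmonicMorphism Γ' Γ)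

theorem _root_.LegGraph.valency_eq_card (Γ : LegGraph) (w : Γ.V) :
    Γ.valency w = Nat.card {h : Γ.H // Γ.root h.1 = w} :=
  Nat.card_congr
    { toFun := fun h => ⟨⟨h.1, h.2.1⟩, Subtype.ext h.2.2⟩
      invFun := fun h => ⟨h.1.1, h.1.2, congrArg Subtype.val h.2⟩
      left_inv := fun _ => rfl
      right_inv := fun _ => rfl }

/-- The map on tangent directions. -/
def mapTangent (w : Γ'.V) (h : {h : Γ'.H // Γ'.root h.1 = w}) :
    {h : Γ.H // Γ.root h.1 = φ.mapV w} :=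
  ⟨φ.mapH h.1, Subtype.ext ((φ.map_r h.1.1).symm.trans
    (congrArg φ.toFun (congrArg Subtype.val h.2)))⟩

theorem deg_eq_card_mul (w : Γ'.V) (h : {h : Γ.H // Γ.root h.1 = φ.mapV w}) (n : ℕ)
    (hn : ∀ h' : Γ'.H, φ.mapH h' = h.1 → φ.deg h'.1 = n) :
    φ.deg w.1 = Nat.card {h' // φ.mapTangent w h' = h} * n := by
  rw [φ.harmonic w h.1.1 h.1.2 (congrArg Subtype.val h.2),
    finsum_mem_congr (g := fun _ => n) rfl fun h' hh' => hn ⟨h', hh'.1.1⟩ (Subtype.ext hh'.2),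
    finsum_mem_eq_finite_toFinset_sum _ (Set.toFinite _), Finset.sum_const, smul_eq_mul,
    ← Set.ncard_eq_toFinset_card]
  congr 1
  exact Nat.card_congr
    { toFun := fun h' => ⟨⟨⟨h'.1, h'.2.1.1⟩, Subtype.ext h'.2.1.2⟩,
        Subtype.ext (Subtype.ext h'.2.2)⟩
      invFun := fun h' => ⟨h'.1.1.1, ⟨h'.1.1.2, congrArg Subtype.val h'.1.2⟩,
        congrArg (fun k => k.1.1) h'.2⟩
      left_inv := fun _ => rfl
      right_inv := fun _ => rfl }

/-- The half-edges at `w` are sorted by their images among the half-edges at the vertex below. -/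
theorem valency_eq_sum (w : Γ'.V) [Fintype {h : Γ.H // Γ.root h.1 = φ.mapV w}] :
    Γ'.valency w = ∑ h, Nat.card {h' // φ.mapTangent w h' = h} := by
  have := Γ'.finite
  rw [LegGraph.valency_eq_card, ← Nat.card_sigma]
  exact Nat.card_congr (Equiv.sigmaFiberEquiv (φ.mapTangent w)).symm

end HarmonicMorphism

namespace GCover.HasStratification

variable {G : Type v} [AddCommGroup G] [Finite G] {X : TropicalCurve.{u}} {τ : GCover G X}
  {S : GStratification G X} (hS : τ.HasStratification S)
  {M' : τ.total.Model} {M : X.Model} {φ : HarmonicMorphism M'.graph M.graph}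

include hS

/-- The base of a model of a cover, as a framed model. -/
theorem exists_framedModel (h : IsModelOf τ.map τ.degree M' M φ) :
    ∃ F : S.FramedModel, F.model = M :=
  ⟨⟨M, fun H => (M.cellular_iff _).1 (by rw [hS H]; exact cellular_of_isModelOf h H),
    M.graph.nonempty_orientation.some⟩, rfl⟩

/-- The ramification degree measures the difference of the genus and its expected value. -/
theorem ram_eq (h : IsModelOf τ.map τ.degree M' M φ) (w : M'.graph.V) :
    (φ.ram w : ℚ) = 2 * (τ.total.genus (M'.vert w) - S.coverGenus (τ.map (M'.vert w))) := by
  classical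
  obtain ⟨F, rfl⟩ := hS.exists_framedModel h
  have := F.model.graph.finite
  let _ : Fintype {h : F.model.graph.H // F.model.graph.root h.1 = φ.mapV w} := Fintype.ofFinite _
  have hdeg : φ.deg w.1 = Nat.card (F.datum.D (φ.mapV w).1) := by
    rw [F.datum_vert, ← h.map_vert, hS.dilation_eq, ← τ.degree_eq_card]
    exact (h.deg_vert w).symm
  -- All half-edges over `k` have degree `#D(k)`, and `w` has degree `#D(v)` for the vertex `v`
  -- below it; harmonicity makes the index their number.
  have hn : ∀ k : {h : F.model.graph.H // F.model.graph.root h.1 = φ.mapV w},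
      Nat.card {h' // φ.mapTangent w h' = k} =
        (F.datum.D k.1.1).relIndex (F.datum.D (φ.mapV w).1) := by
    intro k
    have h1 := φ.deg_eq_card_mul w k (Nat.card (F.datum.D k.1.1)) fun h' hh' => by
      obtain ⟨t, ht⟩ := WeightedMetricGraph.exists_isInner h'
      rw [← h.degree_ray ht, τ.degree_eq_card, ← hS.dilation_eq, h.map_ray,
        ← F.datum_halfEdge (φ.isInner_map_iff.2 ht), hh']
    have h2 := F.datum_le_of_root k.2
    rw [hdeg, ← AddSubgroup.card_mul_relIndex h2, mul_comm] at h1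
    exact (Nat.eq_of_mul_eq_mul_right Nat.card_pos h1).symm
  have h1 := φ.valency_eq_sum w
  simp only [hn] at h1
  have h2 : Nat.card {h : F.model.graph.H // F.model.graph.root h.1 = φ.mapV w} =
      F.model.graph.valency (φ.mapV w) := (LegGraph.valency_eq_card _ _).symm
  rw [Nat.card_eq_fintype_card] at h2
  have h3 : τ.total.genus (M'.vert w) = M'.graph.genus w := M'.genus_vert w
  rw [h.map_vert, GStratification.coverGenus_vert, h3, Finset.sum_sub_distrib, Finset.sum_const,
    Finset.card_univ, h2, nsmul_eq_mul, ← Nat.cast_sum, ← h1]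
  unfold HarmonicMorphism.ram WeightedMetricGraph.euler
  push_cast
  rw [hdeg]
  ring

theorem coverGenus_of_isInner (h : IsModelOf τ.map τ.degree M' M φ) {k : M'.graph.H} {t : ℝ}
    (ht : M'.graph.IsInner k t) : S.coverGenus (τ.map (M'.ray k t)) = 0 := by
  obtain ⟨F, rfl⟩ := hS.exists_framedModel h
  rw [h.map_ray]
  exact GStratification.coverGenus_ray F (φ.isInner_map_iff.2 ht)

/-- At vertices this is `ram_eq`, and at inner points both sides vanish. The right side mentions no
model, so the condition holds in every model of the cover if it holds in one. -/
theorem unramified_iff :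
    τ.Unramified ↔ ∀ y, (τ.total.genus y : ℚ) = S.coverGenus (τ.map y) := by
  constructor
  · rintro ⟨M', M, φ, h, hu⟩ y
    rcases MetricModel.exists_rep (M := M') y with ⟨w, rfl⟩ | ⟨k, t, ht, rfl⟩
    · have h1 := hS.ram_eq h w
      rw [hu w, Int.cast_zero] at h1
      linarith
    · rw [hS.coverGenus_of_isInner h ht, M'.genus_ray ht, Nat.cast_zero]
  · intro h0
    obtain ⟨M', M, φ, h⟩ := τ.harmonic
    refine ⟨M', M, φ, h, fun w => ?_⟩
    have h1 := hS.ram_eq h w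
    rw [h0, sub_self, mul_zero] at h1
    exact_mod_cast h1

end GCover.HasStratification

/-! ### Classification of covers -/

namespace GCover

variable {G : Type v} [AddCommGroup G] {X : TropicalCurve.{u}} {S : GStratification G X}
  {τ τ₁ τ₂ : GCover G X}

theorem Iso.symm (h : Iso τ₁ τ₂) : Iso τ₂ τ₁ := (setoid G X).symm h

theorem Iso.hasStratification (h : Iso τ₁ τ₂) (hS : τ₁.HasStratification S) :
    τ₂.HasStratification S := by
  obtain ⟨ψ, -, -, h3, -, h5⟩ := h
  have hst : ∀ y, AddAction.stabilizer G (ψ y) = AddAction.stabilizer G y := fun y => by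
    ext g
    rw [AddAction.mem_stabilizer_iff, AddAction.mem_stabilizer_iff, ← h5,
      ψ.apply_eq_iff_eq]
  intro H
  rw [hS H]
  ext x
  constructor
  · rintro ⟨y, hy, hH⟩
    exact ⟨ψ y, by rw [h3, hy], by rwa [hst]⟩
  · rintro ⟨y, hy, hH⟩
    refine ⟨ψ.symm y, by rw [← h3, ψ.apply_symm_apply, hy], ?_⟩
    rwa [← hst, ψ.apply_symm_apply]

theorem Iso.hasClass (h : Iso τ₁ τ₂) {F : S.FramedModel} {c : F.H1} (hc : τ₁.HasClass F c) :
    τ₂.HasClass F c := by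
  obtain ⟨ψ, h1, -, h3, -, h5⟩ := h
  obtain ⟨η, ⟨y, σ, a, b, hy, hσ⟩, rfl⟩ := hc
  refine ⟨η, ⟨fun w => ψ (y w), fun e t => ψ (σ e t), a, b, fun w => by rw [h3, hy],
    fun e => ?_⟩, rfl⟩
  obtain ⟨s1, s2, s3, s4, s5⟩ := hσ e
  exact ⟨(Isometry.continuous h1).comp s1, fun t => by rw [h3, s2], (congrArg ψ s3).trans (h5 _ _),
    (congrArg ψ s4).trans (h5 _ _), s5⟩

theorem Iso.hasData (h : Iso τ₁ τ₂) {t : CoverData G X} (ht : τ₁.HasData t) : τ₂.HasData t := by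
  refine ⟨h.hasStratification ht.strat, h.hasClass ht.cls, fun y => ?_⟩
  obtain ⟨ψ, -, h2, h3, -, -⟩ := h
  obtain ⟨z, rfl⟩ := ψ.surjective y
  rw [h2, h3, ht.genus]

/-- A stratification is its family of subsets, the other fields being propositions, and the cover
determines these subsets. -/
theorem HasStratification.unique {S' : GStratification G X} (h : τ.HasStratification S)
    (h' : τ.HasStratification S') : S = S' := by
  have h1 : S.sub = S'.sub := funext fun H => (h H).trans (h' H).symm
  obtain ⟨s, _, _, _, _⟩ := S
  obtain ⟨s', _, _, _, _⟩ := S'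
  obtain rfl : s = s' := h1
  rfl

variable (τ) in
/-- The genus is constant on the fibers of a cover. -/
theorem exists_genus [Finite G] : ∃ g' : X → ℕ, (Function.support g').Finite ∧
    ∀ y, τ.total.genus y = g' (τ.map y) := by
  choose s hs using τ.surjective_map
  have h1 : ∀ y, τ.total.genus y = τ.total.genus (s (τ.map y)) := fun y => by
    obtain ⟨g, hg⟩ := τ.transitive (s (τ.map y)) y (hs _)
    rw [← hg, τ.genus_vadd, hg]
  obtain ⟨M, -⟩ := τ.harmonic
  refine ⟨fun x => τ.total.genus (s x), ?_, h1⟩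
  -- Positive genus upstairs occurs only at vertices of a model of the cover, so downstairs it
  -- occurs only at their finitely many images.
  refine (Set.finite_range fun w => τ.map (M.vert w)).subset fun x hx => ?_
  by_contra h0
  exact hx (M.genus_zero _ fun w hw => h0 ⟨w, (congrArg τ.map hw.symm).trans (hs x)⟩)

variable (τ) in
theorem exists_hasData [Finite G] : ∃ t, τ.HasData t := by
  obtain ⟨S, hS⟩ := τ.exists_hasStratification
  obtain ⟨c, hc⟩ := hS.exists_hasClass S.frame
  obtain ⟨g', hf, hg⟩ := τ.exists_genus
  exact ⟨⟨S, c, g', hf⟩, hS, hc, hg⟩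

theorem HasData.unique [Finite G] {t t' : CoverData G X} (h : τ.HasData t) (h' : τ.HasData t') :
    t = t' := by
  obtain ⟨S, c, g, hg⟩ := t
  obtain ⟨S', c', g', hg'⟩ := t'
  obtain rfl : S = S' := h.strat.unique h'.strat
  obtain rfl : c = c' := h.strat.hasClass_unique h.cls h'.cls
  obtain rfl : g = g' := funext fun x => by
    obtain ⟨y, rfl⟩ := τ.surjective_map x
    exact (h.genus y).symm.trans (h'.genus y)
  rfl

theorem HasData.iso [Finite G] {t : CoverData G X} (h₁ : τ₁.HasData t) (h₂ : τ₂.HasData t) :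
    Iso τ₁ τ₂ :=
  HasClass.iso h₁.strat h₂.strat h₁.cls h₂.cls fun y z hyz => by rw [h₁.genus, h₂.genus, hyz]

theorem HasData.unramified_iff [Finite G] {t : CoverData G X} (h : τ.HasData t) :
    τ.Unramified ↔ t.strat.Admissible ∧ ∀ x, (t.genus x : ℚ) = t.strat.coverGenus x := by
  rw [h.strat.unramified_iff, τ.surjective_map.forall]
  simp only [h.genus]
  refine ⟨fun h1 => ⟨fun x => ?_, h1⟩, fun h1 => h1.2⟩
  obtain ⟨y, rfl⟩ := τ.surjective_map x
  exact ⟨_, (h1 y).symm⟩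

end GCover

/-- Data exist and are unique for each cover and invariant under isomorphism. Covers with equal data
are isomorphic, and every triple is realized by a cover. -/
theorem exists_equiv_coverData (G : Type v) [AddCommGroup G] [Finite G] (X : TropicalCurve.{u}) :
    ∃ Φ : GCoverClass G X ≃ CoverData G X,
      ∀ (τ : GCover G X) (t : CoverData G X), Φ (Quotient.mk _ τ) = t ↔ τ.HasData t := by
  choose f hf using fun τ : GCover G X => τ.exists_hasData
  let Φ : GCoverClass G X → CoverData G X := Quotient.lift f fun τ₁ τ₂ h =>
    (hf τ₂).unique (GCover.Iso.hasData h (hf τ₁)) |>.symm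
  refine ⟨Equiv.ofBijective Φ ⟨?_, fun t => ?_⟩, fun τ t => ⟨?_, fun h => (hf τ).unique h⟩⟩
  · rintro ⟨τ₁⟩ ⟨τ₂⟩ (h : f τ₁ = f τ₂)
    exact Quotient.sound (GCover.HasData.iso (hf τ₁) (h ▸ hf τ₂))
  · obtain ⟨τ, h1, h2, h3⟩ := t.strat.frame.exists_cover_of_finite t.cls t.genus t.finite_support
    exact ⟨Quotient.mk _ τ, (hf τ).unique ⟨h1, h2, h3⟩⟩
  · rintro rfl
    exact hf τ

/-! ### Unramified covers and independence of the model -/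

namespace GStratification

variable {G : Type v} [AddCommGroup G] [Finite G] {X : TropicalCurve.{u}}
  {S : GStratification G X}

theorem finite_support_coverGenus : (Function.support S.coverGenus).Finite := by
  refine (Set.finite_range S.frame.model.vert).subset fun x hx => ?_
  rcases MetricModel.exists_rep (M := S.frame.model) x with ⟨w, rfl⟩ | ⟨h, t, ht, rfl⟩
  · exact ⟨w, rfl⟩
  · exact absurd (coverGenus_ray S.frame ht) hx

/-- An admissible stratification and a class determine a unique unramified cover. -/
theorem Admissible.exists_equiv (hS : S.Admissible) :
    ∃ Ψ : {c : GCoverClass G X // ∃ τ : GCover G X,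
        Quotient.mk _ τ = c ∧ τ.Unramified ∧ τ.HasStratification S} ≃ S.H1,
      ∀ (τ : GCover G X) (hu : τ.Unramified) (hs : τ.HasStratification S) (η : S.H1),
        Ψ ⟨Quotient.mk _ τ, τ, rfl, hu, hs⟩ = η ↔ τ.HasClass S.frame η := by
  -- Admissibility says exactly that the genus forced by the Riemann-Hurwitz condition is a function
  -- to the natural numbers. Its support is finite since `coverGenus` vanishes at inner points.
  choose g' hg' using hS
  have hf : (Function.support g').Finite := S.finite_support_coverGenus.subset fun x hx h0 =>
    hx (by exact_mod_cast (hg' x).symm.trans h0)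
  choose T s c g using fun η : S.H1 => S.frame.exists_cover_of_finite η g' hf
  have hT : ∀ η, (T η).Unramified := fun η => (s η).unramified_iff.2 fun y => by rw [g, hg']
  -- For an unramified cover the stratification already determines the genera, so the class alone
  -- determines the cover up to isomorphism.
  have hiso : ∀ {τ : GCover G X} {η : S.H1}, τ.Unramified → τ.HasStratification S →
      τ.HasClass S.frame η → GCover.Iso τ (T η) := fun hu hs hc =>
    GCover.HasClass.iso hs (s _) hc (c _) fun y z hyz => by
      have h1 := hs.unramified_iff.1 hu y
      rw [hyz, hg', ← g] at h1
      exact_mod_cast h1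
  let f : S.H1 → {c : GCoverClass G X // ∃ τ : GCover G X,
      Quotient.mk _ τ = c ∧ τ.Unramified ∧ τ.HasStratification S} := fun η =>
    ⟨Quotient.mk _ (T η), T η, rfl, hT η, s η⟩
  have hbij : Function.Bijective f := by
    constructor
    · intro η η' h
      have h1 : GCover.Iso (T η) (T η') := Quotient.exact (congrArg Subtype.val h)
      exact (s η').hasClass_unique (h1.hasClass (c η)) (c η')
    · rintro ⟨_, τ, rfl, hu, hs⟩
      obtain ⟨η, hη⟩ := hs.exists_hasClass S.frame
      exact ⟨η, Subtype.ext (Quotient.sound (hiso hu hs hη).symm)⟩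
  refine ⟨(Equiv.ofBijective f hbij).symm, fun τ hu hs η => ?_⟩
  rw [Equiv.symm_apply_eq]
  constructor
  · intro h
    have h1 : GCover.Iso τ (T η) := Quotient.exact (congrArg Subtype.val h)
    exact h1.symm.hasClass (c η)
  · exact fun h => Subtype.ext (Quotient.sound (hiso hu hs h))

namespace FramedModel

/-- A class is realized in `F` by a cover of genus zero, and the class of this cover is read off in
`F'`. By `HasClass.transfer` every other cover with the same class in `F` gives the same result. -/
theorem exists_map_H1 (F F' : S.FramedModel) : ∃ θ : F.H1 → F'.H1, ∀ τ : GCover G X,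
    τ.HasStratification S → ∀ c, τ.HasClass F c → τ.HasClass F' (θ c) := by
  choose T s hc _ using fun c : F.H1 => F.exists_cover_of_finite c (fun _ => 0)
    (by rw [Function.support_fun_zero]; exact Set.finite_empty)
  choose θ hθ using fun c => (s c).exists_hasClass F'
  exact ⟨θ, fun τ hs c h => GCover.HasClass.transfer (s c) hs (hc c) h (hθ c)⟩

/-- The dilated cohomology groups of two oriented models are isomorphic, compatibly with the
classes of covers. -/
theorem exists_addEquiv_H1 (F F' : S.FramedModel) : ∃ θ : F.H1 ≃+ F'.H1, ∀ τ : GCover G X,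
    τ.HasStratification S → ∀ c, τ.HasClass F c ↔ τ.HasClass F' (θ c) := by
  obtain ⟨θ, hθ⟩ := F.exists_map_H1 F'
  obtain ⟨ζ, hζ⟩ := F'.exists_map_H1 F
  have h0 : (Function.support fun _ : X => 0).Finite := by
    rw [Function.support_fun_zero]; exact Set.finite_empty
  -- A cover realizing `c` has both `c` and `ζ (θ c)` as its class in `F`, and classes are unique.
  have hinv : Function.LeftInverse ζ θ := fun c => by
    obtain ⟨τ, s, hc, -⟩ := F.exists_cover_of_finite c _ h0
    exact s.hasClass_unique (hζ τ s _ (hθ τ s _ hc)) hc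
  refine ⟨
    { toFun := θ
      invFun := ζ
      left_inv := hinv
      right_inv := fun c => ?_
      map_add' := fun c d => ?_ }, fun τ hs c => ⟨hθ τ hs c, fun h => ?_⟩⟩
  · obtain ⟨τ, s, hc, -⟩ := F'.exists_cover_of_finite c _ h0
    exact s.hasClass_unique (hθ τ s _ (hζ τ s _ hc)) hc
  -- Additivity is tested on three covers realizing `c`, `d` and `c + d`, for which
  -- `HasClass.add_transfer` gives the relation in `F'`.
  · obtain ⟨τ₁, s₁, h₁, -⟩ := F.exists_cover_of_finite c _ h0
    obtain ⟨τ₂, s₂, h₂, -⟩ := F.exists_cover_of_finite d _ h0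
    obtain ⟨τ₃, s₃, h₃, -⟩ := F.exists_cover_of_finite (c + d) _ h0
    exact s₃.hasClass_unique (hθ τ₃ s₃ _ h₃) (GCover.HasClass.add_transfer s₁ s₂ s₃ h₁ h₂ h₃
      (hθ τ₁ s₁ _ h₁) (hθ τ₂ s₂ _ h₂))
  · obtain ⟨c', hc'⟩ := hs.exists_hasClass F
    rwa [← hinv.injective (hs.hasClass_unique (hθ τ hs _ hc') h)]

end FramedModel

end GStratification

theorem mainTheorem1 (G : Type v) [AddCommGroup G] [Finite G] (X : TropicalCurve.{u}) :
    -- the classification of all covers, and of the unramified ones among them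
    (∃ Φ : GCoverClass G X ≃ CoverData G X,
      (∀ (τ : GCover G X) (t : CoverData G X), Φ (Quotient.mk _ τ) = t ↔ τ.HasData t) ∧
      ∀ τ : GCover G X, τ.Unramified ↔
        (Φ (Quotient.mk _ τ)).strat.Admissible ∧
          ∀ x, ((Φ (Quotient.mk _ τ)).genus x : ℚ) = (Φ (Quotient.mk _ τ)).strat.coverGenus x) ∧
    -- the unramified covers with a fixed admissible stratification
    (∀ S : GStratification G X, S.Admissible →
      ∃ Ψ : {c : GCoverClass G X // ∃ τ : GCover G X,
          Quotient.mk _ τ = c ∧ τ.Unramified ∧ τ.HasStratification S} ≃ S.H1,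
        ∀ (τ : GCover G X) (hu : τ.Unramified) (hs : τ.HasStratification S) (η : S.H1),
          Ψ ⟨Quotient.mk _ τ, τ, rfl, hu, hs⟩ = η ↔ τ.HasClass S.frame η) ∧
    -- neither the dilated cohomology group nor the class of a cover depends on the chosen model
    (∀ (S : GStratification G X) (F : S.FramedModel),
      ∃ θ : S.H1 ≃+ F.H1, ∀ τ : GCover G X, τ.HasStratification S →
        ∀ η : S.H1, τ.HasClass S.frame η ↔ τ.HasClass F (θ η)) := by
  refine ⟨?_, fun S hS => hS.exists_equiv, fun S F => S.frame.exists_addEquiv_H1 F⟩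
  obtain ⟨Φ, hΦ⟩ := exists_equiv_coverData G X
  exact ⟨Φ, hΦ, fun τ => ((hΦ τ _).1 rfl).unramified_iff⟩
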